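/- Let $(R,\mathfrak m,k)$ be a complete local ring (Noetherian, local, $\mathfrak m$-adically complete), let $G=\bigoplus_{i\ge 0}\mathfrak m^i/\mathfrak m^{i+1}$ be its associated graded ring, and let $\widehat G$ be the completion of $G$ at $G_+=\bigoplus_{i>0}\mathfrak m^i/\mathfrak m^{i+1}$. For a commutative ring $A$, let $S=A[[x_1,\dots,x_n]]$ and $T=S[[t]]$. For $0\ne f=\sum_j f_j\in S$ with $f_j$ homogeneous of degree $j$ in $x_1,\dots,x_n$, let $o(f)=\min\{j: f_j\neq 0\}$ and $\hom(f)=\sum_{i\ge 0} t^{i}f_{o(f)+i}\in T$; equivalently $t^{o(f)}\hom(f)=f(x_1t,\dots,x_nt)$. For an ideal $J\subseteq S$ let $\hom(J)=(\hom(f) : 0\neq f\in J)\subseteq T$. (a) Suppose that $R$ has equal characteristic. Then $R$ has a coefficient field (a copy of $k$ in $R$ that maps isomorphically onto $R/\mathfrak m$), and $R\cong k[[x_1,\dots,x_n]]/I$ as $k$-algebras with $n=\dim_k \mathfrak m/\mathfrak m^2$ and $I\subseteq (x_1,\dots,x_n)^2$. For every field $K$ contained in $R$ and every presentation $R\cong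 S/I$ as a $K$-algebra with $S=K[[x_1,\dots,x_n]]$, put $\hom(R)=T/\hom(I)$. Then $\hom(R)$ is a complete local ring, $t$ is a non-zero-divisor on $\hom(R)$, $\hom(R)$ is flat over $K[[t]]$, there is an isomorphism of $K$-algebras $\hom(R)/(t)\cong\widehat G$, and there is an isomorphism of $K((t))$-algebras $$\bigl(\hom(R)\otimes_{K[[t]]}K((t))\bigr)^{\wedge}\cong \bigl(R\otimes_K K((t))\bigr)^{\wedge},$$ where the completions are taken with respect to the extensions of $(x_1,\dots,x_n)$ and of $\mathfrak m$, respectively. (b) Suppose that $R$ has mixed characteristic, and let $p$ be the characteristic of $k$. Then there are a complete discrete valuation ring $V$ with maximal ideal $(p)$ and residue field $k$, and an isomorphism $R\cong Q/I$ with $Q=V[[x_2,\dots,x_n]]$ for some $n\ge 1$ and some ideal $I$ of $Q$. For every complete discrete valuation ring $V$ with maximal ideal $(p)$ such that $R$ is a $V$-algebra, and every presentation $R\cong Q/I$ as a $V$-algebra with $Q=V[[x_2,\dots,x_n]]$, $n\ge 1$, let $S=V[[x_1,\dots,x_n]]$, let $\pi:S\to Q$ be the $V$-algebra homomorphism with $x_1\mapsto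 p$ and $x_i\mapsto x_i$ for $i\ge 2$, and put $\hom(R)=T/\hom(\pi^{-1}(I))$. Then $\hom(R)$ is a complete local ring, $t$ is a non-zero-divisor on $\hom(R)$, there is an isomorphism of $V$-algebras $\hom(R)/(t)\cong\widehat G$, and there is an isomorphism of $V((t))$-algebras $$\bigl(\hom(R)\otimes_{V[[t]]}V((t))\bigr)^{\wedge}\cong \bigl(R\otimes_V V((t))\bigr)^{\wedge},$$ where the completions are taken with respect to the extensions of $(p,x_1,\dots,x_n)$ and of $\mathfrak m$, respectively. -/

import Mathlib

open IsLocalRing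
open scoped TensorProduct DirectSum

noncomputable section

namespace GroebnerDeformation

/-! ### The associated graded ring of an ideal and its completion -/

section AssociatedGraded

variable {R : Type*} [CommRing R]

/-- The `i`-th graded piece `I ^ i / I ^ (i + 1)`. -/
abbrev GrPiece (I : Ideal R) (i : ℕ) : Type _ :=
  ↥(I ^ i) ⧸ Submodule.comap (Submodule.subtype (I ^ i)) (I ^ (i + 1))

/-- The class in `I ^ i / I ^ (i + 1)` of an element of `I ^ i`. -/
def grMk (I : Ideal R) (i : ℕ) (x : R) (hx : x ∈ I ^ i) : GrPiece I i :=
  Submodule.Quotient.mk ⟨x, hx⟩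

variable {I : Ideal R}

theorem grMk_surj {i : ℕ} (a : GrPiece I i) : ∃ x, ∃ hx : x ∈ I ^ i, a = grMk I i x hx := by
  obtain ⟨⟨x, hx⟩, rfl⟩ := Submodule.Quotient.mk_surjective _ a
  exact ⟨x, hx, rfl⟩

theorem grMk_eq_iff {i : ℕ} {x y : R} (hx : x ∈ I ^ i) (hy : y ∈ I ^ i) :
    grMk I i x hx = grMk I i y hy ↔ x - y ∈ I ^ (i + 1) := by
  unfold grMk
  rw [Submodule.Quotient.eq]
  rfl

theorem grMk_add {i : ℕ} {x y : R} (hx : x ∈ I ^ i) (hy : y ∈ I ^ i) :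
    grMk I i x hx + grMk I i y hy = grMk I i (x + y) (add_mem hx hy) := rfl

theorem grMk_zero {i : ℕ} : (0 : GrPiece I i) = grMk I i 0 (zero_mem _) := rfl

theorem mul_mem_pow_add {i j : ℕ} {x y : R} (hx : x ∈ I ^ i) (hy : y ∈ I ^ j) :
    x * y ∈ I ^ (i + j) := by
  rw [pow_add]; exact Ideal.mul_mem_mul hx hy

/-- Multiplication of graded pieces: `[x] * [y] = [x * y]`. -/
def grMul {i j : ℕ} (a : GrPiece I i) (b : GrPiece I j) : GrPiece I (i + j) :=
  Quotient.liftOn₂' a b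
    (fun x y => grMk I (i + j) ((x : R) * (y : R)) (mul_mem_pow_add x.2 y.2)) (by
      rintro ⟨x, hx⟩ ⟨y, hy⟩ ⟨x', hx'⟩ ⟨y', hy'⟩ h₁ h₂
      have e₁ : x - x' ∈ I ^ (i + 1) := (grMk_eq_iff hx hx').1 (Quotient.sound' h₁)
      have e₂ : y - y' ∈ I ^ (j + 1) := (grMk_eq_iff hy hy').1 (Quotient.sound' h₂)
      rw [grMk_eq_iff]
      have e : x * y - x' * y' = (x - x') * y + x' * (y - y') := by ring
      simp only [e]
      refine add_mem ?_ ?_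
      · have := mul_mem_pow_add e₁ hy
        rwa [show i + 1 + j = i + j + 1 by omega] at this
      · have := mul_mem_pow_add hx' e₂
        rwa [← add_assoc] at this)

theorem grMul_mk {i j : ℕ} {x y : R} (hx : x ∈ I ^ i) (hy : y ∈ I ^ j) :
    grMul (grMk I i x hx) (grMk I j y hy) = grMk I (i + j) (x * y) (mul_mem_pow_add hx hy) :=
  rfl

theorem grMk_sigma_eq {i j : ℕ} (hij : i = j) {x y : R} (hx : x ∈ I ^ i) (hy : y ∈ I ^ j)
    (hxy : x = y) :
    (GradedMonoid.mk i (grMk I i x hx) : GradedMonoid (GrPiece I)) =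
      GradedMonoid.mk j (grMk I j y hy) := by
  subst hij hxy
  rfl

instance grGMul (I : Ideal R) : GradedMonoid.GMul (GrPiece I) where
  mul := grMul

instance grGOne (I : Ideal R) : GradedMonoid.GOne (GrPiece I) where
  one := grMk I 0 1 (by simp)

instance grGCommRing (I : Ideal R) : DirectSum.GCommRing (GrPiece I) where
  one_mul := by
    rintro ⟨i, a⟩
    obtain ⟨x, hx, rfl⟩ := grMk_surj a
    exact grMk_sigma_eq (zero_add i) _ _ (one_mul x)
  mul_one := by
    rintro ⟨i, a⟩
    obtain ⟨x, hx, rfl⟩ := grMk_surj a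
    exact grMk_sigma_eq (add_zero i) _ _ (mul_one x)
  mul_assoc := by
    rintro ⟨i, a⟩ ⟨j, b⟩ ⟨l, c⟩
    obtain ⟨x, hx, rfl⟩ := grMk_surj a
    obtain ⟨y, hy, rfl⟩ := grMk_surj b
    obtain ⟨z, hz, rfl⟩ := grMk_surj c
    exact grMk_sigma_eq (add_assoc i j l) _ _ (mul_assoc x y z)
  mul_comm := by
    rintro ⟨i, a⟩ ⟨j, b⟩
    obtain ⟨x, hx, rfl⟩ := grMk_surj a
    obtain ⟨y, hy, rfl⟩ := grMk_surj b
    exact grMk_sigma_eq (add_comm i j) _ _ (mul_comm x y)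
  mul_zero := by
    intro i j a
    obtain ⟨x, hx, rfl⟩ := grMk_surj a
    change grMul _ _ = _
    rw [grMk_zero, grMul_mk, grMk_zero]
    simp only [mul_zero]
  zero_mul := by
    intro i j b
    obtain ⟨x, hx, rfl⟩ := grMk_surj b
    change grMul _ _ = _
    rw [grMk_zero, grMul_mk, grMk_zero]
    simp only [zero_mul]
  mul_add := by
    intro i j a b c
    obtain ⟨x, hx, rfl⟩ := grMk_surj a
    obtain ⟨y, hy, rfl⟩ := grMk_surj b
    obtain ⟨z, hz, rfl⟩ := grMk_surj c
    change grMul _ _ = grMul _ _ + grMul _ _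
    simp only [grMk_add, grMul_mk, mul_add]
  add_mul := by
    intro i j a b c
    obtain ⟨x, hx, rfl⟩ := grMk_surj a
    obtain ⟨y, hy, rfl⟩ := grMk_surj b
    obtain ⟨z, hz, rfl⟩ := grMk_surj c
    change grMul _ _ = grMul _ _ + grMul _ _
    simp only [grMk_add, grMul_mk, add_mul]
  natCast m := grMk I 0 (m : R) (by simp)
  natCast_zero := by simp only [Nat.cast_zero]; rfl
  natCast_succ m := by simp only [Nat.cast_succ]; rfl
  intCast m := grMk I 0 (m : R) (by simp)
  intCast_ofNat m := by simp only [Int.cast_natCast]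
  intCast_negSucc_ofNat m := by simp only [Int.cast_negSucc]; rfl

/-- The associated graded ring `⨁ i, I ^ i / I ^ (i + 1)`. -/
def AssocGraded (I : Ideal R) : Type _ := ⨁ i, GrPiece I i

instance (I : Ideal R) : CommRing (AssocGraded I) :=
  inferInstanceAs (CommRing (⨁ i, GrPiece I i))

/-- The homogeneous element of `gr_I(R)` of degree `i` given by the class of `x ∈ I ^ i`. -/
def AssocGraded.of (I : Ideal R) (i : ℕ) (x : R) (hx : x ∈ I ^ i) : AssocGraded I :=
  DirectSum.of (GrPiece I) i (grMk I i x hx)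

theorem AssocGraded.of_mul_of (I : Ideal R) {i j : ℕ} {x y : R} (hx : x ∈ I ^ i)
    (hy : y ∈ I ^ j) :
    AssocGraded.of I i x hx * AssocGraded.of I j y hy =
      AssocGraded.of I (i + j) (x * y) (mul_mem_pow_add hx hy) :=
  DirectSum.of_mul_of (A := GrPiece I) (grMk I i x hx) (grMk I j y hy)

/-- The ring homomorphism `R → R / I = gr_I(R)_0 → gr_I(R)`. -/
def AssocGraded.ofBase (I : Ideal R) : R →+* AssocGraded I where
  toFun x := AssocGraded.of I 0 x (by simp)
  map_one' := rfl
  map_zero' := by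
    change DirectSum.of (GrPiece I) 0 (grMk I 0 0 _) = 0
    rw [← grMk_zero, map_zero]
  map_add' x y := by
    change DirectSum.of (GrPiece I) 0 (grMk I 0 (x + y) _) =
      DirectSum.of (GrPiece I) 0 (grMk I 0 x _) + DirectSum.of (GrPiece I) 0 (grMk I 0 y _)
    rw [← map_add]; rfl
  map_mul' x y := by
    change DirectSum.of (GrPiece I) 0 (grMk I 0 (x * y) _) =
      DirectSum.of (GrPiece I) 0 (grMk I 0 x _) * DirectSum.of (GrPiece I) 0 (grMk I 0 y _)
    rw [DirectSum.of_mul_of]; rfl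

/-- If `R` is an `A`-algebra, then so is `gr_I(R)`, through `A → R → R / I`. -/
instance {A : Type*} [CommRing A] [Algebra A R] (I : Ideal R) : Algebra A (AssocGraded I) :=
  ((AssocGraded.ofBase I).comp (algebraMap A R)).toAlgebra

/-- The ideal `G_+` of `G = gr_I(R)` generated by the homogeneous elements of positive degree. -/
def irrelevantIdeal (I : Ideal R) : Ideal (AssocGraded I) :=
  Ideal.span {y | ∃ i : ℕ, 0 < i ∧ ∃ a : GrPiece I i, y = DirectSum.of (GrPiece I) i a}

/-- The completion of `gr_I(R)` at `G_+`. -/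
abbrev CompletedGraded (I : Ideal R) : Type _ :=
  AdicCompletion (irrelevantIdeal I) (AssocGraded I)

end AssociatedGraded

/-! ### Complete local rings -/

/-- A complete local ring: Noetherian, local, and complete and separated in the topology of its
maximal ideal. -/
def IsCompleteLocalRing (R : Type*) [CommRing R] : Prop :=
  IsNoetherianRing R ∧ ∃ _ : IsLocalRing R, IsAdicComplete (maximalIdeal R) R

/-! ### Homogenization in `S = A[[x_1, ..., x_n]]`, with values in `T = S[[t]]` -/

section Homogenization

variable {A : Type*} [CommRing A] {n : ℕ}

/-- The ideal `(x_1, ..., x_n)` of `A[[x_1, ..., x_n]]`. -/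
def variablesIdeal (A : Type*) [CommRing A] (n : ℕ) : Ideal (MvPowerSeries (Fin n) A) :=
  Ideal.span (Set.range MvPowerSeries.X)

/-- The homomorphism `ψ : A[[x_1, ..., x_n]] → A[[x_1, ..., x_n]][[t]]` of `A`-algebras given by
the substitution `x_i ↦ x_i t`. -/
def psi (f : MvPowerSeries (Fin n) A) : PowerSeries (MvPowerSeries (Fin n) A) :=
  MvPowerSeries.subst
    (fun i => PowerSeries.C (MvPowerSeries.X i : MvPowerSeries (Fin n) A) * PowerSeries.X) f

/-- `hom(f) = t ^ (-o(f)) ψ(f) = ∑ i, f_{o(f) + i} t ^ i`, where `f_j` is the homogeneous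
component of `f` of degree `j` in the variables, and `o(f)` is the order of `f ≠ 0` (the least `j`
with `f_j ≠ 0`). -/
def homogenize (f : MvPowerSeries (Fin n) A) : PowerSeries (MvPowerSeries (Fin n) A) :=
  PowerSeries.mk fun i => MvPowerSeries.homogeneousComponent (f.order.toNat + i) f

theorem psi_eq_mk (f : MvPowerSeries (Fin n) A) :
    psi f = PowerSeries.mk fun j => MvPowerSeries.homogeneousComponent j f := by
  unfold psi
  have ha : MvPowerSeries.HasSubst (fun i : Fin n => (PowerSeries.C (MvPowerSeries.X i : MvPowerSeries (Fin n) A) * PowerSeries.X : PowerSeries (MvPowerSeries (Fin n) A))) := by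
    apply MvPowerSeries.hasSubst_of_constantCoeff_zero
    intro i
    change PowerSeries.constantCoeff _ = 0
    simp
  have hprod : ∀ (j : ℕ) (d : Fin n →₀ ℕ), PowerSeries.coeff j (d.prod fun s e => (PowerSeries.C (MvPowerSeries.X s : MvPowerSeries (Fin n) A) * PowerSeries.X) ^ e) = if d.degree = j then MvPowerSeries.monomial d (1:A) else 0 := by
    intro j d
    have : (d.prod fun s e => (PowerSeries.C (MvPowerSeries.X s : MvPowerSeries (Fin n) A) * PowerSeries.X) ^ e) = PowerSeries.C (MvPowerSeries.monomial d (1:A)) * PowerSeries.X ^ d.degree := by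
      rw [MvPowerSeries.monomial_one_eq]
      simp only [mul_pow, Finsupp.prod, map_prod, map_pow, Finset.prod_mul_distrib, Finset.prod_pow_eq_pow_sum]
      rfl
    rw [this, PowerSeries.coeff_C_mul, PowerSeries.coeff_X_pow]
    by_cases h : d.degree = j
    · simp [h]
    · rw [if_neg h, if_neg (Ne.symm h), mul_zero]
  have hfin := fun e => MvPowerSeries.coeff_subst_finite ha f e
  ext j e
  rw [PowerSeries.coeff_mk, PowerSeries.coeff, MvPowerSeries.coeff_subst ha]
  have h1 : ∀ d : Fin n →₀ ℕ, (MvPowerSeries.coeff (Finsupp.single () j)) (d.prod fun s e => (PowerSeries.C (MvPowerSeries.X s : MvPowerSeries (Fin n) A) * PowerSeries.X) ^ e) = if d.degree = j then MvPowerSeries.monomial d (1:A) else 0 := hprod j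
  have hf := hfin (Finsupp.single () j)
  have key : MvPowerSeries.coeff e (∑ᶠ d, MvPowerSeries.coeff d f • (MvPowerSeries.coeff (Finsupp.single () j)) (d.prod fun s e => (PowerSeries.C (MvPowerSeries.X s : MvPowerSeries (Fin n) A) * PowerSeries.X) ^ e)) = ∑ᶠ d, MvPowerSeries.coeff e (MvPowerSeries.coeff d f • (MvPowerSeries.coeff (Finsupp.single () j)) (d.prod fun s e => (PowerSeries.C (MvPowerSeries.X s : MvPowerSeries (Fin n) A) * PowerSeries.X) ^ e)) :=
    AddMonoidHom.map_finsum (MvPowerSeries.coeff (R := A) e).toAddMonoidHom hf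
  rw [key, finsum_eq_single _ e]
  · rw [h1, MvPowerSeries.coeff_homogeneousComponent]
    split_ifs <;> simp
  · intro d hd
    rw [h1]
    split_ifs
    · simp [MvPowerSeries.coeff_monomial, hd.symm]
    · simp

/-- The defining property `t ^ o(f) hom(f) = ψ(f)`. -/
theorem X_pow_mul_homogenize (f : MvPowerSeries (Fin n) A) :
    PowerSeries.X ^ f.order.toNat * homogenize f = psi f := by
  rw [psi_eq_mk, homogenize]
  refine PowerSeries.ext fun j => ?_
  rw [PowerSeries.coeff_X_pow_mul', PowerSeries.coeff_mk]
  split_ifs with h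
  · rw [PowerSeries.coeff_mk, Nat.add_sub_cancel' h]
  · rw [PowerSeries.coeff_mk]
    symm
    apply MvPowerSeries.homogeneousComponent_of_lt_order_eq_zero
    push Not at h
    exact lt_of_lt_of_le (by exact_mod_cast h) (ENat.natCast_toNat_le_self _)

/-- The ideal `hom(J)` of `T` generated by the `hom(f)` with `0 ≠ f ∈ J`. -/
def homIdeal (J : Ideal (MvPowerSeries (Fin n) A)) :
    Ideal (PowerSeries (MvPowerSeries (Fin n) A)) :=
  Ideal.span {F | ∃ f ∈ J, f ≠ 0 ∧ F = homogenize f}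

/-- The ring `T / hom(J)`. -/
abbrev HomRing (J : Ideal (MvPowerSeries (Fin n) A)) : Type _ :=
  PowerSeries (MvPowerSeries (Fin n) A) ⧸ homIdeal J

/-- The class of `t` in `T / hom(J)`. -/
def tElt (J : Ideal (MvPowerSeries (Fin n) A)) : HomRing J :=
  Ideal.Quotient.mk (homIdeal J) PowerSeries.X

end Homogenization

/-! ### The map `π : V[[x_1, ..., x_n]] → V[[x_2, ..., x_n]]` with `x_1 ↦ p` -/

section Evaluation

open scoped MvPowerSeries.WithPiTopology in
theorem hasEval_cons {A : Type*} [CommRing A] [TopologicalSpace A] [IsTopologicalRing A] (a : A) (ha : IsTopologicallyNilpotent a) (n : ℕ) :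
    MvPowerSeries.HasEval
      (Fin.cons (MvPowerSeries.C a) MvPowerSeries.X : Fin (n + 1) → MvPowerSeries (Fin n) A) where
  hpow := by
    refine Fin.cases ?_ (fun i => ?_)
    · rw [Fin.cons_zero]
      exact ha.map (φ := MvPowerSeries.C) MvPowerSeries.WithPiTopology.continuous_C
    · rw [Fin.cons_succ]
      exact MvPowerSeries.HasEval.X.hpow i
  tendsto_zero := by simp [Filter.cofinite_eq_bot]

open scoped MvPowerSeries.WithPiTopology in
theorem exists_evalFirst (A : Type*) [CommRing A] [IsLocalRing A]
    [IsAdicComplete (maximalIdeal A) A] (a : A) (ha : a ∈ maximalIdeal A) (n : ℕ) :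
    ∃ π : MvPowerSeries (Fin (n + 1)) A →ₐ[A] MvPowerSeries (Fin n) A,
      π (MvPowerSeries.X 0) = MvPowerSeries.C a ∧
        ∀ i : Fin n, π (MvPowerSeries.X i.succ) = MvPowerSeries.X i := by
  let _ : WithIdeal A := ⟨maximalIdeal A⟩
  have hadic : IsAdic (maximalIdeal A) := rfl
  obtain ⟨h1, h2⟩ := (IsAdic.isAdicComplete_iff hadic).1 inferInstance
  have : IsLinearTopology A A := by
    refine IsLinearTopology.mk_of_hasBasis A (p := fun _ : ℕ => True) (s := fun k => maximalIdeal A ^ k) ?_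
    exact (maximalIdeal A).hasBasis_nhds_zero_adic
  have hn : IsTopologicallyNilpotent a := by
    refine (maximalIdeal A).hasBasis_nhds_zero_adic.tendsto_right_iff.2 fun k _ => ?_
    filter_upwards [Filter.eventually_ge_atTop k] with m hm
    exact Ideal.pow_le_pow_right hm (Ideal.pow_mem_pow ha m)
  have he := hasEval_cons a hn n
  refine ⟨MvPowerSeries.aeval he, ?_, fun i => ?_⟩
  · have := MvPowerSeries.aeval_coe he (MvPolynomial.X 0 : MvPolynomial (Fin (n + 1)) A)
    simpa using this
  · have := MvPowerSeries.aeval_coe he (MvPolynomial.X i.succ : MvPolynomial (Fin (n + 1)) A)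
    simpa using this

/-- The `V`-algebra homomorphism `π : S = V[[x_1, x_2, ..., x_{n+1}]] → Q = V[[x_2, ..., x_{n+1}]]`
with `x_1 ↦ p` and `x_i ↦ x_i` for `i ≥ 2`, where `V` is a complete local ring with maximal ideal
`(p)`; these conditions determine it. The variables of `S` are numbered by `0, ..., n`, those of
`Q` by `0, ..., n - 1`. -/
def evalP {V : Type*} [CommRing V] [IsLocalRing V] [IsAdicComplete (maximalIdeal V) V] {p : ℕ}
    (hp : maximalIdeal V = Ideal.span {(p : V)}) (n : ℕ) :
    MvPowerSeries (Fin (n + 1)) V →ₐ[V] MvPowerSeries (Fin n) V :=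
  Classical.choose
    (exists_evalFirst V (p : V) (hp ▸ Ideal.mem_span_singleton_self (p : V)) n)

theorem evalP_X_zero {V : Type*} [CommRing V] [IsLocalRing V] [IsAdicComplete (maximalIdeal V) V]
    {p : ℕ} (hp : maximalIdeal V = Ideal.span {(p : V)}) (n : ℕ) :
    evalP hp n (MvPowerSeries.X 0) = MvPowerSeries.C (p : V) :=
  (Classical.choose_spec
    (exists_evalFirst V (p : V) (hp ▸ Ideal.mem_span_singleton_self (p : V)) n)).1

theorem evalP_X_succ {V : Type*} [CommRing V] [IsLocalRing V] [IsAdicComplete (maximalIdeal V) V]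
    {p : ℕ} (hp : maximalIdeal V = Ideal.span {(p : V)}) (n : ℕ) (i : Fin n) :
    evalP hp n (MvPowerSeries.X i.succ) = MvPowerSeries.X i :=
  (Classical.choose_spec
    (exists_evalFirst V (p : V) (hp ▸ Ideal.mem_span_singleton_self (p : V)) n)).2 i

end Evaluation

/-! ### Completed generic fibers -/

section GenericFiber

/-- `A((t))` as an `A`-algebra, with the coefficientwise scalar multiplication. -/
instance laurentAlgebra (A : Type*) [CommRing A] : Algebra A (LaurentSeries A) :=
  HahnSeries.instAlgebra

variable (A : Type*) [CommRing A] [IsLocalRing A]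

/-- The maximal ideal `𝔪_A S + (x_1, ..., x_n)` of `S = A[[x_1, ..., x_n]]`. -/
def bigIdeal (n : ℕ) : Ideal (MvPowerSeries (Fin n) A) :=
  (maximalIdeal A).map MvPowerSeries.C ⊔ variablesIdeal A n

variable {A} in
/-- The completion of `A((t)) ⊗_{A[[t]]} T / hom(J)` with respect to the extension of the ideal
`𝔪_A S + (x_1, ..., x_n)` of `S`. -/
abbrev CompletedGenericFiber {n : ℕ} (J : Ideal (MvPowerSeries (Fin n) A)) : Type _ :=
  AdicCompletion
    ((((bigIdeal A n).map PowerSeries.C).map (Ideal.Quotient.mk (homIdeal J))).map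
      (Algebra.TensorProduct.includeRight :
        HomRing J →ₐ[PowerSeries A] LaurentSeries A ⊗[PowerSeries A] HomRing J))
    (LaurentSeries A ⊗[PowerSeries A] HomRing J)

/-- The completion of `A((t)) ⊗_A R` with respect to the extension of the maximal ideal of the
local `A`-algebra `R`. -/
abbrev CompletedConstantFiber (R : Type*) [CommRing R] [IsLocalRing R] [Algebra A R] : Type _ :=
  AdicCompletion
    ((maximalIdeal R).map
      (Algebra.TensorProduct.includeRight : R →ₐ[A] LaurentSeries A ⊗[A] R))
    (LaurentSeries A ⊗[A] R)

end GenericFiber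

end GroebnerDeformation

end

universe u

noncomputable section

namespace GroebnerDeformation

/-! ### Formal smoothness of arbitrary extensions of perfect fields -/

section FormallySmooth

/-! The statements about hom(R) are all proved for a surjection ρ : S = A[[x]] → R of A-algebras
with 𝔪 = (x)R. In equal characteristic A = K and ρ is the given presentation. In mixed
characteristic ρ = q ∘ π: the extra variable sent to p makes the variables generate 𝔪, and π⁻¹(I) is
ker ρ. Write J = ker ρ.

Give x_i weight 1 and t weight -1. Then hom(f) is homogeneous of weight o(f) and becomes f at t = 1.
The key is `homIdeal_eq_weightIdeal`: F lies in hom(J) iff each weight component of F, evaluated at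
t = 1, lies in J. The components of a product, and F in terms of its components, are infinite sums;
they are truncated modulo powers of the maximal ideal, and closedness of ideals in a Noetherian
local ring (Krull) finishes the argument. Multiplication by t only shifts weights, so t is a
non-zero-divisor, and over the discrete valuation ring K[[t]] this gives flatness.

For the special fibre, send t to 0 and x_i to the class of ρ(x_i) in 𝔪/𝔪². This maps T onto Ĝ. A
series f ∈ S dies iff ρ(f_i) ∈ 𝔪^(i+1) for all i, that is, iff each f_i is the degree i part of some
element of J ∩ (x)^i. Hence the kernel is hom(J) + (t) (`ker_specialHom`).

For the generic fibre, ψ (x_i ↦ t x_i) induces A((t)) ⊗ R → A((t)) ⊗ T/hom(J) (`fiberHom`). The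
inverse substitution x_i ↦ t⁻¹ x_i makes sense only with values in the completion (`unscaleHom`).
The two together show that `fiberHom` is an isomorphism modulo all powers of the two ideals
(`nonempty_adicCompletion_algEquiv`).

Existence of presentations rests on formal smoothness of the residue field over its prime field. In
equal characteristic it lifts the residue field into R. In mixed characteristic it is applied
repeatedly to thin out the fibre product of R with the Witt vectors of the perfect closure of k. The
subrings so obtained intersect in a discrete valuation ring with uniformizer p that maps to R
(`exists_cohenRing`). Generators of 𝔪 then give the surjection from power series, by completeness.
-/

theorem ker_generators {R S ι : Type*} [CommRing R] [CommRing S] [Algebra R S]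
    (P : Algebra.Generators R S ι) :
    (P.toExtension.ker : Ideal (MvPolynomial ι R)) =
      RingHom.ker (MvPolynomial.aeval (R := R) P.val) :=
  P.ker_eq_ker_aeval_val

/-- In the basis dX_i of the cotangent space, the class of f goes to df, whose coordinates are the
evaluated partial derivatives. -/
theorem cotangentComplex_mk_eq_zero_iff {R S ι : Type*} [CommRing R] [CommRing S] [Algebra R S]
    (P : Algebra.Generators R S ι) (f : P.toExtension.ker) :
    P.toExtension.cotangentComplex (Algebra.Extension.Cotangent.mk f) = 0 ↔
      ∀ i, MvPolynomial.aeval P.val (MvPolynomial.pderiv i (f.1 : MvPolynomial ι R)) = 0 := by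
  have e := Algebra.Extension.cotangentComplex_mk (P := P.toExtension) f
  rw [e, ← EmbeddingLike.map_eq_zero_iff (f := P.cotangentSpaceBasis.repr), Finsupp.ext_iff]
  refine forall_congr' fun i => ?_
  exact Eq.congr_left (P.cotangentSpaceBasis_repr_one_tmul f.1 i)

/-- The vanishing of the first homology of the naive cotangent complex, in terms of a
presentation. -/
theorem subsingleton_h1Cotangent_iff {R S ι : Type*} [CommRing R] [CommRing S] [Algebra R S]
    (P : Algebra.Generators R S ι) :
    Subsingleton P.toExtension.H1Cotangent ↔
      ∀ f : MvPolynomial ι R, MvPolynomial.aeval P.val f = 0 →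
        (∀ i, MvPolynomial.aeval P.val (MvPolynomial.pderiv i f) = 0) →
        f ∈ RingHom.ker (MvPolynomial.aeval (R := R) P.val) ^ 2 := by
  rw [Algebra.Extension.subsingleton_h1Cotangent, injective_iff_map_eq_zero]
  have e := ker_generators P
  constructor
  · intro h f hf hd
    have hf' : f ∈ (P.toExtension.ker : Ideal (MvPolynomial ι R)) := by rw [e]; exact hf
    have := h (Algebra.Extension.Cotangent.mk ⟨f, hf'⟩)
      ((cotangentComplex_mk_eq_zero_iff P _).2 hd)
    rw [Algebra.Extension.Cotangent.mk_eq_zero_iff] at this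
    rw [← e]
    exact this
  · intro h x hx
    obtain ⟨⟨f, hf⟩, rfl⟩ := Algebra.Extension.Cotangent.mk_surjective x
    rw [cotangentComplex_mk_eq_zero_iff] at hx
    rw [Algebra.Extension.Cotangent.mk_eq_zero_iff]
    have key : ∀ I : Ideal (MvPolynomial ι R),
        I = RingHom.ker (MvPolynomial.aeval (R := R) P.val) → f ∈ I → f ∈ I ^ 2 := by
      rintro _ rfl hf
      exact h f hf hx
    exact key _ e hf

/-- Every extension of a perfect field is formally smooth. -/
theorem formallySmooth_of_perfectField (F K : Type*) [Field F] [Field K] [Algebra F K]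
    [PerfectField F] : Algebra.FormallySmooth F K := by
  -- Differentials over a field are automatically projective, so only the first homology matters.
  -- The presentation is the tautological one, with a variable for each element of K.
  refine ⟨inferInstance, (subsingleton_h1Cotangent_iff _).2 fun f hf hd => ?_⟩
  -- f involves finitely many variables, that is, finitely many elements of K. Over the subfield
  -- that they generate, the essentially finite type case applies, and membership in the square of
  -- the kernel is carried back to K by renaming variables.
  let K₀ := IntermediateField.adjoin F ((f.vars : Finset K) : Set K)
  have hfs : Algebra.FormallySmooth F K₀ := by
    have : Algebra.EssFiniteType F K₀ := IntermediateField.essFiniteType_iff.2 ⟨_, rfl⟩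
    exact .of_perfectField
  have hK₀ := (subsingleton_h1Cotangent_iff _).1 hfs.subsingleton_h1Cotangent
  change MvPolynomial.aeval (R := F) (fun x : K => x) f = 0 at hf
  change ∀ i, MvPolynomial.aeval (R := F) (fun x : K => x) (MvPolynomial.pderiv i f) = 0 at hd
  change f ∈ RingHom.ker (MvPolynomial.aeval (R := F) (fun x : K => x)) ^ 2
  change ∀ g : MvPolynomial K₀ F, MvPolynomial.aeval (fun x : K₀ => x) g = 0 → (∀ i,
    MvPolynomial.aeval (fun x : K₀ => x) (MvPolynomial.pderiv i g) = 0) → g ∈ RingHom.ker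
      (MvPolynomial.aeval (R := F) (fun x : K₀ => x)) ^ 2 at hK₀
  obtain ⟨g, hg⟩ := MvPolynomial.exists_rename_eq_of_vars_subset_range f ((↑) : K₀ → K)
    Subtype.val_injective (fun a ha => ⟨⟨a, IntermediateField.subset_adjoin _ _ ha⟩, rfl⟩)
  have haev : ∀ h : MvPolynomial K₀ F,
      MvPolynomial.aeval (fun x : K => x) (MvPolynomial.rename ((↑) : K₀ → K) h) =
      ((MvPolynomial.aeval (fun x : K₀ => x) h : K₀) : K) := by
    intro h
    rw [MvPolynomial.aeval_rename]
    exact (MvPolynomial.comp_aeval_apply (fun x : K₀ => x) K₀.val h).symm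
  rw [← hg] at hf hd ⊢
  have h2 := hK₀ g (by rw [← Subtype.coe_inj, ← haev, hf]; rfl) (fun i => by
    rw [← Subtype.coe_inj, ← haev, ← MvPolynomial.pderiv_rename Subtype.val_injective, hd]; rfl)
  have h3 := Ideal.mem_map_of_mem (MvPolynomial.rename (R := F) ((↑) : K₀ → K)) h2
  rw [Ideal.map_pow] at h3
  refine Ideal.pow_right_mono ?_ 2 h3
  rw [Ideal.map_le_iff_le_comap]
  intro h hh
  rw [RingHom.mem_ker] at hh
  rw [Ideal.mem_comap, RingHom.mem_ker, haev, hh]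
  rfl

end FormallySmooth

/-! ### Coefficient fields and coefficient rings -/

section CoefficientField

variable {R : Type*} [CommRing R] [IsLocalRing R] [IsAdicComplete (maximalIdeal R) R]

/-- Formal smoothness lifts the identity of the residue field successively along the quotients of R
by powers of 𝔪; completeness assembles the lifts. -/
theorem exists_coefficientField_of_perfectField (F : Type*) [Field F] [PerfectField F]
    [Algebra F R] : ∃ s : ResidueField R →+* R, ∀ a, residue R (s a) = a := by
  have := formallySmooth_of_perfectField F (ResidueField R)
  obtain ⟨g, hg⟩ := Algebra.FormallySmooth.exists_mkₐ_comp_eq_of_isAdicComplete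
    (R := F) (A := ResidueField R) (S := R) (I := maximalIdeal R) (AlgHom.id F (ResidueField R))
  exact ⟨g.toRingHom, fun a => congr($hg a)⟩

theorem exists_coefficientField (h : ringChar R = ringChar (ResidueField R)) :
    ∃ s : ResidueField R →+* R, ∀ a, residue R (s a) = a := by
  rcases CharP.char_is_prime_or_zero (ResidueField R) (ringChar (ResidueField R)) with hp | h0
  · have : Fact (ringChar (ResidueField R)).Prime := ⟨hp⟩
    have hR : CharP R (ringChar (ResidueField R)) := ringChar.of_eq h
    let _ : Algebra (ZMod (ringChar (ResidueField R))) R := ZMod.algebra R _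
    exact exists_coefficientField_of_perfectField (ZMod (ringChar (ResidueField R)))
  · have hk : CharP (ResidueField R) 0 := ringChar.of_eq h0
    have hk0 : CharZero (ResidueField R) := CharP.charP_to_charZero _
    -- A ring all of whose nonzero quotients have characteristic zero is a ℚ-algebra; here each such
    -- quotient maps to the residue field.
    have : ∀ I : Ideal R, I ≠ ⊤ → CharZero (R ⧸ I) := fun I hI =>
      have f : R ⧸ I →+* ResidueField R := Ideal.Quotient.factor (IsLocalRing.le_maximalIdeal hI)
      ⟨fun a b hab => Nat.cast_injective (R := ResidueField R) (by
        simpa using congr_arg f hab)⟩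
    obtain ⟨_⟩ := (EqualCharZero.nonempty_algebraRat_iff R).2 this
    exact exists_coefficientField_of_perfectField ℚ

end CoefficientField

/-! ### Construction of Cohen rings inside the fibre product of Witt vectors and R -/

section CohenRing

variable {W R κ : Type*} [CommRing W] [CommRing R] [IsLocalRing R] [CommRing κ]

/-- The filtration `p ^ n W × 𝔪 ^ n` of `W × R`. -/
def prodFiltration (p : ℕ) (W R : Type*) [CommRing W] [CommRing R] [IsLocalRing R] (n : ℕ) :
    Ideal (W × R) :=
  Ideal.prod (Ideal.span {(p : W) ^ n}) (maximalIdeal R ^ n)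

theorem mem_prodFiltration {p n : ℕ} {x : W × R} :
    x ∈ prodFiltration p W R n ↔ (p : W) ^ n ∣ x.1 ∧ x.2 ∈ maximalIdeal R ^ n := by
  rw [prodFiltration, Ideal.mem_prod, Ideal.mem_span_singleton]

theorem prodFiltration_antitone {p : ℕ} : Antitone (prodFiltration p W R) := by
  intro m n h x hx
  rw [mem_prodFiltration] at hx ⊢
  exact ⟨(pow_dvd_pow _ h).trans hx.1, Ideal.pow_le_pow_right h hx.2⟩

theorem mul_mem_prodFiltration {p m n : ℕ} {x y : W × R} (hx : x ∈ prodFiltration p W R m)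
    (hy : y ∈ prodFiltration p W R n) : x * y ∈ prodFiltration p W R (m + n) := by
  rw [mem_prodFiltration] at hx hy ⊢
  refine ⟨?_, mul_mem_pow_add hx.2 hy.2⟩
  rw [pow_add]
  exact mul_dvd_mul hx.1 hy.1

theorem prodFiltration_pow_le {p : ℕ} (n : ℕ) :
    prodFiltration p W R 1 ^ n ≤ prodFiltration p W R n := by
  induction n with
  | zero => intro x _; simp [mem_prodFiltration]
  | succ n ih =>
    rw [pow_succ]
    exact Ideal.mul_le.2 fun x hx y hy => mul_mem_prodFiltration (ih hx) hy

theorem natCast_mem_prodFiltration {p : ℕ} (hp : (p : R) ∈ maximalIdeal R) :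
    (p : W × R) ∈ prodFiltration p W R 1 := by
  rw [mem_prodFiltration]
  simpa using hp

/-- The residue class in the residue field of `R` of the second component. -/
def sndResidue (W R : Type*) [CommRing W] [CommRing R] [IsLocalRing R] :
    W × R →+* ResidueField R :=
  (residue R).comp (RingHom.snd W R)

/-- The fibre product of `w : W → κ` and `R → R / 𝔪 → κ`. -/
def fibreSubring (w : W →+* κ) (i : ResidueField R →+* κ) : Subring (W × R) :=
  RingHom.eqLocus (w.comp (RingHom.fst W R)) (i.comp (sndResidue W R))

/-- On the fibre product the two residues agree in κ, so a vanishing residue of the second component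
forces p to divide the first. Thus the kernel of the map to k is the first step of the filtration.
-/
theorem mem_prodFiltration_one_iff {p : ℕ} {w : W →+* κ} (hw : RingHom.ker w = Ideal.span {(p : W)})
    {i : ResidueField R →+* κ} {x : W × R} (hx : x ∈ fibreSubring w i) :
    sndResidue W R x = 0 ↔ x ∈ prodFiltration p W R 1 := by
  have hx' : w x.1 = i (sndResidue W R x) := hx
  rw [mem_prodFiltration, pow_one, pow_one, ← Ideal.mem_span_singleton, ← hw, RingHom.mem_ker, hx']
  constructor
  · intro h
    exact ⟨by rw [h, map_zero], (residue_eq_zero_iff _).1 h⟩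
  · rintro ⟨-, h⟩
    exact (residue_eq_zero_iff _).2 h

/-- The inductive step in the construction of a Cohen ring: it uses that the residue field is
formally smooth over its prime field. -/
theorem exists_subring_step {p : ℕ} [Fact p.Prime] (hp : (p : R) ∈ maximalIdeal R)
    {w : W →+* κ} (hw : RingHom.ker w = Ideal.span {(p : W)}) (i : ResidueField R →+* κ)
    (n : ℕ) (E : Subring (W × R)) (hE : E ≤ fibreSubring w i)
    (hN : ∀ x ∈ prodFiltration p W R (n + 1), x ∈ E)
    (hs : ∀ a, ∃ x ∈ E, sndResidue W R x = a) :
    ∃ E' : Subring (W × R), E' ≤ E ∧ (∀ x ∈ prodFiltration p W R (n + 2), x ∈ E') ∧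
      (∀ a, ∃ x ∈ E', sndResidue W R x = a) ∧ (∀ x ∈ E, (p : W × R) * x ∈ E') ∧
      ∀ x ∈ E', sndResidue W R x = 0 → ∃ z ∈ E, x - p * z ∈ prodFiltration p W R (n + 2) := by
  let N : Ideal E := (prodFiltration p W R (n + 2)).comap E.subtype
  -- Killing p makes E/q an algebra over the prime field; killing the filtration makes the kernel of
  -- E/q → k nilpotent. So k → k lifts to a section of E/q → k.
  let q : Ideal E := Ideal.span {(p : E)} ⊔ N
  have hpk : (p : ResidueField R) = 0 := by
    rw [← map_natCast (residue R)]; exact (residue_eq_zero_iff _).2 hp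
  let ρ : E ⧸ q →+* ResidueField R := Ideal.Quotient.lift q ((sndResidue W R).comp E.subtype) (by
    have : q ≤ RingHom.ker ((sndResidue W R).comp E.subtype) := by
      refine sup_le ?_ ?_
      · rw [Ideal.span_singleton_le_iff_mem, RingHom.mem_ker, map_natCast, hpk]
      · intro x hx
        refine (residue_eq_zero_iff _).2 ?_
        exact Ideal.pow_le_self (by omega) (mem_prodFiltration.1 hx).2
    exact this)
  have hρ : ∀ x : E, ρ (Ideal.Quotient.mk q x) = sndResidue W R x := fun x => rfl
  have hρs : Function.Surjective ρ := by
    intro a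
    obtain ⟨x, hx, rfl⟩ := hs a
    exact ⟨Ideal.Quotient.mk q ⟨x, hx⟩, rfl⟩
  have hntr : Nontrivial (E ⧸ q) := hρs.nontrivial
  have hcharQ : CharP (E ⧸ q) p := by
    rw [CharP.charP_iff_prime_eq_zero Fact.out, ← map_natCast (Ideal.Quotient.mk q),
      Ideal.Quotient.eq_zero_iff_mem]
    exact Ideal.mem_sup_left (Ideal.mem_span_singleton_self _)
  have hchark : CharP (ResidueField R) p := by
    rwa [CharP.charP_iff_prime_eq_zero Fact.out]
  let _ : Algebra (ZMod p) (E ⧸ q) := ZMod.algebra _ p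
  let _ : Algebra (ZMod p) (ResidueField R) := ZMod.algebra _ p
  have := formallySmooth_of_perfectField (ZMod p) (ResidueField R)
  let ρₐ : E ⧸ q →ₐ[ZMod p] ResidueField R := { ρ with
    commutes' := fun r => RingHom.congr_fun (RingHom.ext_zmod (ρ.comp (algebraMap _ _)) _) r }
  have hnil : IsNilpotent (RingHom.ker (ρₐ : E ⧸ q →+* ResidueField R)) := by
    let M : Ideal E := (prodFiltration p W R 1).comap E.subtype
    have hM : M ^ (n + 2) ≤ q := by
      refine ((Ideal.le_comap_pow _ _).trans (Ideal.comap_mono ?_)).trans le_sup_right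
      exact prodFiltration_pow_le (n + 2)
    have hk : RingHom.ker (ρₐ : E ⧸ q →+* ResidueField R) ≤ M.map (Ideal.Quotient.mk q) := by
      intro y hy
      obtain ⟨x, rfl⟩ := Ideal.Quotient.mk_surjective y
      exact Ideal.mem_map_of_mem _ ((mem_prodFiltration_one_iff hw (hE x.2)).1 hy)
    refine ⟨n + 2, le_bot_iff.1 ((Ideal.pow_right_mono hk _).trans ?_)⟩
    rw [← Ideal.map_pow]
    exact (Ideal.map_mono hM).trans (Ideal.map_quotient_self q).le
  let s := Algebra.FormallySmooth.liftOfSurjective (AlgHom.id (ZMod p) (ResidueField R)) ρₐ hρs hnil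
  have hsρ : ∀ a, ρ (s a) = a := fun a =>
    Algebra.FormallySmooth.liftOfSurjective_apply (AlgHom.id (ZMod p) (ResidueField R)) ρₐ hρs
      hnil a
  -- The preimage of the section: it still maps onto k, and the kernel of this map is now exactly q
  -- = pE + N.
  let E' : Subring (W × R) :=
    (Subring.comap (Ideal.Quotient.mk q) (s : ResidueField R →+* E ⧸ q).range).map E.subtype
  have hE' : ∀ x, x ∈ E' ↔ ∃ h : x ∈ E, ∃ a, s a = Ideal.Quotient.mk q ⟨x, h⟩ := by
    intro x
    constructor
    · rintro ⟨y, ⟨a, ha⟩, rfl⟩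
      exact ⟨y.2, a, ha⟩
    · rintro ⟨h, a, ha⟩
      exact ⟨⟨x, h⟩, ⟨a, ha⟩, rfl⟩
  refine ⟨E', fun x hx => ((hE' x).1 hx).1, fun x hx => ?_, fun a => ?_, fun x hx => ?_,
    fun x hx hx0 => ?_⟩
  · refine (hE' x).2 ⟨hN x (prodFiltration_antitone (by omega) hx), 0, ?_⟩
    rw [map_zero, eq_comm, Ideal.Quotient.eq_zero_iff_mem]
    exact Ideal.mem_sup_right hx
  · obtain ⟨x, hx⟩ := Ideal.Quotient.mk_surjective (s a)
    refine ⟨x, (hE' x).2 ⟨x.2, a, hx.symm⟩, ?_⟩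
    rw [← hρ, hx, hsρ]
  · refine (hE' _).2 ⟨mul_mem (natCast_mem E p) hx, 0, ?_⟩
    rw [map_zero, eq_comm, Ideal.Quotient.eq_zero_iff_mem]
    exact Ideal.mem_sup_left (Ideal.mul_mem_right (⟨x, hx⟩ : E) _
      (Ideal.mem_span_singleton_self (p : E)))
  · obtain ⟨hxE, a, ha⟩ := (hE' x).1 hx
    have ha0 : a = 0 := by rw [← hsρ a, ha, hρ, hx0]
    rw [ha0, map_zero, eq_comm, Ideal.Quotient.eq_zero_iff_mem] at ha
    obtain ⟨y, hy, z, hz, hyz⟩ := Submodule.mem_sup.1 ha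
    obtain ⟨u, rfl⟩ := Ideal.mem_span_singleton.1 hy
    refine ⟨u, u.2, ?_⟩
    have : x - p * u = (z : W × R) := by
      have := congr_arg Subtype.val hyz
      simp only [Subring.coe_add, Subring.coe_mul, Subring.coe_natCast] at this
      rw [← this]; ring
    rw [this]
    exact hz

/-- A descending sequence of subrings of `W ×_κ R` whose intersection is a Cohen ring. -/
structure CohenTower (p : ℕ) (w : W →+* κ) (i : ResidueField R →+* κ) where
  /-- The terms of the sequence. -/
  ring : ℕ → Subring (W × R)
  le_fibre : ∀ n, ring n ≤ fibreSubring w i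
  succ_le : ∀ n, ring (n + 1) ≤ ring n
  mem_of_filtration : ∀ n, ∀ x ∈ prodFiltration p W R (n + 1), x ∈ ring n
  surj : ∀ n a, ∃ x ∈ ring n, sndResidue W R x = a
  mul_mem : ∀ n, ∀ x ∈ ring n, (p : W × R) * x ∈ ring (n + 1)
  exists_sub_mem : ∀ n, ∀ x ∈ ring (n + 1), sndResidue W R x = 0 →
    ∃ z ∈ ring n, x - p * z ∈ prodFiltration p W R (n + 2)

/-- Start from the whole fibre product and iterate the inductive step by dependent choice. -/
theorem nonempty_cohenTower {p : ℕ} [Fact p.Prime] (hp : (p : R) ∈ maximalIdeal R)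
    {w : W →+* κ} (hws : Function.Surjective w) (hw : RingHom.ker w = Ideal.span {(p : W)})
    (i : ResidueField R →+* κ) : Nonempty (CohenTower p w i) := by
  let Good (n : ℕ) : Type _ := {E : Subring (W × R) // E ≤ fibreSubring w i ∧
    (∀ x ∈ prodFiltration p W R (n + 1), x ∈ E) ∧ ∀ a, ∃ x ∈ E, sndResidue W R x = a}
  have step : ∀ n (E : Good n), ∃ E' : Good (n + 1), E'.1 ≤ E.1 ∧
      (∀ x ∈ E.1, (p : W × R) * x ∈ E'.1) ∧
      ∀ x ∈ E'.1, sndResidue W R x = 0 → ∃ z ∈ E.1, x - p * z ∈ prodFiltration p W R (n + 2) := by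
    rintro n ⟨E, h1, h2, h3⟩
    obtain ⟨E', h4, h5, h6, h7, h8⟩ := exists_subring_step hp hw i n E h1 h2 h3
    exact ⟨⟨E', h4.trans h1, h5, h6⟩, h4, h7, h8⟩
  choose next hnext using step
  let base : Good 0 := ⟨fibreSubring w i, le_rfl, fun x hx => by
    have h := mem_prodFiltration.1 hx
    rw [zero_add, pow_one, pow_one] at h
    change w x.1 = i (residue R x.2)
    rw [← Ideal.mem_span_singleton, ← hw, RingHom.mem_ker] at h
    rw [h.1, (residue_eq_zero_iff _).2 h.2, map_zero], fun a => by
    obtain ⟨r, rfl⟩ := residue_surjective a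
    obtain ⟨y, hy⟩ := hws (i (residue R r))
    exact ⟨(y, r), hy, rfl⟩⟩
  let E : ∀ n, Good n := fun n => Nat.rec base next n
  exact ⟨{
    ring := fun n => (E n).1
    le_fibre := fun n => (E n).2.1
    succ_le := fun n => (hnext n (E n)).1
    mem_of_filtration := fun n => (E n).2.2.1
    surj := fun n => (E n).2.2.2
    mul_mem := fun n => (hnext n (E n)).2.1
    exists_sub_mem := fun n => (hnext n (E n)).2.2 }⟩

namespace CohenTower

variable {p : ℕ} {w : W →+* κ} {i : ResidueField R →+* κ} (C : CohenTower p w i)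

include C

theorem mem_filtration_of_fst_eq_zero [Nontrivial κ]
    (hw : RingHom.ker w = Ideal.span {(p : W)}) {n : ℕ} {r : R}
    (hr : ((0, r) : W × R) ∈ C.ring n) :
    sndResidue W R (0, r) = 0 ∧ ((0, r) : W × R) ∈ prodFiltration p W R 1 := by
  have h0 : w 0 = i (sndResidue W R (0, r)) := C.le_fibre n hr
  rw [map_zero, eq_comm, map_eq_zero_iff _ i.injective] at h0
  exact ⟨h0, (mem_prodFiltration_one_iff hw (C.le_fibre n hr)).1 h0⟩

/-- The terms of the tower are, up to the filtration, graphs of functions. -/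
theorem snd_mem_of_fst_eq_zero [IsDomain W] [Nontrivial κ] (hp0 : (p : W) ≠ 0)
    (hp : (p : R) ∈ maximalIdeal R) (hw : RingHom.ker w = Ideal.span {(p : W)}) (n : ℕ) :
    ∀ r : R, ((0, r) : W × R) ∈ C.ring n → r ∈ maximalIdeal R ^ (n + 1) := by
  induction n with
  | zero =>
    intro r hr
    simpa using (mem_prodFiltration.1 (C.mem_filtration_of_fst_eq_zero hw hr).2).2
  | succ n ih =>
    intro r hr
    obtain ⟨⟨y, s⟩, hz, hrz⟩ :=
      C.exists_sub_mem n _ hr (C.mem_filtration_of_fst_eq_zero hw hr).1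
    obtain ⟨h1, h2⟩ := mem_prodFiltration.1 hrz
    have hy : (p : W) ^ (n + 1) ∣ y := by
      have : (p : W) ^ (n + 2) ∣ p * y := by simpa using h1
      rw [pow_succ', mul_dvd_mul_iff_left hp0] at this
      exact this
    -- Since p is a non-zero-divisor in W, y is divisible by p^(n+1), so (y, 0) lies in the
    -- filtration step contained in the n-th ring and can be subtracted.
    have hs : ((0, s) : W × R) ∈ C.ring n := by
      have : ((0, s) : W × R) = (y, s) - (y, 0) := by simp
      rw [this]
      exact sub_mem hz (C.mem_of_filtration n _ (mem_prodFiltration.2 ⟨hy, zero_mem _⟩))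
    have e : r = (r - p * s) + p * s := by ring
    rw [e]
    refine add_mem (by simpa using h2) ?_
    rw [show n + 1 + 1 = 1 + (n + 1) by ring]
    exact mul_mem_pow_add (by simpa using hp) (ih s hs)

/-- Correct x by an element x' of a later ring with the same residue. Up to the filtration the
difference is p times an element one level down, which is approximated by induction; multiplication
by p gains one step. -/
theorem exists_approx (hp : (p : R) ∈ maximalIdeal R)
    (hw : RingHom.ker w = Ideal.span {(p : W)}) (n : ℕ) :
    ∀ x ∈ C.ring n, ∃ x' ∈ C.ring (n + 1), x - x' ∈ prodFiltration p W R (n + 1) := by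
  induction n with
  | zero =>
    intro x hx
    obtain ⟨x', hx', h⟩ := C.surj 1 (sndResidue W R x)
    refine ⟨x', hx', (mem_prodFiltration_one_iff hw
      (sub_mem (C.le_fibre _ hx) (C.le_fibre _ hx'))).1 ?_⟩
    rw [map_sub, h, sub_self]
  | succ n ih =>
    intro x hx
    obtain ⟨x', hx', h⟩ := C.surj (n + 2) (sndResidue W R x)
    obtain ⟨z, hz, hxz⟩ := C.exists_sub_mem n (x - x') (sub_mem hx (C.succ_le _ hx'))
      (by rw [map_sub, h, sub_self])
    obtain ⟨z', hz', hzz⟩ := ih z hz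
    refine ⟨x' + p * z', add_mem hx' (C.mul_mem _ _ hz'), ?_⟩
    have e : x - (x' + p * z') = (x - x' - p * z) + p * (z - z') := by ring
    rw [e]
    refine add_mem hxz ?_
    rw [show n + 1 + 1 = 1 + (n + 1) by ring]
    exact mul_mem_prodFiltration (natCast_mem_prodFiltration hp) hzz

/-- The Cohen ring cut out by the tower. -/
def limit : Subring (W × R) := ⨅ n, C.ring n

theorem mem_limit {x : W × R} : x ∈ C.limit ↔ ∀ n, x ∈ C.ring n := Subring.mem_iInf

end CohenTower

theorem exists_limit_of_cauchy {p : ℕ} [IsAdicComplete (Ideal.span {(p : W)}) W]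
    [IsAdicComplete (maximalIdeal R) R] (x : ℕ → W × R)
    (hx : ∀ n, x (n + 1) - x n ∈ prodFiltration p W R n) :
    ∃ y, ∀ n, y - x n ∈ prodFiltration p W R n := by
  have hx' : ∀ m n, m ≤ n → x n - x m ∈ prodFiltration p W R m := by
    intro m n h
    induction n, h using Nat.le_induction with
    | base => simp
    | succ n h ih =>
      have := add_mem (prodFiltration_antitone h (hx n)) ih
      rwa [sub_add_sub_cancel] at this
  obtain ⟨a, ha⟩ := IsPrecomplete.prec (I := Ideal.span {(p : W)}) inferInstance
    (f := fun n => (x n).1) (by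
      intro m n h
      rw [SModEq.comm, SModEq.sub_mem, smul_eq_mul, Ideal.mul_top, Ideal.span_singleton_pow,
        Ideal.mem_span_singleton]
      exact (mem_prodFiltration.1 (hx' m n h)).1)
  obtain ⟨b, hb⟩ := IsPrecomplete.prec (I := maximalIdeal R) inferInstance
    (f := fun n => (x n).2) (by
      intro m n h
      rw [SModEq.comm, SModEq.sub_mem, smul_eq_mul, Ideal.mul_top]
      exact (mem_prodFiltration.1 (hx' m n h)).2)
  refine ⟨(a, b), fun n => mem_prodFiltration.2 ⟨?_, ?_⟩⟩
  · have := ha n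
    rwa [SModEq.comm, SModEq.sub_mem, smul_eq_mul, Ideal.mul_top, Ideal.span_singleton_pow,
      Ideal.mem_span_singleton] at this
  · have := hb n
    rwa [SModEq.comm, SModEq.sub_mem, smul_eq_mul, Ideal.mul_top] at this

namespace CohenTower

variable {p : ℕ} {w : W →+* κ} {i : ResidueField R →+* κ} (C : CohenTower p w i)

include C

/-- Successive approximation of a lift of a gives a Cauchy sequence. Its limit lies in every term of
the tower because the n-th ring contains the (n+1)-st filtration step. -/
theorem limit_surj (hp : (p : R) ∈ maximalIdeal R) (hw : RingHom.ker w = Ideal.span {(p : W)})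
    [IsAdicComplete (Ideal.span {(p : W)}) W] [IsAdicComplete (maximalIdeal R) R]
    (a : ResidueField R) : ∃ x ∈ C.limit, sndResidue W R x = a := by
  obtain ⟨x₀, hx₀, rfl⟩ := C.surj 0 a
  choose f hf hf' using C.exists_approx hp hw
  let x : ∀ n, C.ring n := fun n => Nat.rec ⟨x₀, hx₀⟩ (fun n y => ⟨f n y y.2, hf n y y.2⟩) n
  have hx : ∀ n, (x (n + 1)).1 - (x n).1 ∈ prodFiltration p W R (n + 1) := fun n => by
    have : (x n).1 - (x (n + 1)).1 ∈ prodFiltration p W R (n + 1) := hf' n (x n) (x n).2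
    rwa [← neg_mem_iff, neg_sub] at this
  obtain ⟨y, hy⟩ := exists_limit_of_cauchy (fun n => (x n).1)
    (fun n => prodFiltration_antitone n.le_succ (hx n))
  have hy' : ∀ n, y - (x n).1 ∈ prodFiltration p W R (n + 1) := fun n => by
    rw [← sub_add_sub_cancel y (x (n + 1)).1]
    exact add_mem (hy (n + 1)) (hx n)
  refine ⟨y, C.mem_limit.2 fun n => ?_, ?_⟩
  · rw [← sub_add_cancel y (x n).1]
    exact add_mem (C.mem_of_filtration n _ (hy' n)) (x n).2
  · have h := (mem_prodFiltration.1 (hy' 0)).2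
    rw [zero_add, pow_one] at h
    have h' := (residue_eq_zero_iff _).2 h
    rw [Prod.snd_sub, map_sub, sub_eq_zero] at h'
    exact h'

/-- At each level x is p times some (c, s_n) up to the filtration. The s_n share the first
coordinate c, so the graph property `snd_mem_of_fst_eq_zero` makes them Cauchy, and the limit is the
required quotient. -/
theorem exists_eq_mul_of_mem_limit [Nontrivial κ] [IsAdicComplete (Ideal.span {(p : W)}) W]
    [IsAdicComplete (maximalIdeal R) R] [IsDomain W] (hp0 : (p : W) ≠ 0)
    (hp : (p : R) ∈ maximalIdeal R) (hw : RingHom.ker w = Ideal.span {(p : W)})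
    {x : W × R} (hx : x ∈ C.limit) (hpx : (p : W) ∣ x.1) : ∃ y ∈ C.limit, x = p * y := by
  obtain ⟨c, hc⟩ := hpx
  have hres : sndResidue W R x = 0 := by
    have h : w x.1 = i (sndResidue W R x) := C.le_fibre 0 (C.mem_limit.1 hx 0)
    have hpw : w p = 0 := by
      rw [← RingHom.mem_ker, hw]; exact Ideal.mem_span_singleton_self _
    rwa [hc, map_mul, hpw, zero_mul, eq_comm, map_eq_zero_iff _ i.injective] at h
  have key : ∀ n, ∃ s : R, (c, s) ∈ C.ring n ∧ x.2 - p * s ∈ maximalIdeal R ^ (n + 2) := by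
    intro n
    obtain ⟨z, hz, hxz⟩ := C.exists_sub_mem n x (C.mem_limit.1 hx _) hres
    obtain ⟨h1, h2⟩ := mem_prodFiltration.1 hxz
    refine ⟨z.2, ?_, by simpa using h2⟩
    have h3 : (p : W) ^ (n + 1) ∣ c - z.1 := by
      have : (p : W) ^ (n + 2) ∣ p * (c - z.1) := by
        rw [mul_sub, ← hc]; simpa using h1
      rwa [pow_succ', mul_dvd_mul_iff_left hp0] at this
    have e : (c, z.2) = z + (c - z.1, 0) := by ext <;> simp
    rw [e]
    exact add_mem hz (C.mem_of_filtration n _ (mem_prodFiltration.2 ⟨h3, zero_mem _⟩))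
  choose s hs hs' using key
  have hcauchy : ∀ n, ((c, s (n + 1)) : W × R) - (c, s n) ∈ prodFiltration p W R (n + 1) := by
    intro n
    have h0 : ((c, s (n + 1)) : W × R) - (c, s n) = (0, s (n + 1) - s n) := by simp
    have h1 : ((0, s (n + 1) - s n) : W × R) ∈ C.ring n := by
      rw [← h0]; exact sub_mem (C.succ_le _ (hs _)) (hs n)
    rw [h0]
    exact mem_prodFiltration.2 ⟨dvd_zero _, C.snd_mem_of_fst_eq_zero hp0 hp hw n _ h1⟩
  obtain ⟨y, hy⟩ := exists_limit_of_cauchy (fun n => ((c, s n) : W × R))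
    (fun n => prodFiltration_antitone n.le_succ (hcauchy n))
  have hy' : ∀ n, y.2 - s n ∈ maximalIdeal R ^ (n + 1) := fun n => by
    have := (mem_prodFiltration.1 (add_mem (hy (n + 1)) (hcauchy n))).2
    simpa using this
  refine ⟨(c, y.2), C.mem_limit.2 fun n => ?_, ?_⟩
  · have e : ((c, y.2) : W × R) = (c, s n) + (0, y.2 - s n) := by simp
    rw [e]
    exact add_mem (hs n)
      (C.mem_of_filtration n _ (mem_prodFiltration.2 ⟨dvd_zero _, hy' n⟩))
  · refine Prod.ext (by simpa using hc) ?_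
    simp only [Prod.snd_mul, Prod.snd_natCast]
    rw [← sub_eq_zero]
    refine IsHausdorff.haus (I := maximalIdeal R) inferInstance _ fun n => ?_
    rw [SModEq.zero, smul_eq_mul, Ideal.mul_top]
    have e : x.2 - p * y.2 = (x.2 - p * s n) - p * (y.2 - s n) := by ring
    rw [e]
    exact sub_mem (Ideal.pow_le_pow_right (by omega) (hs' n))
      (Ideal.mul_mem_left _ _ (Ideal.pow_le_pow_right (by omega) (hy' n)))

end CohenTower

end CohenRing

/-- Every complete local ring `R` of residue characteristic `p > 0` receives a map from a complete
discrete valuation ring with uniformizer `p`, inducing a surjection on residue fields. -/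
theorem exists_cohenRing {R : Type u} [CommRing R] [IsLocalRing R]
    [IsAdicComplete (maximalIdeal R) R] (p : ℕ) [Fact p.Prime] [CharP (ResidueField R) p] :
    ∃ (V : Type u) (_ : CommRing V) (_ : IsDomain V) (_ : IsDiscreteValuationRing V) (f : V →+* R),
      IsAdicComplete (maximalIdeal V) V ∧ maximalIdeal V = Ideal.span {(p : V)} ∧
        Function.Surjective (fun v => residue R (f v)) := by
  -- The residue field need not be perfect. Over its perfect closure the Witt vectors form a
  -- complete domain in which p generates the kernel of the map to κ.
  let κ := PerfectClosure (ResidueField R) p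
  let W := WittVector p κ
  let w : W →+* κ := WittVector.constantCoeff
  let i : ResidueField R →+* κ := PerfectClosure.of (ResidueField R) p
  have hw : RingHom.ker w = Ideal.span {(p : W)} := WittVector.ker_constantCoeff
  have hp : (p : R) ∈ maximalIdeal R := by
    rw [← residue_eq_zero_iff, map_natCast, CharP.cast_eq_zero]
  have hp0 : (p : W) ≠ 0 := (WittVector.irreducible (p := p) (k := κ)).ne_zero
  obtain ⟨C⟩ := nonempty_cohenTower hp
    (WittVector.constantCoeff_surjective p : Function.Surjective w) hw i
  let V := C.limit
  -- Divisibility by p in V can be tested in W, so V inherits p-adic separatedness and completeness,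
  -- and, being embedded in W, is a domain.
  have hVp : ∀ v : V, (p : W) ∣ v.1.1 → (p : V) ∣ v := by
    rintro v hv
    obtain ⟨y, hy, hvy⟩ := C.exists_eq_mul_of_mem_limit hp0 hp hw v.2 hv
    exact ⟨⟨y, hy⟩, Subtype.ext hvy⟩
  have hVpn : ∀ n (v : V), (p : W) ^ n ∣ v.1.1 → (p : V) ^ n ∣ v := by
    intro n
    induction n with
    | zero => intro v _; simp
    | succ n ih =>
      intro v hv
      obtain ⟨u, rfl⟩ := hVp v ((dvd_pow_self _ n.succ_ne_zero).trans hv)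
      rw [pow_succ']
      refine mul_dvd_mul_left _ (ih u ?_)
      have : (p : W) ^ (n + 1) ∣ p * u.1.1 := hv
      rwa [pow_succ', mul_dvd_mul_iff_left hp0] at this
  let φ : V →+* W := (RingHom.fst W R).comp V.subtype
  have hφ : Function.Injective φ := by
    rw [injective_iff_map_eq_zero]
    rintro ⟨⟨a, r⟩, hv⟩ (rfl : a = 0)
    have : r = 0 := by
      refine IsHausdorff.haus (I := maximalIdeal R) inferInstance _ fun n => ?_
      rw [SModEq.zero, smul_eq_mul, Ideal.mul_top]
      exact Ideal.pow_le_pow_right n.le_succ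
        (C.snd_mem_of_fst_eq_zero hp0 hp hw n r (C.mem_limit.1 hv n))
    subst this
    rfl
  have hdom : IsDomain V := hφ.isDomain φ
  let ρ : V →+* ResidueField R := (sndResidue W R).comp V.subtype
  have hρ : Function.Surjective ρ := fun a => by
    obtain ⟨x, hx, rfl⟩ := C.limit_surj hp hw a
    exact ⟨⟨x, hx⟩, rfl⟩
  have hker : RingHom.ker ρ = Ideal.span {(p : V)} := by
    ext v
    rw [Ideal.mem_span_singleton]
    constructor
    · intro hv
      refine hVp v ?_
      have := (mem_prodFiltration_one_iff hw (C.le_fibre 0 (C.mem_limit.1 v.2 0))).1 hv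
      simpa using (mem_prodFiltration.1 this).1
    · rintro ⟨u, rfl⟩
      rw [RingHom.mem_ker, map_mul, map_natCast, CharP.cast_eq_zero, zero_mul]
  have hmax : (Ideal.span {(p : V)}).IsMaximal := hker ▸ RingHom.ker_isMaximal_of_surjective ρ hρ
  have hcomp : IsAdicComplete (Ideal.span {(p : V)}) V := by
    refine { haus' := fun v hv => ?_, prec' := fun f hf => ?_ }
    · refine hφ (IsHausdorff.haus (I := Ideal.span {(p : W)}) inferInstance _ fun n => ?_)
      have := hv n
      rw [SModEq.zero, smul_eq_mul, Ideal.mul_top, Ideal.span_singleton_pow,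
        Ideal.mem_span_singleton] at this ⊢
      simpa using map_dvd φ this
    · have hf' : ∀ n, (p : V) ^ n ∣ f (n + 1) - f n := fun n => by
        have := hf (Nat.le_succ n)
        rwa [SModEq.comm, SModEq.sub_mem, smul_eq_mul, Ideal.mul_top, Ideal.span_singleton_pow,
          Ideal.mem_span_singleton] at this
      have hpf : ∀ n (v : V), (p : V) ^ n ∣ v → (v : W × R) ∈ prodFiltration p W R n := by
        rintro n _ ⟨u, rfl⟩
        exact Ideal.mul_mem_right _ _
          (prodFiltration_pow_le n (Ideal.pow_mem_pow (natCast_mem_prodFiltration hp) n))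
      obtain ⟨y, hy⟩ := exists_limit_of_cauchy (fun n => (f n : W × R))
        (fun n => hpf n _ (hf' n))
      have hyV : y ∈ C.limit := C.mem_limit.2 fun n => by
        rw [← sub_add_cancel y (f (n + 1) : W × R)]
        exact add_mem (C.mem_of_filtration n _ (hy (n + 1))) (C.mem_limit.1 (f (n + 1)).2 n)
      refine ⟨⟨y, hyV⟩, fun n => ?_⟩
      rw [SModEq.comm, SModEq.sub_mem, smul_eq_mul, Ideal.mul_top, Ideal.span_singleton_pow,
        Ideal.mem_span_singleton]
      exact hVpn n _ (mem_prodFiltration.1 (hy n)).1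
  have hloc : IsLocalRing V := isLocalRing_of_isAdicComplete_maximal (Ideal.span {(p : V)})
  have hmaxeq : maximalIdeal V = Ideal.span {(p : V)} := (eq_maximalIdeal hmax).symm
  have hpV : (p : V) ≠ 0 := fun h => hp0 (by simpa using congr_arg φ h)
  have hdvr : IsDiscreteValuationRing V := by
    have hprime : Prime (p : V) := (Ideal.span_singleton_prime hpV).1 hmax.isPrime
    refine IsDiscreteValuationRing.ofHasUnitMulPowIrreducibleFactorization
      ⟨p, hprime.irreducible, fun {x} hx => ?_⟩
    -- A nonzero element is not infinitely divisible by p, and the cofactor outside the maximal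
    -- ideal (p) is a unit.
    have hfin : FiniteMultiplicity (p : V) x := by
      by_contra hinf
      refine hx (IsHausdorff.haus (I := Ideal.span {(p : V)}) inferInstance _ fun n => ?_)
      rw [SModEq.zero, smul_eq_mul, Ideal.mul_top, Ideal.span_singleton_pow,
        Ideal.mem_span_singleton]
      exact FiniteMultiplicity.not_iff_forall.1 hinf n
    obtain ⟨u, hu, hxu⟩ := hfin.exists_eq_pow_mul_and_not_dvd
    rw [← Ideal.mem_span_singleton, ← hmaxeq, mem_maximalIdeal, mem_nonunits_iff, not_not] at hxu
    exact ⟨_, hxu.unit, hu.symm⟩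
  refine ⟨V, inferInstance, hdom, hdvr, (RingHom.snd W R).comp V.subtype, ?_, hmaxeq, hρ⟩
  rw [hmaxeq]
  exact hcomp

/-! ### Complete local rings and power series -/

section CompleteLocal

theorem isCompleteLocalRing_iff {B : Type*} [CommRing B] [hB : IsLocalRing B] :
    IsCompleteLocalRing B ↔ IsNoetherianRing B ∧ IsAdicComplete (maximalIdeal B) B :=
  ⟨fun ⟨h1, _, h2⟩ => ⟨h1, h2⟩, fun ⟨h1, h2⟩ => ⟨h1, hB, h2⟩⟩

theorem IsCompleteLocalRing.of_ringEquiv {B B' : Type*} [CommRing B] [CommRing B'] (e : B ≃+* B')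
    (h : IsCompleteLocalRing B) : IsCompleteLocalRing B' := by
  obtain ⟨h1, h2, h3⟩ := h
  have : IsLocalRing B' := e.isLocalRing
  refine ⟨isNoetherianRing_of_ringEquiv B e, this, ?_⟩
  rw [← IsAdicComplete.congr_ringEquiv (maximalIdeal B) e] at h3
  convert h3
  ext x
  rw [← Ideal.comap_symm, Ideal.mem_comap, mem_maximalIdeal, mem_maximalIdeal, mem_nonunits_iff,
    mem_nonunits_iff]
  simp

/-- Separatedness is Krull's theorem. For completeness, adic completion preserves surjections, so a
limit in the quotient lifts to one in B. -/
theorem IsCompleteLocalRing.quotient {B : Type*} [CommRing B] (h : IsCompleteLocalRing B)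
    {J : Ideal B} (hJ : J ≠ ⊤) : IsCompleteLocalRing (B ⧸ J) := by
  obtain ⟨h1, h2, h3⟩ := h
  have : Nontrivial (B ⧸ J) := Ideal.Quotient.nontrivial_iff.2 hJ
  have hloc : IsLocalRing (B ⧸ J) :=
    IsLocalRing.of_surjective' (Ideal.Quotient.mk J) Ideal.Quotient.mk_surjective
  refine ⟨inferInstance, hloc, ?_⟩
  have hmax : maximalIdeal (B ⧸ J) = (maximalIdeal B).map (algebraMap B (B ⧸ J)) :=
    (((local_hom_TFAE (Ideal.Quotient.mk J)).out 0 4 rfl rfl).1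
      (.of_surjective _ Ideal.Quotient.mk_surjective) ▸
      Ideal.map_comap_of_surjective _ Ideal.Quotient.mk_surjective _).symm
  rw [hmax, IsAdicComplete.map_algebraMap_iff]
  refine { toIsHausdorff := inferInstance, toIsPrecomplete := ?_ }
  rw [← AdicCompletion.of_surjective_iff]
  intro x
  obtain ⟨y, rfl⟩ := AdicCompletion.map_surjective (maximalIdeal B) (f := J.mkQ) J.mkQ_surjective x
  obtain ⟨z, rfl⟩ := AdicCompletion.of_surjective (maximalIdeal B) B y
  exact ⟨J.mkQ z, (AdicCompletion.map_of _ _ _).symm⟩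

/-- Ideals of a Noetherian local ring are closed. -/
theorem mem_of_forall_mem_sup_pow {B : Type*} [CommRing B] [IsLocalRing B] [IsNoetherianRing B]
    (J : Ideal B) {x : B} (h : ∀ N, x ∈ J ⊔ maximalIdeal B ^ N) : x ∈ J := by
  rw [← Ideal.Quotient.eq_zero_iff_mem]
  refine IsHausdorff.haus (I := maximalIdeal B) (M := B ⧸ J) inferInstance _ fun N => ?_
  obtain ⟨y, hy, z, hz, rfl⟩ := Submodule.mem_sup.1 (h N)
  rw [SModEq.zero, map_add, Ideal.Quotient.eq_zero_iff_mem.2 hy, zero_add,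
    show Ideal.Quotient.mk J z = z • (1 : B ⧸ J) by rw [Algebra.smul_def, mul_one]; rfl]
  exact Submodule.smul_mem_smul hz trivial

open PowerSeries in
-- Membership in powers of (I, t) is read off coefficientwise; the truncated subtraction makes the
-- condition empty for j ≥ k.
theorem mem_map_C_sup_X_pow_iff {B : Type*} [CommRing B] (I : Ideal B) (k : ℕ) (G : PowerSeries B) :
    G ∈ (I.map (C (R := B)) ⊔ Ideal.span {X}) ^ k ↔ ∀ j, coeff j G ∈ I ^ (k - j) := by
  constructor
  · intro hG
    induction k generalizing G with
    | zero => simp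
    | succ k ih =>
      have h1 : ∀ H ∈ I.map (C (R := B)) ⊔ Ideal.span {X}, coeff 0 H ∈ I := by
        intro H hH
        have : I.map (C (R := B)) ⊔ Ideal.span {X} ≤ I.comap (constantCoeff (R := B)) := by
          refine sup_le (Ideal.map_le_iff_le_comap.2 fun b hb => ?_) ?_
          · simpa using hb
          · rw [Ideal.span_singleton_le_iff_mem]; simp
        simpa using this hH
      rw [pow_succ] at hG
      refine Submodule.mul_induction_on hG (fun F hF H hH j => ?_) fun F H hF hH j => ?_
      · rw [coeff_mul]
        refine Ideal.sum_mem _ fun ⟨a, b⟩ hab => ?_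
        replace hab := Finset.HasAntidiagonal.mem_antidiagonal.1 hab
        simp only at hab ⊢
        rcases Nat.eq_zero_or_pos b with rfl | hb
        · have := mul_mem_pow_add (ih F hF a) (show coeff 0 H ∈ I ^ 1 by simpa using h1 H hH)
          exact Ideal.pow_le_pow_right (by omega) this
        · exact Ideal.mul_mem_right _ _ (Ideal.pow_le_pow_right (by omega) (ih F hF a))
      · rw [map_add]; exact add_mem (hF j) (hH j)
  · intro hG
    induction k generalizing G with
    | zero => simp
    | succ k ih =>
      rw [PowerSeries.eq_X_mul_shift_add_const G]
      refine add_mem ?_ ?_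
      · rw [pow_succ']
        refine Ideal.mul_mem_mul (Ideal.mem_sup_right (Ideal.mem_span_singleton_self _))
          (ih _ fun j => ?_)
        rw [coeff_mk]
        simpa using hG (j + 1)
      · refine Ideal.pow_right_mono le_sup_left _ ?_
        rw [← Ideal.map_pow]
        exact Ideal.mem_map_of_mem _ (by simpa using hG 0)

open PowerSeries in
theorem isAdicComplete_powerSeries {B : Type*} [CommRing B] (I : Ideal B) [IsAdicComplete I B] :
    IsAdicComplete (I.map (C (R := B)) ⊔ Ideal.span {X}) (PowerSeries B) where
  haus' := fun G hG => by
    ext j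
    refine IsHausdorff.haus (I := I) inferInstance _ fun n => ?_
    have := hG (n + j)
    rw [SModEq.zero, smul_eq_mul, Ideal.mul_top] at this ⊢
    simpa using (mem_map_C_sup_X_pow_iff I _ G).1 this j
  prec' := fun F hF => by
    have hF' : ∀ m n, m ≤ n → ∀ j, coeff j (F n) - coeff j (F m) ∈ I ^ (m - j) := by
      intro m n h j
      have := hF h
      rw [SModEq.comm, SModEq.sub_mem, smul_eq_mul, Ideal.mul_top, mem_map_C_sup_X_pow_iff] at this
      simpa using this j
    -- The power (I, t)^m controls the j-th coefficient only modulo I^(m-j), hence the shift of the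
    -- index by j.
    have h1 : ∀ j, ∃ a, ∀ n, a - coeff j (F (n + j)) ∈ I ^ n := by
      intro j
      obtain ⟨a, ha⟩ := IsPrecomplete.prec (I := I) (M := B) inferInstance
        (f := fun n => coeff j (F (n + j))) (fun {m n} h => by
          rw [SModEq.comm, SModEq.sub_mem, smul_eq_mul, Ideal.mul_top]
          simpa using hF' (m + j) (n + j) (by omega) j)
      refine ⟨a, fun n => ?_⟩
      have := ha n
      rwa [SModEq.comm, SModEq.sub_mem, smul_eq_mul, Ideal.mul_top] at this
    choose a ha using h1
    refine ⟨PowerSeries.mk a, fun n => ?_⟩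
    rw [SModEq.comm, SModEq.sub_mem, smul_eq_mul, Ideal.mul_top, mem_map_C_sup_X_pow_iff]
    intro j
    rw [map_sub, coeff_mk]
    rcases le_total n j with h | h
    · simp [h]
    · have := ha j (n - j)
      rwa [Nat.sub_add_cancel h] at this

open PowerSeries in
theorem maximalIdeal_powerSeries {B : Type*} [CommRing B] [IsLocalRing B]
    [IsLocalRing (PowerSeries B)] :
    maximalIdeal (PowerSeries B) = (maximalIdeal B).map C ⊔ Ideal.span {X} := by
  ext G
  rw [← pow_one ((maximalIdeal B).map C ⊔ Ideal.span {X}), mem_map_C_sup_X_pow_iff,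
    mem_maximalIdeal, mem_nonunits_iff, PowerSeries.isUnit_iff_constantCoeff]
  constructor
  · intro h j
    rcases j with - | j
    · simpa using h
    · simp
  · intro h
    simpa using h 0

theorem IsCompleteLocalRing.powerSeries {B : Type*} [CommRing B] (h : IsCompleteLocalRing B) :
    IsCompleteLocalRing (PowerSeries B) := by
  obtain ⟨h1, h2, h3⟩ := h
  have hloc : IsLocalRing (PowerSeries B) := inferInstanceAs (IsLocalRing (MvPowerSeries Unit B))
  refine ⟨inferInstance, hloc, ?_⟩
  rw [maximalIdeal_powerSeries]
  exact isAdicComplete_powerSeries _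

theorem IsCompleteLocalRing.mvPowerSeries {B : Type*} [CommRing B] (h : IsCompleteLocalRing B)
    (n : ℕ) : IsCompleteLocalRing (MvPowerSeries (Fin n) B) := by
  induction n with
  | zero => exact h.of_ringEquiv (MvPowerSeries.isEmptyEquiv (Fin 0) B).toRingEquiv.symm
  | succ n ih => exact ih.powerSeries.of_ringEquiv (MvPowerSeries.finSuccEquiv B n).toRingEquiv.symm

end CompleteLocal

/-! ### Powers of the ideal of variables, evaluation of power series, and exchange of x and t -/

section Variables

variable {A : Type*} [CommRing A] {n : ℕ}

theorem mem_variablesIdeal_pow_iff {k : ℕ} {f : MvPowerSeries (Fin n) A} :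
    f ∈ variablesIdeal A n ^ k ↔ ∀ e, e.degree < k → MvPowerSeries.coeff e f = 0 := by
  constructor
  · intro hf
    induction k generalizing f with
    | zero => simp
    | succ k ih =>
      have h1 : ∀ g ∈ variablesIdeal A n, MvPowerSeries.coeff 0 g = 0 := by
        intro g hg
        have : variablesIdeal A n ≤ RingHom.ker (MvPowerSeries.constantCoeff (σ := Fin n) (R := A)) := by
          rw [variablesIdeal, Ideal.span_le]
          rintro _ ⟨i, rfl⟩
          simp
        simpa using this hg
      rw [pow_succ] at hf
      refine Submodule.mul_induction_on hf (fun g hg h hh e he => ?_) fun g h hg hh e he => ?_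
      · rw [MvPowerSeries.coeff_mul]
        refine Finset.sum_eq_zero fun ⟨a, b⟩ hab => ?_
        replace hab := Finset.HasAntidiagonal.mem_antidiagonal.1 hab
        simp only at hab ⊢
        by_cases hb : b = 0
        · rw [hb, h1 h hh, mul_zero]
        · have hb' : b.degree ≠ 0 := by simpa [Finsupp.degree_eq_zero_iff] using hb
          have : a.degree + b.degree = e.degree := by rw [← hab, map_add]
          rw [ih hg a (by omega), zero_mul]
      · rw [map_add, hg e he, hh e he, add_zero]
  · intro hf
    induction k generalizing f with
    | zero => simp
    | succ k ih =>
      -- Each nonconstant monomial of f is charged to the first variable occurring in it, and g i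
      -- collects the quotients of the monomials charged to x_i.
      let g : Fin n → MvPowerSeries (Fin n) A := fun i e =>
        if ∀ j < i, e j = 0 then MvPowerSeries.coeff (e + Finsupp.single i 1) f else 0
      have hg : ∀ i e, MvPowerSeries.coeff e (g i) =
        if ∀ j < i, e j = 0 then MvPowerSeries.coeff (e + Finsupp.single i 1) f else 0 :=
          fun i e => rfl
      have hfg : f = ∑ i, MvPowerSeries.X i * g i := by
        ext e
        have hX : ∀ i, MvPowerSeries.coeff e (MvPowerSeries.X i * g i) =
            if e i ≠ 0 ∧ ∀ j < i, e j = 0 then MvPowerSeries.coeff e f else 0 := by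
          intro i
          rw [MvPowerSeries.X, MvPowerSeries.coeff_monomial_mul, one_mul, hg]
          by_cases hi : e i = 0
          · rw [if_neg, if_neg (by simp [hi])]
            intro h
            have := h i
            simp [hi] at this
          · have hle : Finsupp.single i 1 ≤ e := by
              simpa [Nat.one_le_iff_ne_zero] using hi
            rw [if_pos hle, tsub_add_cancel_of_le hle]
            refine if_congr ?_ rfl rfl
            rw [and_iff_right hi]
            refine forall₂_congr fun j hj => ?_
            simp [hj.ne']
        rw [map_sum, Finset.sum_congr rfl fun i _ => hX i]
        by_cases he : ∃ i, e i ≠ 0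
        · have hmin : ∃ i, e i ≠ 0 ∧ ∀ j < i, e j = 0 := by
            obtain ⟨i, hi, hm⟩ := WellFounded.has_min (wellFounded_lt (α := Fin n))
              {i | e i ≠ 0} he
            exact ⟨i, hi, fun j hj => by_contra fun h => hm j h hj⟩
          obtain ⟨i, hi⟩ := hmin
          rw [Finset.sum_eq_single i, if_pos hi]
          · intro j _ hj
            rw [if_neg]
            rintro ⟨h1, h2⟩
            rcases lt_or_gt_of_ne hj with h | h
            · exact h1 (hi.2 j h)
            · exact hi.1 (h2 i h)
          · simp
        · push Not at he
          have : e = 0 := by ext i; exact he i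
          subst this
          simpa using hf 0 (by simp)
      rw [hfg, pow_succ']
      refine Ideal.sum_mem _ fun i _ => Ideal.mul_mem_mul (Ideal.subset_span ⟨i, rfl⟩)
        (ih fun e he => ?_)
      rw [hg]
      split_ifs
      · exact hf _ (by simpa [Finsupp.degree_single] using he)
      · rfl

theorem aeval_mem_pow {σ A B : Type*} [CommRing A] [CommRing B] [Algebra A B] {I : Ideal B}
    {y : σ → B} (hy : ∀ i, y i ∈ I) {N : ℕ} {f : MvPolynomial σ A}
    (hf : f ∈ MvPolynomial.idealOfVars σ A ^ N) : MvPolynomial.aeval y f ∈ I ^ N := by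
  have h : (MvPolynomial.idealOfVars σ A).map (MvPolynomial.aeval y) ≤ I := by
    rw [Ideal.map_span, Ideal.span_le]
    rintro _ ⟨_, ⟨i, rfl⟩, rfl⟩
    simpa using hy i
  refine Ideal.pow_right_mono h N ?_
  rw [← Ideal.map_pow]
  exact Ideal.mem_map_of_mem _ hf

/-- The evaluation of power series at topologically nilpotent elements modulo `I ^ N`. -/
def evalMod {σ A B : Type*} [Finite σ] [CommRing A] [CommRing B] [Algebra A B] (I : Ideal B)
    (y : σ → B) (hy : ∀ i, y i ∈ I) (N : ℕ) : MvPowerSeries σ A →ₐ[A] B ⧸ I ^ N :=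
  (Ideal.Quotient.liftₐ (MvPolynomial.idealOfVars σ A ^ N)
    ((Ideal.Quotient.mkₐ A (I ^ N)).comp (MvPolynomial.aeval y)) (fun a ha => by
      simpa using Ideal.Quotient.eq_zero_iff_mem.2 (aeval_mem_pow hy ha))).comp
    ((MvPowerSeries.truncTotalAlgHom σ A N).restrictScalars A)

theorem evalMod_apply {σ A B : Type*} [Finite σ] [CommRing A] [CommRing B] [Algebra A B]
    (I : Ideal B) (y : σ → B) (hy : ∀ i, y i ∈ I) (N : ℕ) (f : MvPowerSeries σ A) :
    evalMod I y hy N f =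
      Ideal.Quotient.mk (I ^ N) (MvPolynomial.aeval y (MvPowerSeries.truncTotal N f)) :=
  rfl

theorem evalMod_compatible {σ A B : Type*} [Finite σ] [CommRing A] [CommRing B] [Algebra A B]
    (I : Ideal B) (y : σ → B) (hy : ∀ i, y i ∈ I) {m n : ℕ} (h : m ≤ n) :
    (Ideal.Quotient.factorₐ A (Ideal.pow_le_pow_right h)).comp (evalMod (A := A) I y hy n) =
      evalMod I y hy m := by
  ext f
  have := aeval_mem_pow hy (MvPowerSeries.truncTotal_sub_truncTotal_mem_pow_idealOfVars h le_rfl f)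
  rw [map_sub] at this
  rw [AlgHom.comp_apply, evalMod_apply, evalMod_apply]
  exact (Ideal.Quotient.eq).2 this

/-- The evaluation of power series at topologically nilpotent elements, with values in an adic
completion. -/
def evalHat {σ A B : Type*} [Finite σ] [CommRing A] [CommRing B] [Algebra A B] (I : Ideal B)
    (y : σ → B) (hy : ∀ i, y i ∈ I) : MvPowerSeries σ A →ₐ[A] AdicCompletion I B :=
  AdicCompletion.liftAlgHom I (evalMod I y hy) (evalMod_compatible I y hy)

theorem evalₐ_evalHat {σ A B : Type*} [Finite σ] [CommRing A] [CommRing B] [Algebra A B]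
    (I : Ideal B) (y : σ → B) (hy : ∀ i, y i ∈ I) (N : ℕ) (f : MvPowerSeries σ A) :
    AdicCompletion.evalₐ I N (evalHat I y hy f) =
      Ideal.Quotient.mk (I ^ N) (MvPolynomial.aeval y (MvPowerSeries.truncTotal N f)) :=
  AdicCompletion.evalₐ_liftAlgHom I _ (evalMod_compatible I y hy) N f

theorem evalHat_coe {σ A B : Type*} [Finite σ] [CommRing A] [CommRing B] [Algebra A B]
    (I : Ideal B) (y : σ → B) (hy : ∀ i, y i ∈ I) (f : MvPolynomial σ A) :
    evalHat I y hy (f : MvPowerSeries σ A) = AdicCompletion.of I B (MvPolynomial.aeval y f) := by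
  refine AdicCompletion.ext_evalₐ fun N => ?_
  rw [evalₐ_evalHat, AdicCompletion.evalₐ_of, Ideal.Quotient.eq, ← map_sub]
  refine aeval_mem_pow hy ((MvPolynomial.mem_pow_idealOfVars_iff' _ _).2 fun e he => ?_)
  simp [MvPowerSeries.coeff_truncTotal _ he]

/-- The coefficients of a power series in `A[[x]][[t]]`, rearranged to a power series in
`A[[t]][[x]]`. -/
def swapFun {σ A : Type*} [CommRing A] (F : PowerSeries (MvPowerSeries σ A)) :
    MvPowerSeries σ (PowerSeries A) :=
  fun e => PowerSeries.mk fun j => MvPowerSeries.coeff e (PowerSeries.coeff j F)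

theorem coeff_coeff_swapFun {σ A : Type*} [CommRing A] (F : PowerSeries (MvPowerSeries σ A))
    (e : σ →₀ ℕ) (j : ℕ) : PowerSeries.coeff j (MvPowerSeries.coeff e (swapFun F)) =
      MvPowerSeries.coeff e (PowerSeries.coeff j F) := by
  rw [show MvPowerSeries.coeff e (swapFun F) =
    PowerSeries.mk fun j => MvPowerSeries.coeff e (PowerSeries.coeff j F) from rfl,
    PowerSeries.coeff_mk]

/-- The isomorphism `A[[x]][[t]] → A[[t]][[x]]`, as a ring homomorphism. -/
def swapHom (σ A : Type*) [CommRing A] :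
    PowerSeries (MvPowerSeries σ A) →+* MvPowerSeries σ (PowerSeries A) where
  toFun F := swapFun F
  map_zero' := by
    ext e j
    rw [coeff_coeff_swapFun]
    simp
  map_one' := by
    classical
    ext e j
    rw [coeff_coeff_swapFun, PowerSeries.coeff_one, MvPowerSeries.coeff_one]
    split_ifs <;> simp [*, MvPowerSeries.coeff_one, PowerSeries.coeff_one]
  map_add' F G := by
    ext e j
    simp only [map_add, coeff_coeff_swapFun]
  map_mul' F G := by
    classical
    ext e j
    rw [MvPowerSeries.coeff_mul, map_sum, coeff_coeff_swapFun, PowerSeries.coeff_mul, map_sum]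
    simp only [MvPowerSeries.coeff_mul, PowerSeries.coeff_mul, coeff_coeff_swapFun]
    rw [Finset.sum_comm]

theorem coeff_coeff_swapHom {σ A : Type*} [CommRing A] (F : PowerSeries (MvPowerSeries σ A))
    (e : σ →₀ ℕ) (j : ℕ) : PowerSeries.coeff j (MvPowerSeries.coeff e (swapHom σ A F)) =
      MvPowerSeries.coeff e (PowerSeries.coeff j F) :=
  coeff_coeff_swapFun F e j

end Variables

/-! ### The weight description of hom(J), and regularity of t -/

section HomRing

variable {A : Type*} [CommRing A] {n : ℕ}

theorem maximalIdeal_mvPowerSeries [IsLocalRing A] :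
    maximalIdeal (MvPowerSeries (Fin n) A) = bigIdeal A n := by
  apply le_antisymm
  · intro f hf
    rw [mem_maximalIdeal, mem_nonunits_iff, MvPowerSeries.isUnit_iff_constantCoeff] at hf
    rw [← sub_add_cancel f (MvPowerSeries.C (MvPowerSeries.constantCoeff f))]
    refine add_mem (Ideal.mem_sup_right ?_)
      (Ideal.mem_sup_left (Ideal.mem_map_of_mem _ hf))
    rw [← pow_one (variablesIdeal A n), mem_variablesIdeal_pow_iff]
    intro e he
    obtain rfl : e = 0 := by simpa [Finsupp.degree_eq_zero_iff] using he
    simp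
  · refine sup_le (Ideal.map_le_iff_le_comap.2 fun a ha => ?_) (Ideal.span_le.2 ?_)
    · rw [Ideal.mem_comap, mem_maximalIdeal, mem_nonunits_iff,
        MvPowerSeries.isUnit_iff_constantCoeff]
      simpa using ha
    · rintro _ ⟨i, rfl⟩
      rw [SetLike.mem_coe, mem_maximalIdeal, mem_nonunits_iff,
        MvPowerSeries.isUnit_iff_constantCoeff]
      simp

/-- The constant term of hom(f) is that of f or zero, and elements of a proper ideal have non-unit
constant term. -/
theorem homIdeal_ne_top [IsLocalRing A] {J : Ideal (MvPowerSeries (Fin n) A)} (hJ : J ≠ ⊤) :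
    homIdeal J ≠ ⊤ := by
  have h : homIdeal J ≤ (maximalIdeal A).comap
      ((MvPowerSeries.constantCoeff (σ := Fin n) (R := A)).comp PowerSeries.constantCoeff) := by
    rw [homIdeal, Ideal.span_le]
    rintro _ ⟨f, hf, -, rfl⟩
    rw [SetLike.mem_coe, Ideal.mem_comap, RingHom.comp_apply, homogenize,
      ← PowerSeries.coeff_zero_eq_constantCoeff_apply, PowerSeries.coeff_mk,
      ← MvPowerSeries.coeff_zero_eq_constantCoeff_apply,
      MvPowerSeries.coeff_homogeneousComponent]
    split_ifs
    · rw [MvPowerSeries.coeff_zero_eq_constantCoeff_apply, mem_maximalIdeal, mem_nonunits_iff,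
        ← MvPowerSeries.isUnit_iff_constantCoeff]
      exact fun hu => hJ (Ideal.eq_top_of_isUnit_mem _ hf hu)
    · exact zero_mem _
  intro htop
  rw [htop, top_le_iff, Ideal.comap_eq_top_iff] at h
  exact (maximalIdeal.isMaximal A).ne_top h

theorem isCompleteLocalRing_homRing [IsLocalRing A] (hA : IsCompleteLocalRing A)
    {J : Ideal (MvPowerSeries (Fin n) A)} (hJ : J ≠ ⊤) : IsCompleteLocalRing (HomRing J) :=
  (hA.mvPowerSeries n).powerSeries.quotient (homIdeal_ne_top hJ)

/-- For f ≠ 0 this series is t^(o(f)-k) hom(f). Allowing any k below the order, and f = 0, avoids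
computing orders later. -/
theorem shift_mem_homIdeal {J : Ideal (MvPowerSeries (Fin n) A)} {f : MvPowerSeries (Fin n) A}
    (hf : f ∈ J) {k : ℕ} (hk : f ∈ variablesIdeal A n ^ k) :
    (PowerSeries.mk fun j => MvPowerSeries.homogeneousComponent (k + j) f) ∈ homIdeal J := by
  rcases eq_or_ne f 0 with rfl | h0
  · convert zero_mem (homIdeal J)
    ext j e
    simp
  · have hord : k ≤ f.order.toNat := by
      rw [mem_variablesIdeal_pow_iff] at hk
      have h1 : (k : ℕ∞) ≤ f.order := MvPowerSeries.le_order fun e he => hk e (by exact_mod_cast he)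
      have h2 : f.order ≠ ⊤ := by rwa [Ne, MvPowerSeries.order_eq_top_iff]
      rw [← ENat.natCast_toNat h2] at h1
      exact_mod_cast h1
    have : (PowerSeries.mk fun j => MvPowerSeries.homogeneousComponent (k + j) f) =
        PowerSeries.X ^ (f.order.toNat - k) * homogenize f := by
      refine PowerSeries.ext fun j => ?_
      rw [PowerSeries.coeff_X_pow_mul', PowerSeries.coeff_mk, homogenize]
      split_ifs with h
      · rw [PowerSeries.coeff_mk]
        congr 2
        omega
      · refine MvPowerSeries.homogeneousComponent_of_lt_order_eq_zero
          (lt_of_lt_of_le ?_ (ENat.natCast_toNat_le_self _))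
        exact_mod_cast (by omega)
    rw [this]
    exact Ideal.mul_mem_left _ _ (Ideal.subset_span ⟨f, hf, h0, rfl⟩)

theorem psi_mem_homIdeal {J : Ideal (MvPowerSeries (Fin n) A)} {f : MvPowerSeries (Fin n) A}
    (hf : f ∈ J) : psi f ∈ homIdeal J := by
  rw [psi_eq_mk]
  simpa using shift_mem_homIdeal hf (k := 0) (by simp)

/-- For the grading of `T` with `x_i` of degree `1` and `t` of degree `-1`, the component of degree
`d` of `F`, evaluated at `t = 1`. -/
def weightPart (d : ℤ) (F : PowerSeries (MvPowerSeries (Fin n) A)) : MvPowerSeries (Fin n) A :=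
  fun e => if d ≤ e.degree then
    MvPowerSeries.coeff e (PowerSeries.coeff ((e.degree : ℤ) - d).toNat F) else 0

theorem coeff_weightPart (d : ℤ) (F : PowerSeries (MvPowerSeries (Fin n) A)) (e : Fin n →₀ ℕ) :
    MvPowerSeries.coeff e (weightPart d F) = if d ≤ e.degree then
      MvPowerSeries.coeff e (PowerSeries.coeff ((e.degree : ℤ) - d).toNat F) else 0 := rfl

theorem weightPart_mem_pow {k : ℕ} {d : ℤ} (h : k ≤ d)
    (F : PowerSeries (MvPowerSeries (Fin n) A)) : weightPart d F ∈ variablesIdeal A n ^ k := by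
  rw [mem_variablesIdeal_pow_iff]
  intro e he
  rw [coeff_weightPart, if_neg (by omega)]

/-- t has weight -1. This shift is what makes t regular modulo an ideal described by weights. -/
theorem weightPart_X_mul (d : ℤ) (F : PowerSeries (MvPowerSeries (Fin n) A)) :
    weightPart d (PowerSeries.X * F) = weightPart (d + 1) F := by
  ext e
  rw [coeff_weightPart, coeff_weightPart]
  by_cases h : d + 1 ≤ e.degree
  · rw [if_pos h, if_pos (by omega), show ((e.degree : ℤ) - d).toNat =
      ((e.degree : ℤ) - (d + 1)).toNat + 1 by omega, PowerSeries.coeff_succ_X_mul]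
  · rw [if_neg h]
    split_ifs
    · rw [show ((e.degree : ℤ) - d).toNat = 0 by omega]
      simp
    · rfl

/-- In hom(f) the exponent of t is the degree in x minus o(f), so only the weight o(f) occurs. -/
theorem weightPart_homogenize (d : ℤ) (f : MvPowerSeries (Fin n) A) :
    weightPart d (homogenize f) = if d = f.order.toNat then f else 0 := by
  ext e
  rw [coeff_weightPart, homogenize, PowerSeries.coeff_mk, MvPowerSeries.coeff_homogeneousComponent]
  by_cases hd : d = f.order.toNat
  · rw [if_pos hd]
    by_cases h : d ≤ e.degree
    · rw [if_pos h, if_pos (by omega)]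
    · rw [if_neg h, MvPowerSeries.coeff_of_lt_order]
      refine lt_of_lt_of_le ?_ (ENat.natCast_toNat_le_self _)
      exact_mod_cast (by omega)
  · rw [if_neg hd, map_zero]
    split_ifs
    · omega
    · rfl
    · rfl

/-- The convolution over all weights c ∈ ℤ is infinite, but for a + b = e with |e| < N only c ≤ |a|
< N and d - c ≤ |b| < N contribute. -/
theorem coeff_weightPart_mul {d : ℤ} {N : ℕ} (F G : PowerSeries (MvPowerSeries (Fin n) A))
    {e : Fin n →₀ ℕ} (he : e.degree < N) :
    MvPowerSeries.coeff e (weightPart d (F * G)) =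
      ∑ c ∈ Finset.Icc (d - N) N,
        MvPowerSeries.coeff e (weightPart c F * weightPart (d - c) G) := by
  classical
  simp only [MvPowerSeries.coeff_mul]
  rw [Finset.sum_comm, coeff_weightPart]
  have key : ∀ ab ∈ Finset.HasAntidiagonal.antidiagonal e, ∑ c ∈ Finset.Icc (d - N) N,
      MvPowerSeries.coeff ab.1 (weightPart c F) * MvPowerSeries.coeff ab.2 (weightPart (d - c) G) =
      if d ≤ e.degree then
        ∑ ij ∈ Finset.HasAntidiagonal.antidiagonal ((e.degree : ℤ) - d).toNat,
          MvPowerSeries.coeff ab.1 (PowerSeries.coeff ij.1 F) *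
            MvPowerSeries.coeff ab.2 (PowerSeries.coeff ij.2 G) else 0 := by
    rintro ⟨a, b⟩ hab
    have hab' : a.degree + b.degree = e.degree := by
      rw [← map_add, Finset.HasAntidiagonal.mem_antidiagonal.1 hab]
    simp only [coeff_weightPart]
    split_ifs with h
    · symm
      have hsub : Finset.Icc (d - b.degree) a.degree ⊆ Finset.Icc (d - N) (N : ℤ) :=
        Finset.Icc_subset_Icc (by omega) (by omega)
      rw [← Finset.sum_subset hsub]
      -- For a fixed monomial x^a, the power t^i in F corresponds to the weight c = |a| - i.
      · refine Finset.sum_bij' (fun ij _ => (a.degree : ℤ) - ij.1)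
          (fun c _ => (((a.degree : ℤ) - c).toNat, ((b.degree : ℤ) - (d - c)).toNat)) ?_ ?_ ?_ ?_ ?_
        · rintro ⟨i, j⟩ hij
          have := Finset.HasAntidiagonal.mem_antidiagonal.1 hij
          simp only [Finset.mem_Icc] at this ⊢
          omega
        · intro c hc
          simp only [Finset.mem_Icc, Finset.HasAntidiagonal.mem_antidiagonal] at hc ⊢
          omega
        · rintro ⟨i, j⟩ hij
          have := Finset.HasAntidiagonal.mem_antidiagonal.1 hij
          simp only [Prod.mk.injEq] at this ⊢
          omega
        · intro c hc
          simp only [Finset.mem_Icc] at hc ⊢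
          omega
        · rintro ⟨i, j⟩ hij
          have := Finset.HasAntidiagonal.mem_antidiagonal.1 hij
          simp only at this ⊢
          rw [if_pos (by omega), if_pos (by omega)]
          congr 4 <;> omega
      · intro c _ hc
        simp only [Finset.mem_Icc, not_and_or, not_le] at hc
        rcases hc with hc | hc
        · have hb : ¬ d - c ≤ b.degree := by omega
          rw [if_neg hb, mul_zero]
        · rw [if_neg (by omega), zero_mul]
    · refine Finset.sum_eq_zero fun c _ => ?_
      by_cases h1 : c ≤ a.degree
      · have hb : ¬ d - c ≤ b.degree := by omega
        rw [if_neg hb, mul_zero]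
      · rw [if_neg h1, zero_mul]
  rw [Finset.sum_congr rfl key]
  split_ifs
  · rw [PowerSeries.coeff_mul, map_sum, Finset.sum_comm]
    simp only [MvPowerSeries.coeff_mul]
  · simp

theorem variablesIdeal_le_maximalIdeal [IsLocalRing A] :
    variablesIdeal A n ≤ maximalIdeal (MvPowerSeries (Fin n) A) := by
  rw [maximalIdeal_mvPowerSeries]
  exact le_sup_right

theorem variables_sup_X_le_maximalIdeal [IsLocalRing A]
    [IsLocalRing (PowerSeries (MvPowerSeries (Fin n) A))] :
    (variablesIdeal A n).map PowerSeries.C ⊔ Ideal.span {PowerSeries.X} ≤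
      maximalIdeal (PowerSeries (MvPowerSeries (Fin n) A)) := by
  rw [maximalIdeal_powerSeries]
  exact sup_le_sup_right (Ideal.map_mono variablesIdeal_le_maximalIdeal) _

theorem algebraMap_X (J : Ideal (MvPowerSeries (Fin n) A)) :
    algebraMap (PowerSeries A) (HomRing J) PowerSeries.X = tElt J := by
  rw [IsScalarTower.algebraMap_apply (PowerSeries A) (PowerSeries (MvPowerSeries (Fin n) A)),
    show algebraMap (PowerSeries A) (PowerSeries (MvPowerSeries (Fin n) A)) PowerSeries.X =
      PowerSeries.map (algebraMap A _) PowerSeries.X from rfl, PowerSeries.map_X]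
  rfl

variable [IsLocalRing A] [IsNoetherianRing A]

/-- The ideal of the `F` all of whose components come from elements of `J`. -/
def weightIdeal (J : Ideal (MvPowerSeries (Fin n) A)) :
    Ideal (PowerSeries (MvPowerSeries (Fin n) A)) where
  carrier := {F | ∀ d, weightPart d F ∈ J}
  zero_mem' d := by
    convert zero_mem J
    ext e
    simp [coeff_weightPart]
  add_mem' {F G} hF hG d := by
    convert add_mem (hF d) (hG d)
    ext e
    simp only [map_add, coeff_weightPart]
    split_ifs <;> simp
  smul_mem' F G hG d := by
    -- Modulo (x)^N a component of the product is a finite sum of multiples of components of G, and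
    -- J is closed.
    refine mem_of_forall_mem_sup_pow J fun N => ?_
    rw [← sub_add_cancel (weightPart d (F • G)) (∑ c ∈ Finset.Icc (d - N) N,
        weightPart c F * weightPart (d - c) G)]
    refine add_mem (Ideal.mem_sup_right ?_) (Ideal.mem_sup_left ?_)
    · refine Ideal.pow_right_mono variablesIdeal_le_maximalIdeal N
        (mem_variablesIdeal_pow_iff.2 fun e he => ?_)
      rw [map_sub, smul_eq_mul, coeff_weightPart_mul F G he, map_sum, sub_self]
    · exact Ideal.sum_mem _ fun c _ => Ideal.mul_mem_left _ _ (hG _)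

theorem homIdeal_eq_weightIdeal (J : Ideal (MvPowerSeries (Fin n) A)) :
    homIdeal J = weightIdeal J := by
  apply le_antisymm
  · rw [homIdeal, Ideal.span_le]
    rintro _ ⟨f, hf, -, rfl⟩ d
    rw [weightPart_homogenize]
    split_ifs
    · exact hf
    · exact zero_mem J
  · intro F hF
    have hloc : IsLocalRing (PowerSeries (MvPowerSeries (Fin n) A)) :=
      inferInstanceAs (IsLocalRing (MvPowerSeries Unit _))
    refine mem_of_forall_mem_sup_pow _ fun N => ?_
    -- H reassembles the components of F of weights -N, ..., N - 1, with the powers of t restored. A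
    -- monomial x^e t^j with |e| + j < N has weight in this range, so F - H lies in (x, t)^N.
    let H := ∑ k ∈ Finset.range N, (PowerSeries.mk fun j =>
        MvPowerSeries.homogeneousComponent (k + j) (weightPart k F)) +
      ∑ k ∈ Finset.range N, PowerSeries.X ^ (k + 1) * psi (weightPart (-(k + 1 : ℤ)) F)
    rw [← sub_add_cancel F H]
    refine add_mem (Ideal.mem_sup_right ?_) (Ideal.mem_sup_left ?_)
    · refine Ideal.pow_right_mono variables_sup_X_le_maximalIdeal N
        ((mem_map_C_sup_X_pow_iff _ _ _).2 fun j => mem_variablesIdeal_pow_iff.2 fun e he => ?_)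
      have h1 : ∀ k : ℕ, MvPowerSeries.coeff e (PowerSeries.coeff j (PowerSeries.mk fun j =>
          MvPowerSeries.homogeneousComponent (k + j) (weightPart k F))) =
          if e.degree = k + j then MvPowerSeries.coeff e (PowerSeries.coeff j F) else 0 := by
        intro k
        rw [PowerSeries.coeff_mk, MvPowerSeries.coeff_homogeneousComponent, coeff_weightPart]
        split_ifs with h h'
        · congr 3; omega
        · omega
        · rfl
      have h2 : ∀ k : ℕ, MvPowerSeries.coeff e (PowerSeries.coeff j
          (PowerSeries.X ^ (k + 1) * psi (weightPart (-(k + 1 : ℤ)) F))) =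
          if e.degree + (k + 1) = j then MvPowerSeries.coeff e (PowerSeries.coeff j F) else 0 := by
        intro k
        rw [PowerSeries.coeff_X_pow_mul', psi_eq_mk]
        by_cases h : k + 1 ≤ j
        · rw [if_pos h, PowerSeries.coeff_mk, MvPowerSeries.coeff_homogeneousComponent,
            coeff_weightPart]
          by_cases h' : e.degree + (k + 1) = j
          · rw [if_pos (by omega), if_pos (by omega), if_pos h']
            congr 3
          · rw [if_neg (by omega), if_neg h']
        · rw [if_neg h, if_neg (by omega), map_zero]
      rw [map_sub, map_sub, map_add, map_add, map_sum, map_sum, map_sum, map_sum,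
        Finset.sum_congr rfl fun k _ => h1 k, Finset.sum_congr rfl fun k _ => h2 k, sub_eq_zero]
      rcases le_or_gt j e.degree with h | h
      · rw [Finset.sum_eq_single (e.degree - j), if_pos (by omega), Finset.sum_eq_zero, add_zero]
        · intro k _
          rw [if_neg (by omega)]
        · intro k _ hk
          rw [if_neg (by omega)]
        · intro hk
          rw [Finset.mem_range] at hk
          omega
      · rw [Finset.sum_eq_zero, zero_add, Finset.sum_eq_single (j - e.degree - 1),
          if_pos (by omega)]
        · intro k _ hk
          rw [if_neg (by omega)]
        · intro hk
          rw [Finset.mem_range] at hk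
          omega
        · intro k _
          rw [if_neg (by omega)]
    · refine add_mem (Ideal.sum_mem _ fun k _ => ?_) (Ideal.sum_mem _ fun k _ => ?_)
      · exact shift_mem_homIdeal (hF _) (weightPart_mem_pow le_rfl _)
      · exact Ideal.mul_mem_left _ _ (psi_mem_homIdeal (hF _))

theorem mem_homIdeal_of_X_mul_mem {J : Ideal (MvPowerSeries (Fin n) A)}
    {F : PowerSeries (MvPowerSeries (Fin n) A)} (h : PowerSeries.X * F ∈ homIdeal J) :
    F ∈ homIdeal J := by
  rw [homIdeal_eq_weightIdeal] at h ⊢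
  intro d
  have := h (d - 1)
  rwa [weightPart_X_mul, sub_add_cancel] at this

theorem tElt_mem_nonZeroDivisors (J : Ideal (MvPowerSeries (Fin n) A)) :
    tElt J ∈ nonZeroDivisors (HomRing J) := by
  rw [mem_nonZeroDivisors_iff_left]
  intro x hx
  obtain ⟨F, rfl⟩ := Ideal.Quotient.mk_surjective x
  rw [tElt, ← map_mul, Ideal.Quotient.eq_zero_iff_mem] at hx
  exact Ideal.Quotient.eq_zero_iff_mem.2 (mem_homIdeal_of_X_mul_mem hx)

end HomRing

/-- A nonzero element of k[[t]] is a unit times a power of t, and t is regular on the quotient. Over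
a principal ideal domain, torsion-free modules are flat. -/
theorem flat_homRing {k : Type*} [Field k] {n : ℕ} (J : Ideal (MvPowerSeries (Fin n) k)) :
    Module.Flat (PowerSeries k) (HomRing J) := by
  have : Module.IsTorsionFree (PowerSeries k) (HomRing J) := by
    refine ⟨fun r hr x y hxy => ?_⟩
    rw [← sub_eq_zero] at hxy ⊢
    simp only [← smul_sub] at hxy
    generalize x - y = z at hxy
    obtain ⟨F, rfl⟩ := Ideal.Quotient.mk_surjective z
    obtain ⟨m, u, rfl⟩ := IsDiscreteValuationRing.eq_unit_mul_pow_irreducible hr.ne_zero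
      PowerSeries.X_irreducible
    rw [mul_smul, ← Units.smul_def, smul_eq_zero_iff_eq] at hxy
    have h : tElt J ^ m * Ideal.Quotient.mk (homIdeal J) F = 0 := by
      rw [← algebraMap_X, ← map_pow, ← hxy]
      exact (Algebra.smul_def _ _).symm
    exact (pow_mem (tElt_mem_nonZeroDivisors J) m).1 _ h
  infer_instance

/-! ### Surjectivity of evaluation maps from power series rings -/

section EvalHat

/-- The variables extend to the ideal of the completion generated by I, and the map is onto modulo
that ideal. The source is complete and the target separated, so successive approximation makes it
onto. -/
theorem evalHat_surjective {n : ℕ} {A B : Type*} [CommRing A] [CommRing B] [Algebra A B]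
    (I : Ideal B) (y : Fin n → B) (hy : ∀ i, y i ∈ I) (hI : I ≤ Ideal.span (Set.range y))
    (h : ∀ b : B, ∃ a : A, b - algebraMap A B a ∈ I) :
    Function.Surjective (evalHat (A := A) I y hy) := by
  have hI' : I = Ideal.span (Set.range y) :=
    le_antisymm hI (Ideal.span_le.2 (by rintro _ ⟨i, rfl⟩; exact hy i))
  have hfg : I.FG := hI' ▸ Submodule.fg_span (Set.finite_range y)
  let f : MvPowerSeries (Fin n) A →+* AdicCompletion I B := (evalHat (A := A) I y hy).toRingHom
  have hf : ∀ g, f g = evalHat I y hy g := fun _ => rfl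
  have hmap : (variablesIdeal A n).map f = I.map (algebraMap B (AdicCompletion I B)) := by
    have h1 : ⇑f ∘ MvPowerSeries.X = algebraMap B (AdicCompletion I B) ∘ y := by
      ext1 i
      simp only [Function.comp_apply, hf]
      rw [← MvPolynomial.coe_X, evalHat_coe, MvPolynomial.aeval_X]
      rfl
    rw [variablesIdeal, Ideal.map_span, ← Set.range_comp, h1, Set.range_comp, ← Ideal.map_span]
    exact congrArg (Ideal.map (algebraMap B (AdicCompletion I B))) hI'.symm
  have hcomp : IsPrecomplete (variablesIdeal A n) (MvPowerSeries (Fin n) A) :=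
    (inferInstance : IsAdicComplete (Ideal.span (Set.range MvPowerSeries.X))
      (MvPowerSeries (Fin n) A)).toIsPrecomplete
  have hhaus : IsHausdorff ((variablesIdeal A n).map f) (AdicCompletion I B) := by
    rw [hmap]
    exact (AdicCompletion.isAdicComplete_self I hfg).toIsHausdorff
  refine surjective_of_mk_map_comp_surjective (I := variablesIdeal A n) f fun z => ?_
  obtain ⟨z, rfl⟩ := Ideal.Quotient.mk_surjective z
  obtain ⟨b, hb⟩ := Ideal.Quotient.mk_surjective (AdicCompletion.evalOneₐ I z)
  obtain ⟨a, ha⟩ := h b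
  refine ⟨algebraMap A _ a, ?_⟩
  rw [RingHom.comp_apply, hf, AlgHom.commutes, Ideal.Quotient.eq, hmap,
    ← AdicCompletion.ker_evalOneₐ_eq_map I hfg]
  change AdicCompletion.evalOneₐ I _ = 0
  rw [map_sub, ← hb, sub_eq_zero, IsScalarTower.algebraMap_apply A B (AdicCompletion I B),
    AlgHom.commutes]
  exact ((Ideal.Quotient.eq).2 ha).symm

/-- The evaluation of power series at topologically nilpotent elements of a complete ring. -/
def evalComplete {σ A B : Type*} [Finite σ] [CommRing A] [CommRing B] [Algebra A B] (I : Ideal B)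
    [IsAdicComplete I B] (y : σ → B) (hy : ∀ i, y i ∈ I) : MvPowerSeries σ A →ₐ[A] B :=
  ((AdicCompletion.ofAlgEquiv I).symm.toAlgHom.restrictScalars A).comp (evalHat I y hy)

theorem evalComplete_X {σ A B : Type*} [Finite σ] [CommRing A] [CommRing B] [Algebra A B]
    (I : Ideal B) [IsAdicComplete I B] (y : σ → B) (hy : ∀ i, y i ∈ I) (i : σ) :
    evalComplete (A := A) I y hy (MvPowerSeries.X i) = y i := by
  rw [← MvPolynomial.coe_X]
  change (AdicCompletion.ofAlgEquiv I).symm (evalHat I y hy _) = _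
  rw [evalHat_coe, MvPolynomial.aeval_X]
  simp

theorem evalComplete_surjective {n : ℕ} {A B : Type*} [CommRing A] [CommRing B] [Algebra A B]
    (I : Ideal B) [IsAdicComplete I B] (y : Fin n → B) (hy : ∀ i, y i ∈ I)
    (hI : I ≤ Ideal.span (Set.range y)) (h : ∀ b : B, ∃ a : A, b - algebraMap A B a ∈ I) :
    Function.Surjective (evalComplete (A := A) I y hy) :=
  (AdicCompletion.ofAlgEquiv I).symm.surjective.comp (evalHat_surjective I y hy hI h)

end EvalHat

/-! ### Homogeneous components in the associated graded ring -/

section Graded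

variable {R : Type*} [CommRing R]

namespace AssocGraded

theorem of_congr (I : Ideal R) {i j : ℕ} {x y : R} (hx : x ∈ I ^ i) (hy : y ∈ I ^ j) (hij : i = j)
    (hxy : x = y) : of I i x hx = of I j y hy := by
  subst hij hxy
  rfl

/-- The component of degree `i` of an element of the associated graded ring. -/
def proj (I : Ideal R) (i : ℕ) : AssocGraded I →+ GrPiece I i :=
  (DirectSum.component ℤ ℕ (fun i => GrPiece I i) i).toAddMonoidHom

theorem proj_of_self (I : Ideal R) {i : ℕ} {x : R} (hx : x ∈ I ^ i) :
    proj I i (of I i x hx) = grMk I i x hx :=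
  DirectSum.of_eq_same i _

theorem proj_of_ne (I : Ideal R) {i j : ℕ} (h : i ≠ j) {x : R} (hx : x ∈ I ^ i) :
    proj I j (of I i x hx) = 0 :=
  DirectSum.of_eq_of_ne i j _ h.symm

theorem ext_proj {I : Ideal R} {g h : AssocGraded I} (H : ∀ i, proj I i g = proj I i h) : g = h :=
  DFinsupp.ext H

end AssocGraded

end Graded

/-! ### The special fibre: T / (hom(J) + (t)) and the completed associated graded ring -/

section SpecialFiber

variable {A R : Type*} [CommRing A] [CommRing R] [Algebra A R] {n : ℕ}
  {m : Ideal R} {ρ : MvPowerSeries (Fin n) A →ₐ[A] R}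

theorem map_mem_pow (hm : m = (variablesIdeal A n).map ρ) {k : ℕ} {f : MvPowerSeries (Fin n) A}
    (hf : f ∈ variablesIdeal A n ^ k) : ρ f ∈ m ^ k := by
  rw [hm, ← Ideal.map_pow]
  exact Ideal.mem_map_of_mem _ hf

theorem exists_mem_pow_of_mem_pow (hm : m = (variablesIdeal A n).map ρ)
    (hρ : Function.Surjective ρ) {k : ℕ} {r : R} (hr : r ∈ m ^ k) :
    ∃ f ∈ variablesIdeal A n ^ k, ρ f = r := by
  rw [hm, ← Ideal.map_pow, Ideal.mem_map_iff_of_surjective _ hρ] at hr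
  exact hr

theorem homogeneousComponent_mem_pow (i : ℕ) (f : MvPowerSeries (Fin n) A) :
    MvPowerSeries.homogeneousComponent i f ∈ variablesIdeal A n ^ i := by
  rw [mem_variablesIdeal_pow_iff]
  intro e he
  rw [MvPowerSeries.coeff_homogeneousComponent, if_neg he.ne]

theorem X_mem_pow_one (hm : m = (variablesIdeal A n).map ρ) (i : Fin n) :
    ρ (MvPowerSeries.X i) ∈ m ^ 1 := by
  refine map_mem_pow hm ?_
  rw [pow_one]
  exact Ideal.subset_span ⟨i, rfl⟩

/-- The initial forms in the associated graded ring of the images of the variables. -/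
def initialVar (hm : m = (variablesIdeal A n).map ρ) (i : Fin n) : AssocGraded m :=
  AssocGraded.of m 1 (ρ (MvPowerSeries.X i)) (X_mem_pow_one hm i)

theorem initialVar_mem (hm : m = (variablesIdeal A n).map ρ) (i : Fin n) :
    initialVar hm i ∈ irrelevantIdeal m :=
  Ideal.subset_span ⟨1, one_pos, _, rfl⟩

theorem monomial_mem_pow (e : Fin n →₀ ℕ) (a : A) :
    MvPowerSeries.monomial e a ∈ variablesIdeal A n ^ e.degree := by
  classical
  rw [mem_variablesIdeal_pow_iff]
  intro d hd
  rw [MvPowerSeries.coeff_monomial, if_neg]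
  rintro rfl
  exact hd.false

theorem prod_initialVar (hm : m = (variablesIdeal A n).map ρ) (e : Fin n →₀ ℕ) :
    (e.prod fun i k => initialVar hm i ^ k) = AssocGraded.of m e.degree
      (ρ (MvPowerSeries.monomial e 1)) (map_mem_pow hm (monomial_mem_pow e 1)) := by
  classical
  have hone : ∀ h, (1 : AssocGraded m) = AssocGraded.of m 0 1 h := fun h => rfl
  induction e using Finsupp.induction_linear with
  | zero =>
    rw [Finsupp.prod_zero_index, hone (by simp)]
    refine AssocGraded.of_congr _ _ _ (by simp) ?_
    rw [show MvPowerSeries.monomial (0 : Fin n →₀ ℕ) (1 : A) = 1 from rfl, map_one]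
  | add e e' h h' =>
    rw [Finsupp.prod_add_index' (by simp) (by simp [pow_add]), h, h', AssocGraded.of_mul_of]
    refine AssocGraded.of_congr _ _ _ (by rw [map_add]) ?_
    rw [← map_mul, MvPowerSeries.monomial_mul_monomial, mul_one]
  | single i k =>
    rw [Finsupp.prod_single_index (by simp)]
    induction k with
    | zero =>
      rw [pow_zero, hone (by simp)]
      refine AssocGraded.of_congr _ _ _ (by simp) ?_
      rw [Finsupp.single_zero, show MvPowerSeries.monomial (0 : Fin n →₀ ℕ) (1 : A) = 1 from rfl,
        map_one]
    | succ k ih =>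
      rw [pow_succ, ih, initialVar, AssocGraded.of_mul_of]
      refine AssocGraded.of_congr _ _ _ (by simp [Finsupp.degree_single]) ?_
      rw [← map_mul, MvPowerSeries.X, MvPowerSeries.monomial_mul_monomial, mul_one,
        ← Finsupp.single_add]

theorem aeval_initialVar_monomial (hm : m = (variablesIdeal A n).map ρ) (e : Fin n →₀ ℕ) (a : A) :
    MvPolynomial.aeval (initialVar hm) (MvPolynomial.monomial e a) =
      AssocGraded.of m e.degree (ρ (MvPowerSeries.monomial e a))
        (map_mem_pow hm (monomial_mem_pow e a)) := by
  rw [MvPolynomial.aeval_monomial, prod_initialVar]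
  change AssocGraded.of m 0 (algebraMap A R a) _ * _ = _
  rw [AssocGraded.of_mul_of]
  refine AssocGraded.of_congr _ _ _ (zero_add _) ?_
  rw [← AlgHom.commutes ρ, ← map_mul]
  congr 1
  rw [MvPowerSeries.algebraMap_apply, Algebra.algebraMap_self, RingHom.id_apply,
    ← MvPowerSeries.monomial_zero_eq_C_apply, MvPowerSeries.monomial_mul_monomial, zero_add, mul_one]

/-- The class of the homogeneous component of degree `i` of `f` in the `i`-th graded piece. -/
def grComp (hm : m = (variablesIdeal A n).map ρ) (i : ℕ) (f : MvPowerSeries (Fin n) A) :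
    GrPiece m i :=
  grMk m i (ρ (MvPowerSeries.homogeneousComponent i f))
    (map_mem_pow hm (homogeneousComponent_mem_pow i f))

theorem grComp_add (hm : m = (variablesIdeal A n).map ρ) (i : ℕ) (f g : MvPowerSeries (Fin n) A) :
    grComp hm i (f + g) = grComp hm i f + grComp hm i g := by
  rw [grComp, grComp, grComp, grMk_add]
  congr 1
  rw [map_add, map_add]

theorem grComp_eq_zero_iff (hm : m = (variablesIdeal A n).map ρ) (i : ℕ)
    (f : MvPowerSeries (Fin n) A) : grComp hm i f = 0 ↔
      ρ (MvPowerSeries.homogeneousComponent i f) ∈ m ^ (i + 1) := by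
  rw [grComp, grMk_zero, grMk_eq_iff, sub_zero]

theorem grComp_congr (hm : m = (variablesIdeal A n).map ρ) (i : ℕ) {f g : MvPowerSeries (Fin n) A}
    (h : MvPowerSeries.homogeneousComponent i f = MvPowerSeries.homogeneousComponent i g) :
    grComp hm i f = grComp hm i g := by
  unfold grComp
  congr 2

theorem grComp_eq_zero (hm : m = (variablesIdeal A n).map ρ) (i : ℕ)
    {f : MvPowerSeries (Fin n) A} (h : MvPowerSeries.homogeneousComponent i f = 0) :
    grComp hm i f = 0 := by
  rw [grComp_eq_zero_iff, h, map_zero]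
  exact zero_mem _

/-- Evaluation at the initial forms respects degrees, so computations in the graded ring reduce to
homogeneous components in S mapped to R. -/
theorem proj_aeval_initialVar (hm : m = (variablesIdeal A n).map ρ) (i : ℕ)
    (f : MvPolynomial (Fin n) A) :
    AssocGraded.proj m i (MvPolynomial.aeval (initialVar hm) f) =
      grComp hm i (f : MvPowerSeries (Fin n) A) := by
  classical
  induction f using MvPolynomial.induction_on' with
  | monomial e a =>
    rw [aeval_initialVar_monomial, MvPolynomial.coe_monomial]
    have key : MvPowerSeries.homogeneousComponent i (MvPowerSeries.monomial e a) =
        if e.degree = i then MvPowerSeries.monomial e a else 0 := by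
      ext d
      rw [MvPowerSeries.coeff_homogeneousComponent, MvPowerSeries.coeff_monomial]
      by_cases h2 : d = e
      · subst h2
        by_cases h3 : d.degree = i <;> simp [h3]
      · by_cases h3 : e.degree = i <;> simp [h2, h3, MvPowerSeries.coeff_monomial]
    by_cases h : e.degree = i
    · subst h
      rw [AssocGraded.proj_of_self, grComp]
      congr 2
      rw [key, if_pos rfl]
    · rw [AssocGraded.proj_of_ne _ h, grComp_eq_zero]
      rw [key, if_neg h]
  | add f g hf hg => rw [map_add, map_add, hf, hg, MvPolynomial.coe_add, grComp_add]

/-- Lift r to a power series of order at least i and truncate it after degree i. What is discarded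
maps to 𝔪^(i+1). -/
theorem exists_polynomial_of_graded (hm : m = (variablesIdeal A n).map ρ)
    (hρ : Function.Surjective ρ) {i : ℕ} {r : R} (hr : r ∈ m ^ i) :
    ∃ f ∈ MvPolynomial.idealOfVars (Fin n) A ^ i,
      MvPolynomial.aeval (initialVar hm) f = AssocGraded.of m i r hr := by
  obtain ⟨g, hg, rfl⟩ := exists_mem_pow_of_mem_pow hm hρ hr
  refine ⟨MvPowerSeries.truncTotal (i + 1) g, (MvPolynomial.mem_pow_idealOfVars_iff' _ _).2
    fun e he => ?_, AssocGraded.ext_proj fun j => ?_⟩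
  · rw [MvPowerSeries.coeff_truncTotal _ (by omega)]
    exact mem_variablesIdeal_pow_iff.1 hg e he
  · rw [proj_aeval_initialVar]
    by_cases h : i = j
    · subst h
      rw [AssocGraded.proj_of_self, grComp, grMk_eq_iff, ← map_sub]
      refine map_mem_pow hm (mem_variablesIdeal_pow_iff.2 fun e he => ?_)
      rw [map_sub, MvPowerSeries.coeff_homogeneousComponent, sub_eq_zero]
      split_ifs with h
      · rw [MvPolynomial.coeff_coe, MvPowerSeries.coeff_truncTotal _ (by omega)]
      · exact (mem_variablesIdeal_pow_iff.1 hg e (by omega)).symm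
    · rw [AssocGraded.proj_of_ne _ h, grComp_eq_zero]
      ext e
      rw [MvPowerSeries.coeff_homogeneousComponent, map_zero]
      split_ifs with he
      · rw [MvPolynomial.coeff_coe, MvPowerSeries.coeff_truncTotal_eq_ite]
        split_ifs
        · exact mem_variablesIdeal_pow_iff.1 hg e (by omega)
        · rfl
      · rfl

theorem irrelevantIdeal_eq_map (hm : m = (variablesIdeal A n).map ρ)
    (hρ : Function.Surjective ρ) :
    irrelevantIdeal m =
      (MvPolynomial.idealOfVars (Fin n) A).map (MvPolynomial.aeval (initialVar hm)) := by
  apply le_antisymm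
  · rw [irrelevantIdeal, Ideal.span_le]
    rintro _ ⟨i, hi, a, rfl⟩
    obtain ⟨r, hr, rfl⟩ := grMk_surj a
    obtain ⟨f, hf, h⟩ := exists_polynomial_of_graded hm hρ hr
    change AssocGraded.of m i r hr ∈ _
    rw [← h]
    exact Ideal.mem_map_of_mem _ (Ideal.pow_le_self hi.ne' hf)
  · rw [Ideal.map_span, Ideal.span_le]
    rintro _ ⟨_, ⟨i, rfl⟩, rfl⟩
    rw [SetLike.mem_coe, MvPolynomial.aeval_X]
    exact initialVar_mem hm i

theorem aeval_initialVar_surjective (hm : m = (variablesIdeal A n).map ρ)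
    (hρ : Function.Surjective ρ) :
    Function.Surjective (MvPolynomial.aeval (R := A) (initialVar hm)) := by
  intro g
  change g ∈ (MvPolynomial.aeval (R := A) (initialVar hm)).range
  induction g using DirectSum.induction_on with
  | zero => exact zero_mem _
  | of i a =>
    obtain ⟨r, hr, rfl⟩ := grMk_surj a
    obtain ⟨f, -, h⟩ := exists_polynomial_of_graded hm hρ hr
    exact ⟨f, h⟩
  | add g h hg hh => exact add_mem hg hh

/-- G_+^N is the image of the N-th power of the polynomial ideal of variables, which has no
components of degree below N. -/
theorem proj_eq_zero_of_mem_pow (hm : m = (variablesIdeal A n).map ρ)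
    (hρ : Function.Surjective ρ) {N i : ℕ} (hi : i < N) {g : AssocGraded m}
    (hg : g ∈ irrelevantIdeal m ^ N) : AssocGraded.proj m i g = 0 := by
  rw [irrelevantIdeal_eq_map hm hρ, ← Ideal.map_pow,
    Ideal.mem_map_iff_of_surjective _ (aeval_initialVar_surjective hm hρ)] at hg
  obtain ⟨f, hf, rfl⟩ := hg
  rw [proj_aeval_initialVar, grComp_eq_zero]
  ext e
  rw [MvPowerSeries.coeff_homogeneousComponent]
  split_ifs with he
  · exact (MvPolynomial.mem_pow_idealOfVars_iff' _ _).1 hf e (by omega)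
  · rfl

/-- The homomorphism from power series to the completed associated graded ring. -/
def initialHom (hm : m = (variablesIdeal A n).map ρ) :
    MvPowerSeries (Fin n) A →ₐ[A] CompletedGraded m :=
  evalHat (irrelevantIdeal m) (initialVar hm) (initialVar_mem hm)

theorem initialHom_surjective (hm : m = (variablesIdeal A n).map ρ)
    (hρ : Function.Surjective ρ) : Function.Surjective (initialHom hm) := by
  refine evalHat_surjective _ _ _ ?_ fun g => ?_
  · rw [irrelevantIdeal_eq_map hm hρ, Ideal.map_span, ← Set.range_comp]
    refine Ideal.span_mono ?_
    rintro _ ⟨i, rfl⟩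
    exact ⟨i, by simp⟩
  · obtain ⟨f, rfl⟩ := aeval_initialVar_surjective hm hρ g
    refine ⟨MvPolynomial.constantCoeff f, ?_⟩
    rw [← AlgHom.commutes (MvPolynomial.aeval (initialVar hm)), ← map_sub,
      irrelevantIdeal_eq_map hm hρ]
    refine Ideal.mem_map_of_mem _ ?_
    rw [← pow_one (MvPolynomial.idealOfVars (Fin n) A), MvPolynomial.mem_pow_idealOfVars_iff']
    intro e he
    obtain rfl : e = 0 := by simpa [Finsupp.degree_eq_zero_iff] using he
    simp [MvPolynomial.algebraMap_eq, MvPolynomial.constantCoeff_eq]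

theorem homogeneousComponent_truncTotal {N i : ℕ} (hi : i < N) (f : MvPowerSeries (Fin n) A) :
    MvPowerSeries.homogeneousComponent i
      (MvPowerSeries.truncTotal N f : MvPowerSeries (Fin n) A) =
        MvPowerSeries.homogeneousComponent i f := by
  ext e
  rw [MvPowerSeries.coeff_homogeneousComponent, MvPowerSeries.coeff_homogeneousComponent]
  split_ifs with he
  · rw [MvPolynomial.coeff_coe, MvPowerSeries.coeff_truncTotal _ (by omega)]
  · rfl

theorem initialHom_eq_zero_iff (hm : m = (variablesIdeal A n).map ρ)
    (hρ : Function.Surjective ρ) (f : MvPowerSeries (Fin n) A) :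
    initialHom hm f = 0 ↔
      ∀ i, ρ (MvPowerSeries.homogeneousComponent i f) ∈ m ^ (i + 1) := by
  constructor
  · intro h i
    -- The exponent i + 1 is the least for which the component of degree i survives in the quotient.
    have := congrArg (AdicCompletion.evalₐ (irrelevantIdeal m) (i + 1)) h
    rw [initialHom, evalₐ_evalHat, map_zero, Ideal.Quotient.eq_zero_iff_mem] at this
    have := proj_eq_zero_of_mem_pow hm hρ (Nat.lt_succ_self i) this
    rwa [proj_aeval_initialVar, grComp_congr hm i (homogeneousComponent_truncTotal
      (Nat.lt_succ_self i) f), grComp_eq_zero_iff] at this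
  · intro h
    refine AdicCompletion.ext_evalₐ fun N => ?_
    rw [initialHom, evalₐ_evalHat, map_zero, Ideal.Quotient.eq_zero_iff_mem]
    suffices h0 : MvPolynomial.aeval (initialVar hm) (MvPowerSeries.truncTotal N f) = 0 from
      h0 ▸ zero_mem _
    refine AssocGraded.ext_proj fun i => ?_
    rw [proj_aeval_initialVar, map_zero]
    rcases lt_or_ge i N with hi | hi
    · rw [grComp_congr hm i (homogeneousComponent_truncTotal hi f), grComp_eq_zero_iff]
      exact h i
    · rw [grComp_eq_zero]
      ext e
      rw [MvPowerSeries.coeff_homogeneousComponent]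
      split_ifs with he
      · rw [MvPolynomial.coeff_coe, MvPowerSeries.coeff_truncTotal_eq_zero _ (by omega)]
        rfl
      · rfl

/-- The homomorphism from `T` to the completed associated graded ring, with `t ↦ 0`. -/
def specialHom (hm : m = (variablesIdeal A n).map ρ) :
    PowerSeries (MvPowerSeries (Fin n) A) →ₐ[A] CompletedGraded m :=
  AlgHom.mk ((initialHom hm).toRingHom.comp PowerSeries.constantCoeff) fun a => by
    rw [PowerSeries.algebraMap_apply]
    change initialHom hm (PowerSeries.constantCoeff (PowerSeries.C _)) = _
    rw [PowerSeries.constantCoeff_C, AlgHom.commutes]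

theorem specialHom_apply (hm : m = (variablesIdeal A n).map ρ)
    (F : PowerSeries (MvPowerSeries (Fin n) A)) :
    specialHom hm F = initialHom hm (PowerSeries.constantCoeff F) := rfl

theorem specialHom_surjective (hm : m = (variablesIdeal A n).map ρ)
    (hρ : Function.Surjective ρ) : Function.Surjective (specialHom hm) := fun z => by
  obtain ⟨f, rfl⟩ := initialHom_surjective hm hρ z
  exact ⟨PowerSeries.C f, by rw [specialHom_apply, PowerSeries.constantCoeff_C]⟩

theorem ker_specialHom [IsLocalRing A] [IsNoetherianRing A]
    (hm : m = (variablesIdeal A n).map ρ) (hρ : Function.Surjective ρ) :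
    RingHom.ker (specialHom hm) = homIdeal (RingHom.ker ρ) ⊔ Ideal.span {PowerSeries.X} := by
  have hX : ∀ F : PowerSeries (MvPowerSeries (Fin n) A), PowerSeries.constantCoeff F = 0 →
      F ∈ homIdeal (RingHom.ker ρ) ⊔ Ideal.span {PowerSeries.X} := fun F hF =>
    Ideal.mem_sup_right (Ideal.mem_span_singleton.2 (PowerSeries.X_dvd_iff.2 hF))
  apply le_antisymm
  · intro F hF
    rw [RingHom.mem_ker, specialHom_apply, initialHom_eq_zero_iff hm hρ] at hF
    have hloc : IsLocalRing (PowerSeries (MvPowerSeries (Fin n) A)) :=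
      inferInstanceAs (IsLocalRing (MvPowerSeries Unit _))
    refine mem_of_forall_mem_sup_pow _ fun N => ?_
    set f := PowerSeries.constantCoeff F with hf
    -- Lift ρ(f_i) ∈ 𝔪^(i+1) to h ∈ (x)^(i+1). Then f_i - h lies in ker ρ and has f_i as its part of
    -- degree i, so its shifted homogenization is congruent to f_i modulo t.
    have hcomp : ∀ i, PowerSeries.C (MvPowerSeries.homogeneousComponent i f) ∈
        homIdeal (RingHom.ker ρ) ⊔ Ideal.span {PowerSeries.X} := by
      intro i
      obtain ⟨h, hh, hρh⟩ := exists_mem_pow_of_mem_pow hm hρ (hF i)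
      have hg : MvPowerSeries.homogeneousComponent i f - h ∈ RingHom.ker ρ := by
        rw [RingHom.mem_ker, map_sub, hρh, sub_self]
      have hg' : MvPowerSeries.homogeneousComponent i f - h ∈ variablesIdeal A n ^ i :=
        sub_mem (homogeneousComponent_mem_pow i f) (Ideal.pow_le_pow_right i.le_succ hh)
      rw [← sub_add_cancel (PowerSeries.C (MvPowerSeries.homogeneousComponent i f))
        (PowerSeries.mk fun j => MvPowerSeries.homogeneousComponent (i + j)
          (MvPowerSeries.homogeneousComponent i f - h))]
      refine add_mem (hX _ ?_) (Ideal.mem_sup_left (shift_mem_homIdeal hg hg'))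
      rw [map_sub, PowerSeries.constantCoeff_C, sub_eq_zero,
        ← PowerSeries.coeff_zero_eq_constantCoeff_apply, PowerSeries.coeff_mk, add_zero]
      ext e
      rw [MvPowerSeries.coeff_homogeneousComponent, MvPowerSeries.coeff_homogeneousComponent,
        map_sub, MvPowerSeries.coeff_homogeneousComponent]
      split_ifs with he
      · rw [mem_variablesIdeal_pow_iff.1 hh e (by omega), sub_zero]
      · rfl
    rw [← sub_add_cancel F (PowerSeries.C (f - ∑ i ∈ Finset.range N,
      MvPowerSeries.homogeneousComponent i f)), add_comm]
    refine add_mem (Ideal.mem_sup_right ?_) (Ideal.mem_sup_left ?_)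
    · refine Ideal.pow_right_mono variables_sup_X_le_maximalIdeal N
        ((mem_map_C_sup_X_pow_iff _ _ _).2 fun j => mem_variablesIdeal_pow_iff.2 fun e he => ?_)
      rw [PowerSeries.coeff_C]
      split_ifs with hj
      · simp only [map_sub, map_sum, MvPowerSeries.coeff_homogeneousComponent,
          Finset.sum_ite_eq, Finset.mem_range]
        rw [if_pos (by omega), sub_self]
      · rfl
    · rw [map_sub, ← sub_add, map_sum]
      refine add_mem (hX _ ?_) (Ideal.sum_mem _ fun i _ => hcomp i)
      rw [map_sub, PowerSeries.constantCoeff_C, ← hf, sub_self]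
  · refine sup_le ?_ ?_
    · rw [homIdeal, Ideal.span_le]
      rintro _ ⟨f, hf, -, rfl⟩
      rw [SetLike.mem_coe, RingHom.mem_ker, specialHom_apply, homogenize,
        ← PowerSeries.coeff_zero_eq_constantCoeff_apply, PowerSeries.coeff_mk, add_zero,
        initialHom_eq_zero_iff hm hρ]
      intro i
      by_cases hi : i = f.order.toNat
      · subst hi
        -- f and its initial form differ by an element of (x)^(o(f)+1). Since ρ(f) = 0, the initial
        -- form maps into 𝔪^(o(f)+1).
        have h1 : f - MvPowerSeries.homogeneousComponent f.order.toNat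
            (MvPowerSeries.homogeneousComponent f.order.toNat f) ∈
            variablesIdeal A n ^ (f.order.toNat + 1) := by
          refine mem_variablesIdeal_pow_iff.2 fun e he => ?_
          rw [map_sub, MvPowerSeries.coeff_homogeneousComponent,
            MvPowerSeries.coeff_homogeneousComponent, sub_eq_zero]
          split_ifs with h
          · rfl
          · refine MvPowerSeries.coeff_of_lt_order
              (lt_of_lt_of_le ?_ (ENat.natCast_toNat_le_self _))
            exact_mod_cast (by omega)
        have h2 := map_mem_pow hm h1
        rw [map_sub, RingHom.mem_ker.1 hf, zero_sub, neg_mem_iff] at h2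
        exact h2
      · suffices h0 : MvPowerSeries.homogeneousComponent i
            (MvPowerSeries.homogeneousComponent f.order.toNat f) = 0 by
          rw [h0, map_zero]
          exact zero_mem _
        ext e
        rw [MvPowerSeries.coeff_homogeneousComponent, MvPowerSeries.coeff_homogeneousComponent]
        split_ifs with h1 h2
        · exact absurd (h1.symm.trans h2) hi
        · rfl
        · rfl
    · rw [Ideal.span_singleton_le_iff_mem, RingHom.mem_ker, specialHom_apply,
        PowerSeries.constantCoeff_X, map_zero]

theorem nonempty_specialFiber_equiv [IsLocalRing A] [IsNoetherianRing A]
    (hm : m = (variablesIdeal A n).map ρ) (hρ : Function.Surjective ρ) :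
    Nonempty ((HomRing (RingHom.ker ρ) ⧸ Ideal.span {tElt (RingHom.ker ρ)}) ≃ₐ[A]
      CompletedGraded m) := by
  let Λ : HomRing (RingHom.ker ρ) →ₐ[A] CompletedGraded m :=
    Ideal.Quotient.liftₐ _ (specialHom hm) fun F hF => by
      have : F ∈ RingHom.ker (specialHom hm) := by
        rw [ker_specialHom hm hρ]
        exact Ideal.mem_sup_left hF
      exact this
  have hΛ : Function.Surjective Λ := fun z => by
    obtain ⟨F, rfl⟩ := specialHom_surjective hm hρ z
    exact ⟨Ideal.Quotient.mk _ F, rfl⟩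
  have hker : RingHom.ker Λ = Ideal.span {tElt (RingHom.ker ρ)} := by
    ext x
    obtain ⟨F, rfl⟩ := Ideal.Quotient.mk_surjective x
    have h1 : Ideal.Quotient.mk (homIdeal (RingHom.ker ρ)) F ∈ RingHom.ker Λ ↔
        F ∈ RingHom.ker (specialHom hm) := Iff.rfl
    rw [h1, ker_specialHom hm hρ, tElt,
      ← Set.image_singleton (f := Ideal.Quotient.mk (homIdeal (RingHom.ker ρ))), ← Ideal.map_span,
      Ideal.mem_map_iff_of_surjective _ Ideal.Quotient.mk_surjective]
    constructor
    · intro h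
      obtain ⟨G, hG, H, hH, rfl⟩ := Submodule.mem_sup.1 h
      exact ⟨H, hH, by rw [map_add, Ideal.Quotient.eq_zero_iff_mem.2 hG, zero_add]⟩
    · rintro ⟨H, hH, h⟩
      rw [← sub_add_cancel F H]
      exact add_mem (Ideal.mem_sup_left ((Ideal.Quotient.eq).1 h.symm)) (Ideal.mem_sup_right hH)
  exact ⟨(Ideal.quotientEquivAlgOfEq A hker.symm).trans
    (Ideal.quotientKerAlgEquivOfSurjective hΛ)⟩

end SpecialFiber

/-! ### Isomorphisms of adic completions -/

/-- The hypotheses say that Φ induces isomorphisms Y/K^N ≅ X/I^N for all N. These are compatible, so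
they pass to the limit, although Φ itself need not be an isomorphism. -/
theorem nonempty_adicCompletion_algEquiv {L X Y : Type*} [CommRing L] [CommRing X] [CommRing Y]
    [Algebra L X] [Algebra L Y] {I : Ideal X} {K : Ideal Y} (Φ : Y →ₐ[L] X)
    (h1 : K.map Φ ≤ I) (h2 : ∀ N x, ∃ y, x - Φ y ∈ I ^ N)
    (h3 : ∀ N y, Φ y ∈ I ^ N → y ∈ K ^ N) :
    Nonempty (AdicCompletion I X ≃ₐ[L] AdicCompletion K Y) := by
  have h4 : ∀ N y, y ∈ K ^ N → Φ y ∈ I ^ N := fun N y hy => by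
    refine Ideal.pow_right_mono h1 N ?_
    rw [← Ideal.map_pow]
    exact Ideal.mem_map_of_mem _ hy
  let f : ∀ N, (Y ⧸ K ^ N) ≃ₐ[L] (X ⧸ I ^ N) := fun N =>
    AlgEquiv.ofBijective (Ideal.Quotient.liftₐ (K ^ N) ((Ideal.Quotient.mkₐ L (I ^ N)).comp Φ)
      fun y hy => Ideal.Quotient.eq_zero_iff_mem.2 (h4 N y hy)) (by
      constructor
      · rw [injective_iff_map_eq_zero]
        intro y hy
        obtain ⟨y, rfl⟩ := Ideal.Quotient.mk_surjective y
        exact Ideal.Quotient.eq_zero_iff_mem.2 (h3 N y (Ideal.Quotient.eq_zero_iff_mem.1 hy))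
      · intro x
        obtain ⟨x, rfl⟩ := Ideal.Quotient.mk_surjective x
        obtain ⟨y, hy⟩ := h2 N x
        exact ⟨Ideal.Quotient.mk _ y, ((Ideal.Quotient.eq).2 hy).symm⟩)
  have hf : ∀ N y, f N (Ideal.Quotient.mk _ y) = Ideal.Quotient.mk _ (Φ y) := fun _ _ => rfl
  have hfsymm : ∀ {M N : ℕ} (h : M ≤ N) (x : X ⧸ I ^ N),
      Ideal.Quotient.factorₐ L (Ideal.pow_le_pow_right h) ((f N).symm x) =
        (f M).symm (Ideal.Quotient.factorₐ L (Ideal.pow_le_pow_right h) x) := by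
    intro M N h x
    obtain ⟨y, rfl⟩ := (f N).surjective x
    obtain ⟨y, rfl⟩ := Ideal.Quotient.mk_surjective y
    rw [AlgEquiv.symm_apply_apply, AlgEquiv.eq_symm_apply, hf]
    rfl
  have hev : ∀ {M N : ℕ} (h : M ≤ N) (y : AdicCompletion K Y),
      Ideal.Quotient.factorₐ L (Ideal.pow_le_pow_right h) (AdicCompletion.evalₐ K N y) =
        AdicCompletion.evalₐ K M y := fun h y => by
    obtain ⟨c, rfl⟩ := AdicCompletion.mk_surjective _ _ y
    rw [AdicCompletion.evalₐ_mk, AdicCompletion.evalₐ_mk]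
    exact AdicCompletion.Ideal.mk_eq_mk _ h c
  have hev' : ∀ {M N : ℕ} (h : M ≤ N) (x : AdicCompletion I X),
      Ideal.Quotient.factorₐ L (Ideal.pow_le_pow_right h) (AdicCompletion.evalₐ I N x) =
        AdicCompletion.evalₐ I M x := fun h y => by
    obtain ⟨c, rfl⟩ := AdicCompletion.mk_surjective _ _ y
    rw [AdicCompletion.evalₐ_mk, AdicCompletion.evalₐ_mk]
    exact AdicCompletion.Ideal.mk_eq_mk _ h c
  let F : AdicCompletion K Y →ₐ[L] AdicCompletion I X :=
    AdicCompletion.liftAlgHom I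
      (fun N => (f N).toAlgHom.comp ((AdicCompletion.evalₐ K N).restrictScalars L)) (by
        intro M N h
        ext y
        change Ideal.Quotient.factorₐ L (Ideal.pow_le_pow_right h)
          (f N (AdicCompletion.evalₐ K N y)) = f M (AdicCompletion.evalₐ K M y)
        rw [← hev h y, ← (f M).symm_apply_eq, ← hfsymm h, AlgEquiv.symm_apply_apply])
  let G : AdicCompletion I X →ₐ[L] AdicCompletion K Y :=
    AdicCompletion.liftAlgHom K
      (fun N => (f N).symm.toAlgHom.comp ((AdicCompletion.evalₐ I N).restrictScalars L)) (by
        intro M N h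
        ext x
        change Ideal.Quotient.factorₐ L (Ideal.pow_le_pow_right h)
          ((f N).symm (AdicCompletion.evalₐ I N x)) = (f M).symm (AdicCompletion.evalₐ I M x)
        rw [hfsymm h, hev' h])
  have hF : ∀ N y, AdicCompletion.evalₐ I N (F y) = f N (AdicCompletion.evalₐ K N y) := fun N y =>
    AdicCompletion.evalₐ_liftAlgHom I _ _ N y
  have hG : ∀ N x, AdicCompletion.evalₐ K N (G x) = (f N).symm (AdicCompletion.evalₐ I N x) :=
    fun N y => AdicCompletion.evalₐ_liftAlgHom K _ _ N y
  refine ⟨AlgEquiv.ofAlgHom G F (AlgHom.ext fun y => AdicCompletion.ext_evalₐ fun N => ?_)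
    (AlgHom.ext fun x => AdicCompletion.ext_evalₐ fun N => ?_)⟩
  · rw [AlgHom.comp_apply, hG, hF, AlgEquiv.symm_apply_apply, AlgHom.id_apply]
  · rw [AlgHom.comp_apply, hF, hG, AlgEquiv.apply_symm_apply, AlgHom.id_apply]

/-- The homomorphism of `L`-algebras on a base change given by a homomorphism of `A`-algebras. -/
def baseChangeLift {A L B C : Type*} [CommRing A] [CommRing L] [CommRing B] [CommRing C]
    [Algebra A L] [Algebra A B] [Algebra A C] [Algebra L C] [IsScalarTower A L C] (g : B →ₐ[A] C) :
    L ⊗[A] B →ₐ[L] C :=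
  Algebra.TensorProduct.lift (Algebra.ofId L C) g fun _ _ => Commute.all _ _

theorem baseChangeLift_one_tmul {A L B C : Type*} [CommRing A] [CommRing L] [CommRing B]
    [CommRing C] [Algebra A L] [Algebra A B] [Algebra A C] [Algebra L C] [IsScalarTower A L C]
    (g : B →ₐ[A] C) (b : B) : baseChangeLift (L := L) g (1 ⊗ₜ b) = g b := by
  rw [baseChangeLift, Algebra.TensorProduct.lift_tmul, map_one, one_mul]

/-! ### The generic fibre: the substitutions x_i ↦ t x_i and x_i ↦ t⁻¹ x_i -/

section GenericFiberIso

variable {A : Type*} [CommRing A] {n : ℕ}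

/-- Finite generation lets all coefficients be written in the same generators, so that their
multipliers assemble into power series. -/
theorem mem_map_C_of_forall_coeff_mem {B : Type*} [CommRing B] {I : Ideal B} (hI : I.FG)
    {F : PowerSeries B} (hF : ∀ j, PowerSeries.coeff j F ∈ I) :
    F ∈ I.map (PowerSeries.C (R := B)) := by
  obtain ⟨r, b, hb⟩ := Submodule.fg_iff_exists_fin_generating_family.1 hI
  rw [show Submodule.span B (Set.range b) = Ideal.span (Set.range b) from rfl] at hb
  subst hb
  simp only [Ideal.mem_span_range_iff_exists_fun] at hF
  choose c hc using hF
  have : F = ∑ i, PowerSeries.mk (fun j => c j i) * PowerSeries.C (b i) := by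
    ext j
    simp [← hc j, PowerSeries.coeff_mul_C]
  rw [this]
  exact Ideal.sum_mem _ fun i _ => Ideal.mul_mem_left _ _
    (Ideal.mem_map_of_mem _ (Ideal.subset_span ⟨i, rfl⟩))

theorem hasSubst_psi : MvPowerSeries.HasSubst (fun i : Fin n =>
    (PowerSeries.C (MvPowerSeries.X i : MvPowerSeries (Fin n) A) * PowerSeries.X :
      PowerSeries (MvPowerSeries (Fin n) A))) := by
  apply MvPowerSeries.hasSubst_of_constantCoeff_zero
  intro i
  change PowerSeries.constantCoeff _ = 0
  simp

/-- The map `psi` as a ring homomorphism. -/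
def psiHom (A : Type*) [CommRing A] (n : ℕ) :
    MvPowerSeries (Fin n) A →+* PowerSeries (MvPowerSeries (Fin n) A) :=
  (MvPowerSeries.substAlgHom hasSubst_psi).toRingHom

theorem psiHom_apply (f : MvPowerSeries (Fin n) A) : psiHom A n f = psi f :=
  congrFun (MvPowerSeries.coe_substAlgHom hasSubst_psi) f

theorem psi_C (a : A) : psi (MvPowerSeries.C a : MvPowerSeries (Fin n) A) =
    PowerSeries.C (MvPowerSeries.C a) := by
  classical
  rw [psi_eq_mk]
  ext j e
  rw [PowerSeries.coeff_mk, MvPowerSeries.coeff_homogeneousComponent, PowerSeries.coeff_C]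
  by_cases he : e = 0
  · subst he
    simp only [map_zero, eq_comm (a := 0)]
    split_ifs <;> simp
  · split_ifs <;> simp [MvPowerSeries.coeff_C, he]

theorem psi_X (i : Fin n) : psi (MvPowerSeries.X i : MvPowerSeries (Fin n) A) =
    PowerSeries.C (MvPowerSeries.X i) * PowerSeries.X := by
  rw [psi, MvPowerSeries.subst_X hasSubst_psi]

/-- The elements `y_i = s ⊗ ρ(x_i)` of `L ⊗ R`. -/
def scaledVar {L R : Type*} [CommRing L] [Algebra A L] [CommRing R] [Algebra A R]
    (s : L) (ρ : MvPowerSeries (Fin n) A →ₐ[A] R) (i : Fin n) : L ⊗[A] R :=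
  s ⊗ₜ ρ (MvPowerSeries.X i)

theorem scaledVar_mem {L R : Type*} [CommRing L] [Algebra A L] [CommRing R] [Algebra A R]
    {ρ : MvPowerSeries (Fin n) A →ₐ[A] R} {m : Ideal R}
    (hm : m = (variablesIdeal A n).map ρ) (s : L) (i : Fin n) :
    scaledVar s ρ i ∈ m.map (Algebra.TensorProduct.includeRight : R →ₐ[A] L ⊗[A] R) := by
  have h : ρ (MvPowerSeries.X i) ∈ m := by
    rw [hm]
    exact Ideal.mem_map_of_mem _ (Ideal.subset_span ⟨i, rfl⟩)
  have : scaledVar s ρ i = s • (Algebra.TensorProduct.includeRight : R →ₐ[A] L ⊗[A] R)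
      (ρ (MvPowerSeries.X i)) := by
    rw [scaledVar, Algebra.TensorProduct.includeRight_apply, TensorProduct.smul_tmul', smul_eq_mul,
      mul_one]
  rw [this]
  exact Submodule.smul_of_tower_mem _ _ (Ideal.mem_map_of_mem _ h)

variable {L H R : Type*} [CommRing L] [Algebra A L] [Algebra (PowerSeries A) L]
  [IsScalarTower A (PowerSeries A) L] [CommRing H] [Algebra (PowerSeries A) H]
  [CommRing R] [Algebra A R]
  {ρ : MvPowerSeries (Fin n) A →ₐ[A] R}
  {π : PowerSeries (MvPowerSeries (Fin n) A) →ₐ[PowerSeries A] H}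

theorem algebraMap_tensor (L : Type*) [CommRing L] [Algebra A L] [Algebra (PowerSeries A) L]
    [IsScalarTower A (PowerSeries A) L] {H : Type*} [CommRing H] [Algebra (PowerSeries A) H]
    (a : A) : algebraMap A (L ⊗[PowerSeries A] H) a =
      1 ⊗ₜ algebraMap (PowerSeries A) H (PowerSeries.C a) := by
  rw [Algebra.TensorProduct.algebraMap_apply, IsScalarTower.algebraMap_apply A (PowerSeries A) L,
    show algebraMap A (PowerSeries A) a = PowerSeries.C a from rfl,
    Algebra.algebraMap_eq_smul_one (A := L) (PowerSeries.C a), TensorProduct.smul_tmul,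
    ← Algebra.algebraMap_eq_smul_one]

/-- The homomorphism `S → L ⊗ T / hom(J)` induced by `psi`. -/
def psiToGeneric (L : Type*) [CommRing L] [Algebra A L] [Algebra (PowerSeries A) L]
    [IsScalarTower A (PowerSeries A) L]
    (π : PowerSeries (MvPowerSeries (Fin n) A) →ₐ[PowerSeries A] H) :
    MvPowerSeries (Fin n) A →ₐ[A] L ⊗[PowerSeries A] H where
  toRingHom := (Algebra.TensorProduct.includeRight : H →ₐ[PowerSeries A]
      L ⊗[PowerSeries A] H).toRingHom.comp (π.toRingHom.comp (psiHom A n))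
  commutes' a := by
    rw [algebraMap_tensor, ← AlgHom.commutes π]
    change (1 : L) ⊗ₜ[PowerSeries A] π (psiHom A n (algebraMap A _ a)) = _
    rw [psiHom_apply, MvPowerSeries.algebraMap_apply, Algebra.algebraMap_self, RingHom.id_apply,
      psi_C, show algebraMap (PowerSeries A) (PowerSeries (MvPowerSeries (Fin n) A))
        (PowerSeries.C a) = PowerSeries.map (algebraMap A _) (PowerSeries.C a) from rfl,
      PowerSeries.map_C]
    rfl

theorem psiToGeneric_apply (f : MvPowerSeries (Fin n) A) :
    psiToGeneric L π f = 1 ⊗ₜ π (psi f) := by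
  rw [← psiHom_apply]
  rfl

/-- The homomorphism `L ⊗ R → L ⊗ T / hom(J)` induced by `psi`. -/
def fiberHom (L : Type*) [CommRing L] [Algebra A L] [Algebra (PowerSeries A) L]
    [IsScalarTower A (PowerSeries A) L] (hρ : Function.Surjective ρ)
    (π : PowerSeries (MvPowerSeries (Fin n) A) →ₐ[PowerSeries A] H)
    (hπ : ∀ f ∈ RingHom.ker ρ, π (psi f) = 0) : L ⊗[A] R →ₐ[L] L ⊗[PowerSeries A] H :=
  baseChangeLift (AlgHom.liftOfSurjective ρ hρ (psiToGeneric L π) fun f hf => by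
    change psiToGeneric L π f = 0
    rw [psiToGeneric_apply, hπ f hf, TensorProduct.tmul_zero])

theorem fiberHom_one_tmul (hρ : Function.Surjective ρ)
    (hπ : ∀ f ∈ RingHom.ker ρ, π (psi f) = 0) (f : MvPowerSeries (Fin n) A) :
    fiberHom L hρ π hπ (1 ⊗ₜ ρ f) = 1 ⊗ₜ π (psi f) := by
  rw [fiberHom, baseChangeLift_one_tmul, ← psiToGeneric_apply]
  exact AlgHom.liftOfSurjective_apply _ _ _ _ _

/-- The polynomial `f(t x_1, ..., t x_n)`. -/
def scalePoly (n : ℕ) (A : Type*) [CommRing A] :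
    MvPolynomial (Fin n) A →+* MvPolynomial (Fin n) (PowerSeries A) :=
  MvPolynomial.eval₂Hom (MvPolynomial.C.comp PowerSeries.C)
    fun i => MvPolynomial.C PowerSeries.X * MvPolynomial.X i

theorem scalePoly_monomial (e : Fin n →₀ ℕ) (a : A) :
    scalePoly n A (MvPolynomial.monomial e a) =
      MvPolynomial.monomial e (PowerSeries.C a * PowerSeries.X ^ e.degree) := by
  rw [scalePoly, MvPolynomial.coe_eval₂Hom, MvPolynomial.eval₂_monomial,
    MvPolynomial.monomial_eq (s := e)]
  simp only [mul_pow, Finsupp.prod, Finset.prod_mul_distrib, Finset.prod_pow_eq_pow_sum, map_mul,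
    map_pow, RingHom.comp_apply, Finsupp.degree, mul_assoc]
  rfl

theorem coeff_scalePoly (f : MvPolynomial (Fin n) A) (e : Fin n →₀ ℕ) :
    (scalePoly n A f).coeff e = PowerSeries.C (f.coeff e) * PowerSeries.X ^ e.degree := by
  classical
  induction f using MvPolynomial.induction_on' with
  | monomial d a =>
    rw [scalePoly_monomial, MvPolynomial.coeff_monomial, MvPolynomial.coeff_monomial]
    split_ifs with h
    · rw [h]
    · rw [map_zero, zero_mul]
  | add f g hf hg => rw [map_add, MvPolynomial.coeff_add, hf, hg, MvPolynomial.coeff_add, map_add,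
      add_mul]

theorem truncTotal_swapHom_psi (N : ℕ) (f : MvPowerSeries (Fin n) A) :
    MvPowerSeries.truncTotal N (swapHom (Fin n) A (psi f)) =
      scalePoly n A (MvPowerSeries.truncTotal N f) := by
  ext e j
  rw [coeff_scalePoly, MvPowerSeries.coeff_truncTotal_eq_ite, MvPowerSeries.coeff_truncTotal_eq_ite,
    PowerSeries.coeff_C_mul, PowerSeries.coeff_X_pow]
  split_ifs with h1 h2 h2
  · rw [coeff_coeff_swapHom, psi_eq_mk, PowerSeries.coeff_mk,
      MvPowerSeries.coeff_homogeneousComponent, if_pos h2.symm, mul_one]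
  · rw [coeff_coeff_swapHom, psi_eq_mk, PowerSeries.coeff_mk,
      MvPowerSeries.coeff_homogeneousComponent, if_neg (Ne.symm h2), mul_zero]
  · rw [map_zero, zero_mul]
  · rw [map_zero, zero_mul]

/-- Scaling by t and then evaluating at the s ⊗ ρ(x_i) cancels, because s is inverse to t. It
suffices to check constants and variables. -/
theorem aeval_scalePoly {s : L} (hs : s * algebraMap (PowerSeries A) L PowerSeries.X = 1)
    (f : MvPolynomial (Fin n) A) :
    MvPolynomial.aeval (scaledVar s ρ) (scalePoly n A f) = 1 ⊗ₜ ρ f := by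
  have : (MvPolynomial.aeval (R := PowerSeries A) (scaledVar s ρ)).toRingHom.comp (scalePoly n A) =
      (Algebra.TensorProduct.includeRight : R →ₐ[A] L ⊗[A] R).toRingHom.comp
        (ρ.toRingHom.comp MvPolynomial.coeToMvPowerSeries.ringHom) := by
    refine MvPolynomial.ringHom_ext (fun a => ?_) fun i => ?_
    · change MvPolynomial.aeval (scaledVar s ρ) (scalePoly n A (MvPolynomial.C a)) = (1 : L) ⊗ₜ
        ρ (MvPolynomial.C a : MvPolynomial (Fin n) A)
      rw [scalePoly, MvPolynomial.coe_eval₂Hom, MvPolynomial.eval₂_C, RingHom.comp_apply,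
        MvPolynomial.aeval_C, MvPolynomial.coe_C, show ρ (MvPowerSeries.C a) = algebraMap A R a from
          AlgHom.commutes ρ a, Algebra.algebraMap_eq_smul_one (A := R), ← TensorProduct.smul_tmul,
        Algebra.TensorProduct.algebraMap_apply, Algebra.smul_def, mul_one,
        IsScalarTower.algebraMap_apply A (PowerSeries A) L]
      rfl
    · change MvPolynomial.aeval (scaledVar s ρ) (scalePoly n A (MvPolynomial.X i)) = (1 : L) ⊗ₜ
        ρ (MvPolynomial.X i : MvPolynomial (Fin n) A)
      rw [scalePoly, MvPolynomial.coe_eval₂Hom, MvPolynomial.eval₂_X, map_mul,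
        MvPolynomial.aeval_C, MvPolynomial.aeval_X, MvPolynomial.coe_X, scaledVar,
        Algebra.TensorProduct.algebraMap_apply, Algebra.TensorProduct.tmul_mul_tmul, one_mul,
        mul_comm, hs]
  exact RingHom.congr_fun this f

/-- The isomorphism `A[[x]][[t]] → A[[t]][[x]]`, as a homomorphism of `A[[t]]`-algebras. -/
def swapAlgHom (n : ℕ) (A : Type*) [CommRing A] :
    PowerSeries (MvPowerSeries (Fin n) A) →ₐ[PowerSeries A]
    MvPowerSeries (Fin n) (PowerSeries A) where
  toRingHom := swapHom (Fin n) A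
  commutes' F := by
    classical
    change swapHom (Fin n) A (PowerSeries.map (algebraMap A _) F) = MvPowerSeries.C F
    ext e j
    rw [coeff_coeff_swapHom, PowerSeries.coeff_map, MvPowerSeries.algebraMap_apply,
      Algebra.algebraMap_self, RingHom.id_apply, MvPowerSeries.coeff_C, MvPowerSeries.coeff_C]
    split_ifs
    · rfl
    · rw [map_zero]

/-- The homomorphism `T → (L ⊗ R)^` with `t ↦ t` and `x_i ↦ t⁻¹ ⊗ ρ(x_i)`. -/
def unscaleHom {m : Ideal R} (hm : m = (variablesIdeal A n).map ρ) (s : L) :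
    PowerSeries (MvPowerSeries (Fin n) A) →ₐ[PowerSeries A] AdicCompletion
      (m.map (Algebra.TensorProduct.includeRight : R →ₐ[A] L ⊗[A] R)) (L ⊗[A] R) :=
  (evalHat (A := PowerSeries A) _ (scaledVar s ρ) (scaledVar_mem hm s)).comp (swapAlgHom n A)

theorem evalₐ_unscaleHom {m : Ideal R} (hm : m = (variablesIdeal A n).map ρ) (s : L) (N : ℕ)
    (F : PowerSeries (MvPowerSeries (Fin n) A)) :
    AdicCompletion.evalₐ _ N (unscaleHom hm s F) = Ideal.Quotient.mk _
      (MvPolynomial.aeval (scaledVar s ρ) (MvPowerSeries.truncTotal N (swapHom (Fin n) A F))) :=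
  evalₐ_evalHat _ _ (scaledVar_mem hm s) N _

/-- Polynomial cancellation, applied to truncations modulo each power of the ideal. This is half of
the statement that the two substitutions are inverse. -/
theorem unscaleHom_psi {m : Ideal R} (hm : m = (variablesIdeal A n).map ρ) {s : L}
    (hs : s * algebraMap (PowerSeries A) L PowerSeries.X = 1) (f : MvPowerSeries (Fin n) A) :
    unscaleHom hm s (psi f) = AdicCompletion.of _ _ (1 ⊗ₜ ρ f) := by
  refine AdicCompletion.ext_evalₐ fun N => ?_
  rw [evalₐ_unscaleHom, AdicCompletion.evalₐ_of, truncTotal_swapHom_psi, aeval_scalePoly hs,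
    Ideal.Quotient.eq, ← TensorProduct.tmul_sub, ← map_sub, ← Ideal.map_pow]
  refine Ideal.mem_map_of_mem (Algebra.TensorProduct.includeRight : R →ₐ[A] L ⊗[A] R)
    (map_mem_pow hm (mem_variablesIdeal_pow_iff.2 fun e he => ?_))
  rw [map_sub, MvPolynomial.coeff_coe, MvPowerSeries.coeff_truncTotal _ he, sub_self]

end GenericFiberIso

/-! ### The generic fibre: density, kernels and the isomorphism of completions -/

section GenericFiberIso

variable {A : Type*} [CommRing A] {n : ℕ}

/-- Polynomials over `A[[t]]` as elements of `T`. -/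
def polyToT (n : ℕ) (A : Type*) [CommRing A] :
    MvPolynomial (Fin n) (PowerSeries A) →ₐ[PowerSeries A]
    PowerSeries (MvPowerSeries (Fin n) A) :=
  MvPolynomial.aeval fun i => PowerSeries.C (MvPowerSeries.X i)

theorem algebraMap_powerSeries (F : PowerSeries A) :
    algebraMap (PowerSeries A) (PowerSeries (MvPowerSeries (Fin n) A)) F =
      PowerSeries.map (algebraMap A _) F := rfl

theorem coeff_coeff_polyToT (g : MvPolynomial (Fin n) (PowerSeries A)) (e : Fin n →₀ ℕ) (j : ℕ) :
    MvPowerSeries.coeff e (PowerSeries.coeff j (polyToT n A g)) =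
      PowerSeries.coeff j (g.coeff e) := by
  classical
  induction g using MvPolynomial.induction_on' with
  | monomial d a =>
    have h : (d.prod fun i k =>
        (PowerSeries.C (MvPowerSeries.X i) : PowerSeries (MvPowerSeries (Fin n) A)) ^ k) =
        PowerSeries.C (MvPowerSeries.monomial d 1) := by
      rw [MvPowerSeries.monomial_one_eq]
      simp only [Finsupp.prod, map_prod, map_pow]
    rw [polyToT, MvPolynomial.aeval_monomial, h, PowerSeries.coeff_mul_C, algebraMap_powerSeries,
      PowerSeries.coeff_map, MvPowerSeries.algebraMap_apply, Algebra.algebraMap_self,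
      RingHom.id_apply, MvPowerSeries.coeff_C_mul, MvPowerSeries.coeff_monomial,
      MvPolynomial.coeff_monomial]
    by_cases hd : e = d
    · rw [if_pos hd, if_pos hd.symm, mul_one]
    · rw [if_neg hd, if_neg (Ne.symm hd), mul_zero, map_zero]
  | add f g hf hg =>
    rw [map_add, map_add, map_add, hf, hg, MvPolynomial.coeff_add, map_add]

/-- Truncating in x while keeping full power series in t turns F into a polynomial over A[[t]], with
an error in (x)^N T. -/
theorem sub_polyToT_mem (N : ℕ) (F : PowerSeries (MvPowerSeries (Fin n) A)) :
    F - polyToT n A (MvPowerSeries.truncTotal N (swapHom (Fin n) A F)) ∈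
      (variablesIdeal A n ^ N).map PowerSeries.C := by
  have hfg : (variablesIdeal A n).FG := Submodule.fg_span (Set.finite_range _)
  refine mem_map_C_of_forall_coeff_mem hfg.pow fun j => mem_variablesIdeal_pow_iff.2 fun e he => ?_
  rw [map_sub, map_sub, coeff_coeff_polyToT, MvPowerSeries.coeff_truncTotal _ he,
    coeff_coeff_swapHom, sub_self]

theorem algebraMap_X_mul_cancel {L Z : Type*} [CommRing L] [Algebra (PowerSeries A) L]
    [CommRing Z] [Algebra L Z]
    [Algebra (PowerSeries A) Z] [IsScalarTower (PowerSeries A) L Z] {s : L}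
    (hs : s * algebraMap (PowerSeries A) L PowerSeries.X = 1) (z : Z) :
    s • (algebraMap (PowerSeries A) Z PowerSeries.X * z) = z := by
  rw [IsScalarTower.algebraMap_apply (PowerSeries A) L Z, ← Algebra.smul_def, smul_smul, hs,
    one_smul]

variable {L H R : Type*} [CommRing L] [Algebra A L] [Algebra (PowerSeries A) L]
  [IsScalarTower A (PowerSeries A) L] [CommRing H] [Algebra (PowerSeries A) H]
  [CommRing R] [Algebra A R]
  {ρ : MvPowerSeries (Fin n) A →ₐ[A] R}
  {π : PowerSeries (MvPowerSeries (Fin n) A) →ₐ[PowerSeries A] H}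

/-- The extension to `L ⊗ H` of an ideal of `S`. -/
abbrev fiberIdeal (L : Type*) [CommRing L] [Algebra (PowerSeries A) L]
    (π : PowerSeries (MvPowerSeries (Fin n) A) →ₐ[PowerSeries A] H)
    (I : Ideal (MvPowerSeries (Fin n) A)) : Ideal (L ⊗[PowerSeries A] H) :=
  ((I.map PowerSeries.C).map π).map
    (Algebra.TensorProduct.includeRight : H →ₐ[PowerSeries A] L ⊗[PowerSeries A] H)

/-- The extension to `L ⊗ R` of an ideal of `R`. -/
abbrev constIdeal (A L : Type*) [CommRing A] [CommRing L] [Algebra A L] {R : Type*} [CommRing R]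
    [Algebra A R] (m : Ideal R) : Ideal (L ⊗[A] R) :=
  m.map (Algebra.TensorProduct.includeRight : R →ₐ[A] L ⊗[A] R)

theorem map_X_eq_algebraMap (π : PowerSeries (MvPowerSeries (Fin n) A) →ₐ[PowerSeries A] H) :
    π PowerSeries.X = algebraMap (PowerSeries A) H PowerSeries.X := by
  rw [← AlgHom.commutes π, algebraMap_powerSeries, PowerSeries.map_X]

theorem fiberHom_scaledVar (hρ : Function.Surjective ρ)
    (hπ : ∀ f ∈ RingHom.ker ρ, π (psi f) = 0) {s : L}
    (hs : s * algebraMap (PowerSeries A) L PowerSeries.X = 1) (i : Fin n) :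
    fiberHom L hρ π hπ (scaledVar s ρ i) = 1 ⊗ₜ π (PowerSeries.C (MvPowerSeries.X i)) := by
  have h1 : scaledVar s ρ i = s • ((1 : L) ⊗ₜ[A] ρ (MvPowerSeries.X i)) := by
    rw [scaledVar, TensorProduct.smul_tmul', smul_eq_mul, mul_one]
  rw [h1, map_smul, fiberHom_one_tmul, psi_X, map_mul, map_X_eq_algebraMap,
    mul_comm (π _), ← Algebra.smul_def, ← TensorProduct.smul_tmul, TensorProduct.smul_tmul',
    smul_eq_mul, Algebra.smul_def, mul_one, hs]

theorem exists_fiberHom_eq (hρ : Function.Surjective ρ)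
    (hπ : ∀ f ∈ RingHom.ker ρ, π (psi f) = 0) {s : L}
    (hs : s * algebraMap (PowerSeries A) L PowerSeries.X = 1)
    (g : MvPolynomial (Fin n) (PowerSeries A)) :
    ∃ y, fiberHom L hρ π hπ y = 1 ⊗ₜ π (polyToT n A g) := by
  induction g using MvPolynomial.induction_on with
  | C a =>
    refine ⟨algebraMap L _ (algebraMap (PowerSeries A) L a), ?_⟩
    rw [AlgHom.commutes, ← MvPolynomial.algebraMap_eq, AlgHom.commutes, AlgHom.commutes,
      Algebra.TensorProduct.algebraMap_apply, Algebra.algebraMap_self, RingHom.id_apply,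
      Algebra.algebraMap_eq_smul_one, TensorProduct.smul_tmul, ← Algebra.algebraMap_eq_smul_one]
  | add f g hf hg =>
    obtain ⟨y, hy⟩ := hf
    obtain ⟨z, hz⟩ := hg
    exact ⟨y + z, by rw [map_add, hy, hz, map_add, map_add, TensorProduct.tmul_add]⟩
  | mul_X f i hf =>
    obtain ⟨y, hy⟩ := hf
    refine ⟨y * scaledVar s ρ i, ?_⟩
    rw [map_mul, hy, fiberHom_scaledVar hρ hπ hs, Algebra.TensorProduct.tmul_mul_tmul, one_mul,
      map_mul, map_mul, polyToT, MvPolynomial.aeval_X]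

/-- The image contains the scalars and the x_i, because t is invertible, hence all polynomials over
A[[t]]; these approximate T modulo (x)^N. -/
theorem fiberHom_surjective_mod (hρ : Function.Surjective ρ) (hπ' : Function.Surjective π)
    (hπ : ∀ f ∈ RingHom.ker ρ, π (psi f) = 0) {s : L}
    (hs : s * algebraMap (PowerSeries A) L PowerSeries.X = 1) (N : ℕ)
    (x : L ⊗[PowerSeries A] H) : ∃ y, x - fiberHom L hρ π hπ y ∈
      fiberIdeal L π (variablesIdeal A n) ^ N := by
  induction x using TensorProduct.induction_on with
  | zero => exact ⟨0, by rw [map_zero, sub_zero]; exact zero_mem _⟩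
  | add x x' hx hx' =>
    obtain ⟨y, hy⟩ := hx
    obtain ⟨y', hy'⟩ := hx'
    exact ⟨y + y', by rw [map_add, add_sub_add_comm]; exact add_mem hy hy'⟩
  | tmul l h =>
    obtain ⟨F, rfl⟩ := hπ' h
    obtain ⟨y, hy⟩ := exists_fiberHom_eq hρ hπ hs
      (MvPowerSeries.truncTotal N (swapHom (Fin n) A F))
    refine ⟨l • y, ?_⟩
    have h1 : l ⊗ₜ[PowerSeries A] π F = l • ((1 : L) ⊗ₜ[PowerSeries A] π F) := by
      rw [TensorProduct.smul_tmul', smul_eq_mul, mul_one]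
    rw [map_smul, hy, h1, ← smul_sub, ← TensorProduct.tmul_sub, ← map_sub]
    refine Submodule.smul_of_tower_mem _ _ ?_
    rw [← Ideal.map_pow, ← Ideal.map_pow, ← Ideal.map_pow]
    exact Ideal.mem_map_of_mem
      (Algebra.TensorProduct.includeRight : H →ₐ[PowerSeries A] L ⊗[PowerSeries A] H)
      (Ideal.mem_map_of_mem π (sub_polyToT_mem N F))

theorem fiberHom_map_le {m : Ideal R} (hm : m = (variablesIdeal A n).map ρ)
    (hρ : Function.Surjective ρ) (hπ : ∀ f ∈ RingHom.ker ρ, π (psi f) = 0) :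
    (constIdeal A L m).map (fiberHom L hρ π hπ) ≤
      fiberIdeal L π (variablesIdeal A n) := by
  rw [hm, Ideal.map_le_iff_le_comap, Ideal.map_le_iff_le_comap, Ideal.map_le_iff_le_comap,
    variablesIdeal, Ideal.span_le]
  rintro _ ⟨i, rfl⟩
  change fiberHom L hρ π hπ (1 ⊗ₜ ρ (MvPowerSeries.X i)) ∈ fiberIdeal L π (variablesIdeal A n)
  rw [fiberHom_one_tmul, psi_X, map_mul, ← one_mul (1 : L),
    ← Algebra.TensorProduct.tmul_mul_tmul]
  refine Ideal.mul_mem_right _ _ (Ideal.mem_map_of_mem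
    (Algebra.TensorProduct.includeRight : H →ₐ[PowerSeries A] L ⊗[PowerSeries A] H)
    (Ideal.mem_map_of_mem π (Ideal.mem_map_of_mem _ (Ideal.subset_span ⟨i, rfl⟩))))

/-- t^o(f) hom(f) = ψ(f) maps to 1 ⊗ ρ(f) = 0, and t acts invertibly on the target. -/
theorem unscaleHom_homogenize {m : Ideal R} (hm : m = (variablesIdeal A n).map ρ) {s : L}
    (hs : s * algebraMap (PowerSeries A) L PowerSeries.X = 1) {f : MvPowerSeries (Fin n) A}
    (hf : f ∈ RingHom.ker ρ) : unscaleHom hm s (homogenize f) = 0 := by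
  have h : ∀ k, unscaleHom hm s (PowerSeries.X ^ k * homogenize f) = 0 →
      unscaleHom hm s (homogenize f) = 0 := by
    intro k
    induction k with
    | zero => intro h; rwa [pow_zero, one_mul] at h
    | succ k ih =>
      intro h
      refine ih ?_
      rw [pow_succ', mul_assoc, map_mul, map_X_eq_algebraMap] at h
      rw [← algebraMap_X_mul_cancel hs (unscaleHom hm s _), h, smul_zero]
  refine h f.order.toNat ?_
  rw [X_pow_mul_homogenize, unscaleHom_psi hm hs, RingHom.mem_ker.1 hf, TensorProduct.tmul_zero,
    map_zero]

theorem unscaleHom_C_X {m : Ideal R} (hm : m = (variablesIdeal A n).map ρ) {s : L}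
    (hs : s * algebraMap (PowerSeries A) L PowerSeries.X = 1) (i : Fin n) :
    unscaleHom hm s (PowerSeries.C (MvPowerSeries.X i)) =
      s • AdicCompletion.of _ _ (1 ⊗ₜ ρ (MvPowerSeries.X i)) := by
  rw [← unscaleHom_psi hm hs, psi_X, mul_comm, map_mul, map_X_eq_algebraMap,
    algebraMap_X_mul_cancel hs]

variable [IsLocalRing A]

/-- Besides the variables, the ideal of S contains the maximal ideal of A. The hypothesis `hA` makes
that part land in the extension of m as well. -/
theorem evalₐ_unscaleHom_mem {m : Ideal R} (hm : m = (variablesIdeal A n).map ρ)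
    (hA : ∀ a ∈ maximalIdeal A, algebraMap A R a ∈ m) {s : L}
    (hs : s * algebraMap (PowerSeries A) L PowerSeries.X = 1) (N : ℕ) :
    (bigIdeal A n).map ((AdicCompletion.evalₐ _ N).toRingHom.comp
      ((unscaleHom hm s).toRingHom.comp PowerSeries.C)) ≤
      (constIdeal A L m).map
        (Ideal.Quotient.mk (constIdeal A L m ^ N)) := by
  rw [Ideal.map_le_iff_le_comap, bigIdeal, sup_le_iff, Ideal.map_le_iff_le_comap, variablesIdeal,
    Ideal.span_le]
  constructor
  · intro a ha
    change AdicCompletion.evalₐ _ N (unscaleHom hm s (PowerSeries.C (MvPowerSeries.C a))) ∈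
      (constIdeal A L m).map (Ideal.Quotient.mk (constIdeal A L m ^ N))
    rw [← psi_C, unscaleHom_psi hm hs, AdicCompletion.evalₐ_of]
    refine Ideal.mem_map_of_mem _ (Ideal.mem_map_of_mem
      (Algebra.TensorProduct.includeRight : R →ₐ[A] L ⊗[A] R) ?_)
    rw [show ρ (MvPowerSeries.C a) = algebraMap A R a from AlgHom.commutes ρ a]
    exact hA a ha
  · rintro _ ⟨i, rfl⟩
    change AdicCompletion.evalₐ _ N (unscaleHom hm s (PowerSeries.C (MvPowerSeries.X i))) ∈
      (constIdeal A L m).map (Ideal.Quotient.mk (constIdeal A L m ^ N))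
    rw [unscaleHom_C_X hm hs, Algebra.smul_def, map_mul, AdicCompletion.evalₐ_of]
    refine Ideal.mul_mem_left _ _ (Ideal.mem_map_of_mem _ (Ideal.mem_map_of_mem
      (Algebra.TensorProduct.includeRight : R →ₐ[A] L ⊗[A] R) ?_))
    rw [hm]
    exact Ideal.mem_map_of_mem _ (Ideal.subset_span ⟨i, rfl⟩)

theorem nonempty_genericFiber_equiv_aux {m : Ideal R} (hm : m = (variablesIdeal A n).map ρ)
    (hρ : Function.Surjective ρ) (hA : ∀ a ∈ maximalIdeal A, algebraMap A R a ∈ m)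
    (hπ : Function.Surjective π) (hker : RingHom.ker π = homIdeal (RingHom.ker ρ)) {s : L}
    (hs : s * algebraMap (PowerSeries A) L PowerSeries.X = 1) {I : Ideal (L ⊗[PowerSeries A] H)}
    (hI : I = fiberIdeal L π (bigIdeal A n)) :
    Nonempty (AdicCompletion I (L ⊗[PowerSeries A] H) ≃ₐ[L]
      AdicCompletion (constIdeal A L m) (L ⊗[A] R)) := by
  subst hI
  have hπpsi : ∀ f ∈ RingHom.ker ρ, π (psi f) = 0 := fun f hf => by
    rw [← RingHom.mem_ker, hker]
    exact psi_mem_homIdeal hf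
  have hle : fiberIdeal L π (variablesIdeal A n) ≤
      fiberIdeal L π (bigIdeal A n) :=
    Ideal.map_mono (Ideal.map_mono (Ideal.map_mono le_sup_right))
  have hkerle : RingHom.ker π ≤ RingHom.ker (unscaleHom hm s) := by
    rw [hker, homIdeal, Ideal.span_le]
    rintro _ ⟨f, hf, -, rfl⟩
    exact unscaleHom_homogenize hm hs hf
  let Ψ₀ := AlgHom.liftOfSurjective π hπ (unscaleHom hm s) hkerle
  have hΨ₀ : ∀ F, Ψ₀ (π F) = unscaleHom hm s F :=
    AlgHom.liftOfSurjective_apply _ _ _ hkerle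
  let Ψ := baseChangeLift (L := L) Ψ₀
  have hΨ : ∀ F, Ψ (1 ⊗ₜ π F) = unscaleHom hm s F := fun F => by
    rw [← hΨ₀]
    exact baseChangeLift_one_tmul _ _
  -- Ψ is a left inverse of Φ up to the canonical map to the completion; with density of the image,
  -- this replaces a two-sided inverse.
  have hΨΦ : ∀ y, Ψ (fiberHom L hρ π hπpsi y) = AdicCompletion.of _ _ y := by
    intro y
    induction y using TensorProduct.induction_on with
    | zero => simp only [map_zero]
    | add y z hy hz => simp only [map_add, hy, hz]
    | tmul l r =>
      obtain ⟨f, rfl⟩ := hρ r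
      have h1 : l ⊗ₜ[A] ρ f = l • ((1 : L) ⊗ₜ[A] ρ f) := by
        rw [TensorProduct.smul_tmul', smul_eq_mul, mul_one]
      rw [h1, map_smul, fiberHom_one_tmul, map_smul, hΨ, unscaleHom_psi hm hs]
      rfl
  refine nonempty_adicCompletion_algEquiv (fiberHom L hρ π hπpsi)
    ((fiberHom_map_le hm hρ hπpsi).trans hle) (fun N x => ?_) fun N y hy => ?_
  · obtain ⟨y, hy⟩ := fiberHom_surjective_mod hρ hπ hπpsi hs N x
    exact ⟨y, Ideal.pow_right_mono hle N hy⟩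
  -- g carries the ideal of the fibre into the image of K modulo K^N, whose N-th power is zero. So
  -- Φ(y) in the N-th power forces y ∈ K^N.
  · let g := (AdicCompletion.evalₐ (constIdeal A L m) N).toRingHom.comp Ψ.toRingHom
    have hg : (fiberIdeal L π (bigIdeal A n)).map g ≤
        (constIdeal A L m).map
        (Ideal.Quotient.mk (constIdeal A L m ^ N)) := by
      rw [Ideal.map_le_iff_le_comap, Ideal.map_le_iff_le_comap, Ideal.map_le_iff_le_comap,
        Ideal.map_le_iff_le_comap]
      intro b hb
      change AdicCompletion.evalₐ _ N (Ψ (1 ⊗ₜ π (PowerSeries.C b))) ∈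
      (constIdeal A L m).map (Ideal.Quotient.mk (constIdeal A L m ^ N))
      rw [hΨ]
      exact evalₐ_unscaleHom_mem hm hA hs N (Ideal.mem_map_of_mem _ hb)
    have h1 : g (fiberHom L hρ π hπpsi y) ∈ _ := Ideal.mem_map_of_mem g hy
    rw [Ideal.map_pow] at h1
    have h2 := Ideal.pow_right_mono hg N h1
    have h3 : (constIdeal A L m).map (Ideal.Quotient.mk (constIdeal A L m ^ N)) ^ N = ⊥ := by
      generalize constIdeal A L m = K
      rw [← Ideal.map_pow, Ideal.map_quotient_self]
    rw [h3, Ideal.mem_bot] at h2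
    change AdicCompletion.evalₐ _ N (Ψ (fiberHom L hρ π hπpsi y)) = 0 at h2
    rw [hΨΦ, AdicCompletion.evalₐ_of] at h2
    exact Ideal.Quotient.eq_zero_iff_mem.1 h2

end GenericFiberIso

theorem nonempty_genericFiber_equiv {A R : Type*} [CommRing A] [IsLocalRing A] [CommRing R]
    [IsLocalRing R] [Algebra A R] {n : ℕ} {ρ : MvPowerSeries (Fin n) A →ₐ[A] R}
    (hm : maximalIdeal R = (variablesIdeal A n).map ρ)
    (hρ : Function.Surjective ρ) (hA : ∀ a ∈ maximalIdeal A, algebraMap A R a ∈ maximalIdeal R) :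
    Nonempty (CompletedGenericFiber (RingHom.ker ρ) ≃ₐ[LaurentSeries A]
      CompletedConstantFiber A R) := by
  have : IsScalarTower A (PowerSeries A) (LaurentSeries A) := by
    refine .of_algebraMap_eq fun a => ?_
    rw [HahnSeries.algebraMap_apply, LaurentSeries.coe_algebraMap]
    exact (HahnSeries.ofPowerSeries_C a).symm
  have hs : (HahnSeries.single (-1) 1 : LaurentSeries A) *
      algebraMap (PowerSeries A) (LaurentSeries A) PowerSeries.X = 1 := by
    rw [LaurentSeries.coe_algebraMap, HahnSeries.ofPowerSeries_X, HahnSeries.single_mul_single]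
    simp
  let π : PowerSeries (MvPowerSeries (Fin n) A) →ₐ[PowerSeries A] HomRing (RingHom.ker ρ) :=
    Ideal.Quotient.mkₐ (PowerSeries A) (homIdeal (RingHom.ker ρ))
  have hπ : Function.Surjective π := Ideal.Quotient.mkₐ_surjective _ _
  have hker : RingHom.ker π = homIdeal (RingHom.ker ρ) :=
    Ideal.Quotient.mkₐ_ker (PowerSeries A) _
  have hmap : ((bigIdeal A n).map PowerSeries.C).map (Ideal.Quotient.mk (homIdeal (RingHom.ker ρ))) =
      ((bigIdeal A n).map PowerSeries.C).map π := rfl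
  exact nonempty_genericFiber_equiv_aux (L := LaurentSeries A) (H := HomRing (RingHom.ker ρ)) hm hρ
    hA hπ hker hs
    (congrArg (Ideal.map (Algebra.TensorProduct.includeRight : HomRing (RingHom.ker ρ) →ₐ[PowerSeries A]
      LaurentSeries A ⊗[PowerSeries A] HomRing (RingHom.ker ρ))) hmap)

/-! ### Presentations of complete local rings -/

section Presentation

theorem maximalIdeal_eq_map_of_surjective {B C : Type*} [CommRing B] [IsLocalRing B] [CommRing C]
    [IsLocalRing C] (f : B →+* C) (hf : Function.Surjective f) :
    maximalIdeal C = (maximalIdeal B).map f := by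
  have h : IsLocalHom f := .of_surjective _ hf
  have := ((local_hom_TFAE f).out 0 4 rfl rfl).1 h
  rw [← this, Ideal.map_comap_of_surjective _ hf]

theorem sub_C_constantCoeff_mem {A : Type*} [CommRing A] {n : ℕ} (f : MvPowerSeries (Fin n) A) :
    f - MvPowerSeries.C (MvPowerSeries.constantCoeff f) ∈ variablesIdeal A n := by
  rw [← pow_one (variablesIdeal A n), mem_variablesIdeal_pow_iff]
  intro e he
  obtain rfl : e = 0 := by simpa [Finsupp.degree_eq_zero_iff] using he
  simp

variable {R : Type*} [CommRing R] [IsLocalRing R]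

/-- The constant term of a relation dies in the residue field. Its linear part then maps into 𝔪²,
and independence of the y_i in the cotangent space makes all linear coefficients vanish. -/
theorem coeff_eq_zero_of_basis {A : Type*} [CommRing A] [Algebra A R] {n : ℕ}
    (q : MvPowerSeries (Fin n) A →ₐ[A] R) (y : Fin n → maximalIdeal R)
    (hy : ∀ i, q (MvPowerSeries.X i) = y i)
    (hres : Function.Injective fun a => residue R (algebraMap A R a))
    (hli : LinearIndependent (ResidueField R) fun i => (maximalIdeal R).toCotangent (y i)) :
    RingHom.ker q ≤ variablesIdeal A n ^ 2 := by
  classical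
  have hres0 : ∀ a, residue R (algebraMap A R a) = 0 → a = 0 := fun a ha =>
    hres (by simpa using ha)
  have hm : (variablesIdeal A n).map q ≤ maximalIdeal R := by
    rw [variablesIdeal, Ideal.map_span, Ideal.span_le]
    rintro _ ⟨_, ⟨i, rfl⟩, rfl⟩
    rw [hy]
    exact (y i).2
  intro f hf
  have h0 : MvPowerSeries.coeff 0 f = 0 := by
    refine hres0 _ ((residue_eq_zero_iff _).2 ?_)
    have h1 := hm (Ideal.mem_map_of_mem q (sub_C_constantCoeff_mem f))
    rw [map_sub, RingHom.mem_ker.1 hf, zero_sub, neg_mem_iff] at h1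
    rw [← AlgHom.commutes q]
    exact h1
  have hlin : f - ∑ i, MvPowerSeries.C (MvPowerSeries.coeff (Finsupp.single i 1) f) *
      MvPowerSeries.X i ∈ variablesIdeal A n ^ 2 := by
    rw [mem_variablesIdeal_pow_iff]
    intro e he
    simp only [map_sub, map_sum, MvPowerSeries.coeff_C_mul, MvPowerSeries.coeff_X, mul_ite, mul_one,
      mul_zero]
    rcases Nat.lt_or_ge e.degree 1 with h | h
    · obtain rfl : e = 0 := by simpa [Finsupp.degree_eq_zero_iff] using h
      rw [h0, Finset.sum_eq_zero, sub_zero]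
      intro i _
      rw [if_neg]
      intro h
      simpa using DFunLike.congr_fun h i
    · obtain ⟨j, rfl⟩ : ∃ j, e = Finsupp.single j 1 := by
        exact (Finsupp.sum_eq_one_iff e).1
          (show e.sum (fun _ n => n) = 1 from (by omega : e.degree = 1))
      rw [Finset.sum_eq_single j, if_pos rfl, sub_self]
      · intro i _ hij
        rw [if_neg]
        intro h
        exact hij ((Finsupp.single_left_inj one_ne_zero).1 h).symm
      · simp
  have hsum : ∑ i, algebraMap A R (MvPowerSeries.coeff (Finsupp.single i 1) f) * (y i : R) ∈
      maximalIdeal R ^ 2 := by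
    have h1 := Ideal.pow_right_mono hm 2 (by
      rw [← Ideal.map_pow]
      exact Ideal.mem_map_of_mem q hlin)
    rw [map_sub, RingHom.mem_ker.1 hf, zero_sub, neg_mem_iff, map_sum] at h1
    convert h1 using 2 with i
    rw [map_mul, hy, ← AlgHom.commutes q]
    rfl
  have hzero : ∑ i, residue R (algebraMap A R (MvPowerSeries.coeff (Finsupp.single i 1) f)) •
      (maximalIdeal R).toCotangent (y i) = 0 := by
    have h1 : (maximalIdeal R).toCotangent
        (∑ i, algebraMap A R (MvPowerSeries.coeff (Finsupp.single i 1) f) • y i) = 0 := by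
      rw [Ideal.toCotangent_eq_zero, AddSubmonoidClass.coe_finsetSum]
      exact hsum
    rw [map_sum] at h1
    rw [← h1]
    refine Finset.sum_congr rfl fun i _ => ?_
    rw [map_smul]
    rfl
  have hc := Fintype.linearIndependent_iff.1 hli _ hzero
  rw [← sub_add_cancel f (∑ i, MvPowerSeries.C (MvPowerSeries.coeff (Finsupp.single i 1) f) *
      MvPowerSeries.X i)]
  refine add_mem hlin (Ideal.sum_mem _ fun i _ => ?_)
  rw [hres0 _ (hc i), map_zero, zero_mul]
  exact zero_mem _

theorem exists_presentation_of_coefficientField [IsNoetherianRing R]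
    [IsAdicComplete (maximalIdeal R) R] (s : ResidueField R →+* R)
    (hs : ∀ a, residue R (s a) = a) :
    ∃ (_ : Algebra (ResidueField R) R) (n : ℕ)
      (q : MvPowerSeries (Fin n) (ResidueField R) →ₐ[ResidueField R] R),
      (∀ a : ResidueField R, residue R (algebraMap (ResidueField R) R a) = a) ∧
      n = Module.finrank (ResidueField R) (CotangentSpace R) ∧
      Function.Surjective q ∧ RingHom.ker q ≤ variablesIdeal (ResidueField R) n ^ 2 := by
  let b := Module.finBasis (ResidueField R) (CotangentSpace R)
  choose y hy using fun i => (maximalIdeal R).toCotangent_surjective (b i)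
  have hspan : maximalIdeal R ≤ Ideal.span (Set.range fun i => (y i : R)) := by
    have h1 : Submodule.span (ResidueField R)
        ((maximalIdeal R).toCotangent '' Set.range y) = ⊤ := by
      rw [← Set.range_comp, ← b.span_eq]
      congr 2
      ext1 i
      exact hy i
    have h2 := congrArg (Submodule.map (maximalIdeal R).subtype)
      (CotangentSpace.span_image_eq_top_iff.1 h1)
    rw [Submodule.map_span, ← Set.range_comp, Submodule.map_top, Submodule.range_subtype] at h2
    exact h2.ge
  have hli : LinearIndependent (ResidueField R) fun i => (maximalIdeal R).toCotangent (y i) := by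
    simp only [hy]
    exact b.linearIndependent
  let _ : Algebra (ResidueField R) R := s.toAlgebra
  refine ⟨s.toAlgebra, _, evalComplete (maximalIdeal R) (fun i => (y i : R)) (fun i => (y i).2), hs,
    rfl, evalComplete_surjective _ _ _ hspan fun r => ⟨residue R r, ?_⟩, ?_⟩
  · rw [← residue_eq_zero_iff, map_sub, sub_eq_zero]
    exact (hs _).symm
  · refine coeff_eq_zero_of_basis _ y (evalComplete_X _ _ _) (fun a b h => ?_) hli
    exact (hs a).symm.trans (h.trans (hs b))

theorem exists_presentation [IsNoetherianRing R] [IsAdicComplete (maximalIdeal R) R]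
    {V : Type*} [CommRing V] [Algebra V R]
    (hV : Function.Surjective fun v : V => residue R (algebraMap V R v)) :
    ∃ (n : ℕ) (q : MvPowerSeries (Fin n) V →ₐ[V] R), Function.Surjective q := by
  obtain ⟨n, y, hy⟩ := Submodule.fg_iff_exists_fin_generating_family.1
    (IsNoetherian.noetherian (maximalIdeal R))
  have hy' : Ideal.span (Set.range y) = maximalIdeal R := hy
  refine ⟨n, evalComplete (maximalIdeal R) y fun i => hy' ▸ Ideal.subset_span ⟨i, rfl⟩,
    evalComplete_surjective _ _ _ hy'.ge fun r => ?_⟩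
  obtain ⟨v, hv⟩ := hV (residue R r)
  refine ⟨v, ?_⟩
  rw [← residue_eq_zero_iff, map_sub, sub_eq_zero]
  exact hv.symm

/-- The characteristic of R maps to zero in the residue field. If that field had characteristic
zero, both characteristics would be zero. -/
theorem prime_ringChar_residueField (h : ringChar R ≠ ringChar (ResidueField R)) :
    (ringChar (ResidueField R)).Prime := by
  refine (CharP.char_is_prime_or_zero (ResidueField R) _).resolve_right fun h0 => h ?_
  rw [h0]
  have : ((ringChar R : ℕ) : ResidueField R) = 0 := by
    rw [← map_natCast (residue R), ringChar.Nat.cast_ringChar, map_zero]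
  rw [ringChar.spec, h0, zero_dvd_iff] at this
  exact this

end Presentation

/-! ### The deformation -/

section Deformation

theorem isCompleteLocalRing_of_field (k : Type*) [Field k] : IsCompleteLocalRing k := by
  rw [isCompleteLocalRing_iff, maximalIdeal_eq_bot]
  exact ⟨inferInstance, inferInstance⟩

theorem algebraMap_mem_maximalIdeal {A R : Type*} [CommRing A] [IsLocalRing A] [CommRing R]
    [IsLocalRing R] [Algebra A R] {n : ℕ} {ρ : MvPowerSeries (Fin n) A →ₐ[A] R}
    (hρ : Function.Surjective ρ) {a : A} (ha : a ∈ maximalIdeal A) :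
    algebraMap A R a ∈ maximalIdeal R := by
  rw [maximalIdeal_eq_map_of_surjective (ρ : MvPowerSeries (Fin n) A →+* R) hρ,
    maximalIdeal_mvPowerSeries, ← AlgHom.commutes ρ]
  exact Ideal.mem_map_of_mem _ (Ideal.mem_sup_left (Ideal.mem_map_of_mem _ ha))

theorem maximalIdeal_eq_map_variablesIdeal {k R : Type*} [Field k] [CommRing R] [IsLocalRing R]
    [Algebra k R] {n : ℕ} {q : MvPowerSeries (Fin n) k →ₐ[k] R} (hq : Function.Surjective q) :
    maximalIdeal R = (variablesIdeal k n).map q := by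
  rw [maximalIdeal_eq_map_of_surjective (q : MvPowerSeries (Fin n) k →+* R) hq,
    maximalIdeal_mvPowerSeries, bigIdeal, maximalIdeal_eq_bot, Ideal.map_bot, bot_sup_eq]
  rfl

variable {V : Type*} [CommRing V] [IsLocalRing V] [IsAdicComplete (maximalIdeal V) V] {p : ℕ}

/-- This is the purpose of the additional variable: with p among the images, the variables alone
generate the whole maximal ideal of Q. -/
theorem map_evalP_variablesIdeal (hp : maximalIdeal V = Ideal.span {(p : V)}) (n : ℕ) :
    (variablesIdeal V (n + 1)).map (evalP hp n) = bigIdeal V n := by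
  rw [bigIdeal, hp, Ideal.map_span, variablesIdeal, variablesIdeal, Ideal.map_span,
    ← Ideal.span_union, Set.image_singleton, ← Set.range_comp]
  congr 1
  ext f
  constructor
  · rintro ⟨i, rfl⟩
    refine Fin.cases ?_ (fun i => ?_) i
    · exact Or.inl (evalP_X_zero hp n)
    · exact Or.inr ⟨i, (evalP_X_succ hp n i).symm⟩
  · rintro (rfl | ⟨i, rfl⟩)
    · exact ⟨0, evalP_X_zero hp n⟩
    · exact ⟨i.succ, evalP_X_succ hp n i⟩

/-- The variables generate the maximal ideal of Q, and constants cover Q modulo it; completeness of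
S in the variables does the rest. -/
theorem evalP_surjective [IsNoetherianRing V] (hp : maximalIdeal V = Ideal.span {(p : V)})
    (n : ℕ) : Function.Surjective (evalP hp n) := by
  have hV : IsCompleteLocalRing V := isCompleteLocalRing_iff.2 ⟨inferInstance, inferInstance⟩
  have hQ := (isCompleteLocalRing_iff.1 (hV.mvPowerSeries n)).2
  have hmap : (variablesIdeal V (n + 1)).map (evalP hp n).toRingHom =
      maximalIdeal (MvPowerSeries (Fin n) V) := by
    rw [maximalIdeal_mvPowerSeries, ← map_evalP_variablesIdeal hp]
    rfl
  have hcomp : IsPrecomplete (variablesIdeal V (n + 1)) (MvPowerSeries (Fin (n + 1)) V) :=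
    (inferInstance : IsAdicComplete (Ideal.span (Set.range MvPowerSeries.X))
      (MvPowerSeries (Fin (n + 1)) V)).toIsPrecomplete
  have hhaus : IsHausdorff ((variablesIdeal V (n + 1)).map (evalP hp n).toRingHom)
      (MvPowerSeries (Fin n) V) := by
    rw [hmap]
    exact hQ.toIsHausdorff
  refine surjective_of_mk_map_comp_surjective (I := variablesIdeal V (n + 1))
    (evalP hp n).toRingHom fun z => ?_
  obtain ⟨f, rfl⟩ := Ideal.Quotient.mk_surjective z
  refine ⟨MvPowerSeries.C (MvPowerSeries.constantCoeff f), ?_⟩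
  rw [RingHom.comp_apply, eq_comm, Ideal.Quotient.eq, hmap,
    show (evalP hp n).toRingHom (MvPowerSeries.C (MvPowerSeries.constantCoeff f)) =
      MvPowerSeries.C (MvPowerSeries.constantCoeff f) from AlgHom.commutes (evalP hp n) _]
  exact variablesIdeal_le_maximalIdeal (sub_C_constantCoeff_mem f)

theorem maximalIdeal_eq_map_comp_evalP (hp : maximalIdeal V = Ideal.span {(p : V)}) {n : ℕ}
    {R : Type*} [CommRing R] [IsLocalRing R] [Algebra V R] {q : MvPowerSeries (Fin n) V →ₐ[V] R}
    (hq : Function.Surjective q) :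
    maximalIdeal R = (variablesIdeal V (n + 1)).map (q.comp (evalP hp n)) := by
  rw [maximalIdeal_eq_map_of_surjective (q : MvPowerSeries (Fin n) V →+* R) hq,
    maximalIdeal_mvPowerSeries, ← map_evalP_variablesIdeal hp]
  exact Ideal.map_map (evalP hp n).toRingHom q.toRingHom

end Deformation

end GroebnerDeformation

end

open GroebnerDeformation in
theorem theoremA (R : Type u) [CommRing R] [IsLocalRing R] [IsNoetherianRing R]
    [IsAdicComplete (maximalIdeal R) R] :
    -- equal characteristic
    (ringChar R = ringChar (ResidueField R) →
      -- `R` has a coefficient field and a presentation over it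
      (∃ (_ : Algebra (ResidueField R) R) (n : ℕ)
          (q : MvPowerSeries (Fin n) (ResidueField R) →ₐ[ResidueField R] R),
        (∀ a : ResidueField R, residue R (algebraMap (ResidueField R) R a) = a) ∧
        n = Module.finrank (ResidueField R) (CotangentSpace R) ∧
        Function.Surjective q ∧
        RingHom.ker q ≤ variablesIdeal (ResidueField R) n ^ 2) ∧
      -- every presentation `R = S / I`, `S = k[[x_1, ..., x_n]]`, gives a deformation
      (∀ (k : Type u) [Field k] [Algebra k R] (n : ℕ) (q : MvPowerSeries (Fin n) k →ₐ[k] R),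
        Function.Surjective q →
        IsCompleteLocalRing (HomRing (RingHom.ker q)) ∧
        tElt (RingHom.ker q) ∈ nonZeroDivisors (HomRing (RingHom.ker q)) ∧
        Module.Flat (PowerSeries k) (HomRing (RingHom.ker q)) ∧
        Nonempty ((HomRing (RingHom.ker q) ⧸ Ideal.span {tElt (RingHom.ker q)}) ≃ₐ[k]
          CompletedGraded (maximalIdeal R)) ∧
        Nonempty (CompletedGenericFiber (RingHom.ker q) ≃ₐ[LaurentSeries k]
          CompletedConstantFiber k R))) ∧
    -- mixed characteristic
    (ringChar R ≠ ringChar (ResidueField R) →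
      -- `R` has a presentation over an unramified complete discrete valuation ring
      (∃ (V : Type u) (_ : CommRing V) (_ : IsDomain V) (_ : IsDiscreteValuationRing V)
          (_ : Algebra V R) (n : ℕ) (q : MvPowerSeries (Fin n) V →ₐ[V] R),
        IsAdicComplete (maximalIdeal V) V ∧
        maximalIdeal V = Ideal.span {(ringChar (ResidueField R) : V)} ∧
        Function.Surjective (fun v : V => residue R (algebraMap V R v)) ∧
        Function.Surjective q) ∧
      -- every presentation `R = Q / I`, `Q = V[[x_2, ..., x_{n+1}]]`, gives a deformation
      (∀ (V : Type u) [CommRing V] [IsDomain V] [IsDiscreteValuationRing V]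
          [IsAdicComplete (maximalIdeal V) V] [Algebra V R]
          (hp : maximalIdeal V = Ideal.span {(ringChar (ResidueField R) : V)})
          (n : ℕ) (q : MvPowerSeries (Fin n) V →ₐ[V] R),
        Function.Surjective q →
        ∀ J : Ideal (MvPowerSeries (Fin (n + 1)) V),
          J = (RingHom.ker q).comap (evalP hp n) →
          IsCompleteLocalRing (HomRing J) ∧
          tElt J ∈ nonZeroDivisors (HomRing J) ∧
          Nonempty ((HomRing J ⧸ Ideal.span {tElt J}) ≃ₐ[V] CompletedGraded (maximalIdeal R)) ∧
          Nonempty (CompletedGenericFiber J ≃ₐ[LaurentSeries V] CompletedConstantFiber V R))) := by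
  refine ⟨fun h => ⟨?_, ?_⟩, fun h => ⟨?_, ?_⟩⟩
  · obtain ⟨s, hs⟩ := exists_coefficientField h
    exact exists_presentation_of_coefficientField s hs
  · intro k _ _ n q hq
    have hm := maximalIdeal_eq_map_variablesIdeal hq
    exact ⟨isCompleteLocalRing_homRing (isCompleteLocalRing_of_field k) (RingHom.ker_ne_top q),
      tElt_mem_nonZeroDivisors _, flat_homRing _, nonempty_specialFiber_equiv hm hq,
      nonempty_genericFiber_equiv hm hq fun _ => algebraMap_mem_maximalIdeal hq⟩
  · have : Fact (ringChar (ResidueField R)).Prime := ⟨prime_ringChar_residueField h⟩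
    obtain ⟨V, iV, iD, iDVR, f, h1, h2, h3⟩ :=
      exists_cohenRing (R := R) (ringChar (ResidueField R))
    let _ : Algebra V R := f.toAlgebra
    obtain ⟨n, q, hq⟩ := exists_presentation (R := R) (V := V) h3
    exact ⟨V, iV, iD, iDVR, f.toAlgebra, n, q, h1, h2, h3, hq⟩
  · intro V _ _ _ _ _ hp n q hq J hJ
    -- π⁻¹(I) is the kernel of q ∘ π, so the arguments of the equal characteristic case apply to
    -- this composite.
    obtain rfl : J = RingHom.ker (q.comp (evalP hp n)) := hJ
    have hρ : Function.Surjective (q.comp (evalP hp n)) := hq.comp (evalP_surjective hp n)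
    have hm := maximalIdeal_eq_map_comp_evalP hp hq
    have hV : IsCompleteLocalRing V := isCompleteLocalRing_iff.2 ⟨inferInstance, inferInstance⟩
    exact ⟨isCompleteLocalRing_homRing hV (RingHom.ker_ne_top _), tElt_mem_nonZeroDivisors _,
      nonempty_specialFiber_equiv hm hρ,
      nonempty_genericFiber_equiv hm hρ fun _ => algebraMap_mem_maximalIdeal hρ⟩
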